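/- A regular metric tree $\Gamma$ is the rooted metric tree with root $o$ given by integers $b_0=1$, $b_n\ge 2$ ($n\ge1$) and reals $0=t_0<t_1<t_2<\dots$, $t_n\to\infty$: every vertex of generation $n$ lies at distance $t_n$ from $o$ and has $b_n$ emanating edges. Write $|x|$ for the distance from $x$ to $o$, $dx$ for the measure on $\Gamma$ induced by Lebesgue measure on the edges, and $g_0(t)=b_0b_1\cdots b_n$ for $t_n<t\le t_{n+1}$, $n\ge0$. The tree has global dimension $d\ge1$ if $c_1(1+t)^{d-1}\le g_0(t)\le c_2(1+t)^{d-1}$ for all $t>0$, with some constants $0<c_1<c_2$. Let $H^{1,0}(\Gamma)$ be the space of continuous $u:\Gamma\to\mathbb C$ with $u(o)=0$, whose restriction to every edge $e$ is in $H^1(e)$, and $\int_\Gamma(|u'|^2+|u|^2)\,dx<\infty$. For $V\ge0$ and $\alpha>0$, $H_{\alpha V}$ denotes the operator in $L_2(\Gamma)$ generated by the quadratic form $\int_\Gamma(|u'|^2-\alpha V|u|^2)\,dx$, $u\in H^{1,0}(\Gamma)$, and $N_-(H_{\alpha V})$ is the number of its negative eigenvalues counted with multiplicities. For a measure $\mu$,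 $f\in L_{p,w}(\mu)$ means that $f$ is measurable and $\sup_{t>0}t\,\mu\{|f|>t\}^{1/p}<\infty$; $L_p(\Gamma,|x|^{-1})$ and $L_{p,w}(\Gamma,|x|^{-1})$ are taken with respect to the measure $|x|^{-1}dx$. **Theorem.** Let $\Gamma$ be a regular metric tree of global dimension $d\ne2$ and let $p>1$. There is a constant $C>0$, depending only on $\Gamma$ and $p$, such that for every measurable $V\ge0$ on $\Gamma$ the following holds. 1. Suppose $V|x|^2\in L_{p,w}(\Gamma,|x|^{-1})$. Then for every $\alpha>0$ the quadratic form above is finite on $H^{1,0}(\Gamma)$ and bounded below, the operator $H_{\alpha V}$ is self-adjoint with finite negative spectrum, and $$N_-(H_{\alpha V})\le C\alpha^p\sup_{t>0}\Bigl(t^p\int_{V(x)|x|^2>t}|x|^{-1}dx\Bigr).$$ Moreover, $$\limsup_{\alpha\to\infty}\alpha^{-p}N_-(H_{\alpha V})\le C\limsup_{t+t^{-1}\to\infty}\Bigl(t^p\int_{V(x)|x|^2>t}|x|^{-1}dx\Bigr).$$ In particular, if $\int_{V(x)|x|^2>t}|x|^{-1}dx=o(t^{-p})$ as $t+t^{-1}\to\infty$,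 then $N_-(H_{\alpha V})=o(\alpha^p)$ as $\alpha\to\infty$. 2. Suppose $V|x|^2\in L_p(\Gamma,|x|^{-1})$. Then $$N_-(H_{\alpha V})\le C\alpha^p\int_\Gamma V^p|x|^{2p-1}dx\quad\text{for all }\alpha>0,\qquad N_-(H_{\alpha V})=o(\alpha^p)\ \text{ as }\alpha\to\infty.$$ -/

import Mathlib

open MeasureTheory Filter Topology
open scoped ENNReal ComplexConjugate

noncomputable section

/-! ### Unbounded operators -/

section UnboundedOperators

variable {E : Type*} [NormedAddCommGroup E] [InnerProductSpace ℂ E]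

/-- The eigenspace `ker (H - z)` of an unbounded operator `H`, inside the domain of `H`. -/
def opEigenspace (H : E →ₗ.[ℂ] E) (z : ℂ) : Submodule ℂ H.domain :=
  LinearMap.ker (H.toFun - z • H.domain.subtype)

/-- The number of negative eigenvalues of `H`, counted with multiplicities: the sum of the
dimensions of `ker (H - l)` over all real `l < 0`. It is allowed to be infinite. -/
def negEigenvalueCount (H : E →ₗ.[ℂ] E) : ℝ≥0∞ :=
  ∑' l : Set.Iio (0 : ℝ),
    ((Cardinal.toENat (Module.rank ℂ (opEigenspace H ((l : ℝ) : ℂ))) : ℕ∞) : ℝ≥0∞)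

/-- The spectrum of an unbounded operator: the `z` for which `H - z` has no bounded everywhere
defined two-sided inverse. -/
def opSpectrum (H : E →ₗ.[ℂ] E) : Set ℂ :=
  {z | ¬ ∃ R : E →L[ℂ] E,
    (∀ f : E, ∃ h : R f ∈ H.domain, H ⟨R f, h⟩ - z • R f = f) ∧
    ∀ u : H.domain, R (H u - z • (u : E)) = u}

/-- The negative spectrum of `H` is finite: it has finitely many points, and the negative
eigenvalues have finite total multiplicity. -/
def HasFiniteNegativeSpectrum (H : E →ₗ.[ℂ] E) : Prop :=
  {l : ℝ | l < 0 ∧ (l : ℂ) ∈ opSpectrum H}.Finite ∧ negEigenvalueCount H < ∞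

end UnboundedOperators

/-! ### Weak Lebesgue spaces -/

/-- Membership in the weak `L_p` space: `f` is measurable and
`sup_{t > 0} t * μ {|f| > t} ^ (1 / p)` is finite. -/
def MemWeakLp {X : Type*} [MeasurableSpace X] (f : X → ℝ) (p : ℝ) (μ : Measure X) : Prop :=
  AEStronglyMeasurable f μ ∧
    (⨆ t : {t : ℝ // 0 < t}, ENNReal.ofReal t * (μ {x | (t : ℝ) < |f x|}) ^ (1 / p)) < ∞

/-! ### Regular metric trees -/

/-- A regular rooted metric tree, given by its two defining sequences: every vertex of generation
`n` is at distance `t n` from the root and has `b n` emanating edges. -/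
structure RegularTree where
  /-- branching numbers -/
  b : ℕ → ℕ
  /-- distances of the vertices from the root -/
  t : ℕ → ℝ
  b_zero : b 0 = 1
  one_lt_b : ∀ n, n ≠ 0 → 1 < b n
  t_zero : t 0 = 0
  t_strictMono : StrictMono t
  t_unbounded : Tendsto t atTop atTop

namespace RegularTree

variable (Γ : RegularTree)

/-- A vertex of generation `n`: the list of the choices made at the vertices of generations
`0, …, n - 1` on the way from the root. -/
def Vertex (n : ℕ) : Type := (k : Fin n) → Fin (Γ.b k)

/-- The lower endpoint of the edge with upper endpoint `v`. -/
def lower {n : ℕ} (v : Γ.Vertex (n + 1)) : Γ.Vertex n := fun k => v k.castSucc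

/-- An edge goes from a vertex of generation `gen` to a vertex `top` of generation `gen + 1`;
edges correspond to their upper endpoints. -/
structure Edge where
  gen : ℕ
  top : Γ.Vertex (gen + 1)

instance : MeasurableSpace Γ.Edge := ⊤

/-- The points of the tree: a pair `(e, s)`, `e` an edge of generation `n`, is the point of `e` at
distance `s` from the root, where `t n < s ≤ t (n + 1)`; so every vertex other than the root is
listed once, as the upper endpoint of an edge. The root is the point `(e, 0)` of the only edge of
generation `0`. -/
structure Point where
  edge : Γ.Edge
  pos : ℝ
  pos_le : pos ≤ Γ.t (edge.gen + 1)
  lt_pos : Γ.t edge.gen < pos ∨ (edge.gen = 0 ∧ pos = 0)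

instance : MeasurableSpace Γ.Point :=
  MeasurableSpace.comap (fun x : Γ.Point => (x.edge, x.pos)) inferInstance

variable {Γ}

/-- `|x|`, the distance of the point `x` from the root. -/
def Point.abs (x : Γ.Point) : ℝ := x.pos

variable (Γ)

/-- The root. -/
def root : Γ.Point where
  edge := ⟨0, fun k => ⟨0, by
    have hk : (k : ℕ) = 0 := by omega
    rw [hk, Γ.b_zero]; exact Nat.one_pos⟩⟩
  pos := 0
  pos_le := by
    have h := Γ.t_strictMono (Nat.lt_succ_self 0)
    rw [Γ.t_zero] at h
    exact h.le
  lt_pos := Or.inr ⟨rfl, rfl⟩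

/-- The nearest point to `s` in the interval `[t n, t (n + 1)]`. -/
def clamp (n : ℕ) (s : ℝ) : ℝ := max (Γ.t n) (min s (Γ.t (n + 1)))

theorem clamp_le (n : ℕ) (s : ℝ) : Γ.clamp n s ≤ Γ.t (n + 1) :=
  max_le (Γ.t_strictMono (Nat.lt_succ_self n)).le (min_le_right _ _)

theorem le_clamp (n : ℕ) (s : ℝ) : Γ.t n ≤ Γ.clamp n s := le_max_left _ _

/-- The parametrization of the closed edge `e` of generation `n` by the distance `s` from the root,
`t n ≤ s ≤ t (n + 1)`; values of `s` outside this interval are moved to its nearest endpoint. The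
lower endpoint of an edge of positive generation is the upper endpoint of the preceding edge. -/
def edgePoint : Γ.Edge → ℝ → Γ.Point
  | ⟨0, v⟩, s => ⟨⟨0, v⟩, Γ.clamp 0 s, Γ.clamp_le 0 s, by
      rcases (Γ.le_clamp 0 s).lt_or_eq with h | h
      · exact Or.inl h
      · exact Or.inr ⟨rfl, by rw [← h, Γ.t_zero]⟩⟩
  | ⟨n + 1, v⟩, s =>
      if h : Γ.t (n + 1) < Γ.clamp (n + 1) s then
        ⟨⟨n + 1, v⟩, Γ.clamp (n + 1) s, Γ.clamp_le (n + 1) s, Or.inl h⟩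
      else
        ⟨⟨n, Γ.lower v⟩, Γ.t (n + 1), le_rfl, Or.inl (Γ.t_strictMono (Nat.lt_succ_self n))⟩

theorem measurable_clamp (n : ℕ) : Measurable (Γ.clamp n) :=
  measurable_const.max (measurable_id.min measurable_const)

theorem measurable_edgePoint (e : Γ.Edge) : Measurable (Γ.edgePoint e) := by
  rw [measurable_comap_iff]
  obtain ⟨n, v⟩ := e
  cases n with
  | zero => exact measurable_const.prodMk (Γ.measurable_clamp 0)
  | succ n =>
    have : ((fun x : Γ.Point => (x.edge, x.pos)) ∘ Γ.edgePoint ⟨n + 1, v⟩) = fun s =>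
        if Γ.t (n + 1) < Γ.clamp (n + 1) s then
          ((⟨n + 1, v⟩ : Γ.Edge), Γ.clamp (n + 1) s)
        else ((⟨n, Γ.lower v⟩ : Γ.Edge), Γ.t (n + 1)) := by
      funext s
      by_cases h : Γ.t (n + 1) < Γ.clamp (n + 1) s <;> simp [edgePoint, h]
    rw [this]
    exact Measurable.ite (measurableSet_lt measurable_const (Γ.measurable_clamp (n + 1)))
      (measurable_const.prodMk (Γ.measurable_clamp (n + 1))) measurable_const

/-- The parameter is the distance from the root. -/
theorem abs_edgePoint (e : Γ.Edge) {s : ℝ} (hs : s ∈ Set.Icc (Γ.t e.gen) (Γ.t (e.gen + 1))) :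
    (Γ.edgePoint e s).abs = s := by
  obtain ⟨n, v⟩ := e
  have hc : Γ.clamp n s = s := by
    unfold clamp
    rw [min_eq_left hs.2, max_eq_right hs.1]
  cases n with
  | zero => exact hc
  | succ n =>
    by_cases h : Γ.t (n + 1) < Γ.clamp (n + 1) s
    · simp only [edgePoint, h, dif_pos, Point.abs]; exact hc
    · have hs1 : Γ.t (n + 1) ≤ s := hs.1
      simp only [edgePoint, h, dite_false, Point.abs]
      rw [hc] at h
      exact le_antisymm hs1 (not_lt.mp h)

/-- The natural measure `dx` on the tree, induced by the Lebesgue measure on the edges. -/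
instance : MeasureSpace Γ.Point where
  volume := Measure.sum fun e : Γ.Edge =>
    (volume.restrict (Set.Icc (Γ.t e.gen) (Γ.t (e.gen + 1)))).map (Γ.edgePoint e)

/-- The measure `|x|⁻¹ dx`. -/
def invAbsMeasure : Measure Γ.Point :=
  (volume : Measure Γ.Point).withDensity fun x => ENNReal.ofReal x.abs⁻¹

/-- The branching function: `g₀(s) = b 0 * b 1 * ⋯ * b n` for `t n < s ≤ t (n + 1)`. -/
def branching (s : ℝ) : ℝ := ∏ k ∈ Finset.range (sInf {m : ℕ | s ≤ Γ.t m}), (Γ.b k : ℝ)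

theorem branching_eq (n : ℕ) {s : ℝ} (hs : s ∈ Set.Ioc (Γ.t n) (Γ.t (n + 1))) :
    Γ.branching s = ∏ k ∈ Finset.range (n + 1), (Γ.b k : ℝ) := by
  have h : sInf {m : ℕ | s ≤ Γ.t m} = n + 1 := by
    apply le_antisymm (Nat.sInf_le hs.2)
    have hm : s ≤ Γ.t (sInf {m : ℕ | s ≤ Γ.t m}) :=
      Nat.sInf_mem (s := {m : ℕ | s ≤ Γ.t m}) ⟨n + 1, hs.2⟩
    exact Γ.t_strictMono.lt_iff_lt.mp (hs.1.trans_le hm)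
  rw [branching, h]

/-- `d` is the global dimension of the tree. -/
def HasGlobalDimension (d : ℝ) : Prop :=
  1 ≤ d ∧ ∃ c₁ c₂ : ℝ, 0 < c₁ ∧ c₁ < c₂ ∧ ∀ s : ℝ, 0 < s →
    c₁ * (1 + s) ^ (d - 1) ≤ Γ.branching s ∧ Γ.branching s ≤ c₂ * (1 + s) ^ (d - 1)

/-- `u` belongs to the Sobolev space `H^{1,0}` of the tree and `w` is its derivative (in the
direction away from the root; it is determined almost everywhere): `u` is continuous on the tree,
absolutely continuous with derivative `w` on every closed edge, `u` and `w` are square integrable,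
and `u` vanishes at the root. As the tree is locally finite, continuity on the tree is continuity
along every closed edge. -/
structure IsSobolev (u w : Γ.Point → ℂ) : Prop where
  continuous : ∀ e : Γ.Edge, Continuous fun s => u (Γ.edgePoint e s)
  intervalIntegrable : ∀ e : Γ.Edge,
    IntervalIntegrable (fun s => w (Γ.edgePoint e s)) volume (Γ.t e.gen) (Γ.t (e.gen + 1))
  eq_integral : ∀ e : Γ.Edge, ∀ s ∈ Set.Icc (Γ.t e.gen) (Γ.t (e.gen + 1)),
    u (Γ.edgePoint e s) =
      u (Γ.edgePoint e (Γ.t e.gen)) + ∫ r in (Γ.t e.gen)..s, w (Γ.edgePoint e r)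
  memLp : MemLp u 2 volume
  memLp_deriv : MemLp w 2 volume
  root_eq_zero : u Γ.root = 0

variable {Γ}

theorem IsSobolev.zero : Γ.IsSobolev 0 0 where
  continuous _ := continuous_const
  intervalIntegrable _ := by simp
  eq_integral _ _ _ := by simp
  memLp := MemLp.zero
  memLp_deriv := MemLp.zero
  root_eq_zero := rfl

theorem IsSobolev.add {u w u' w' : Γ.Point → ℂ} (h : Γ.IsSobolev u w) (h' : Γ.IsSobolev u' w') :
    Γ.IsSobolev (u + u') (w + w') where
  continuous e := (h.continuous e).add (h'.continuous e)
  intervalIntegrable e := (h.intervalIntegrable e).add (h'.intervalIntegrable e)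
  eq_integral e s hs := by
    have hsub : Set.uIcc (Γ.t e.gen) s ⊆ Set.uIcc (Γ.t e.gen) (Γ.t (e.gen + 1)) := by
      rw [Set.uIcc_of_le hs.1, Set.uIcc_of_le (hs.1.trans hs.2)]
      exact Set.Icc_subset_Icc_right hs.2
    simp only [Pi.add_apply]
    rw [intervalIntegral.integral_add ((h.intervalIntegrable e).mono_set hsub)
      ((h'.intervalIntegrable e).mono_set hsub), h.eq_integral e s hs, h'.eq_integral e s hs]
    ring
  memLp := h.memLp.add h'.memLp
  memLp_deriv := h.memLp_deriv.add h'.memLp_deriv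
  root_eq_zero := by simp [h.root_eq_zero, h'.root_eq_zero]

theorem IsSobolev.smul (c : ℂ) {u w : Γ.Point → ℂ} (h : Γ.IsSobolev u w) :
    Γ.IsSobolev (c • u) (c • w) where
  continuous e := (h.continuous e).const_smul c
  intervalIntegrable e := (h.intervalIntegrable e).smul c
  eq_integral e s hs := by
    simp only [Pi.smul_apply]
    rw [intervalIntegral.integral_smul, h.eq_integral e s hs, smul_add]
  memLp := h.memLp.const_smul c
  memLp_deriv := h.memLp_deriv.const_smul c
  root_eq_zero := by simp [h.root_eq_zero]

variable (Γ)

/-- The Hilbert space `L₂` of the tree. -/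
abbrev L2 : Type := Lp ℂ 2 (volume : Measure Γ.Point)

/-- The graph of the operator generated by the quadratic form `∫ (|u'|² - W |u|²) dx` with domain
`H^{1,0}`: the pairs `(u, g)` with `u` in `H^{1,0}` and
`∫ (u' φ'⁻ - W u φ⁻) dx = ∫ g φ⁻ dx` for all `φ` in `H^{1,0}` (`⁻` is complex conjugation). -/
def schrodingerGraph (W : Γ.Point → ℝ) : Submodule ℂ (Γ.L2 × Γ.L2) where
  carrier := {fg | ∃ u w : Γ.Point → ℂ, Γ.IsSobolev u w ∧ fg.1 =ᵐ[volume] u ∧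
    ∀ φ ψ : Γ.Point → ℂ, Γ.IsSobolev φ ψ →
      Integrable (fun x => (W x : ℂ) * u x * conj (φ x)) ∧
      ∫ x, (w x * conj (ψ x) - (W x : ℂ) * u x * conj (φ x)) = ∫ x, fg.2 x * conj (φ x)}
  zero_mem' := by
    refine ⟨0, 0, IsSobolev.zero, Lp.coeFn_zero _ _ _, fun φ ψ _ => ⟨by simp, ?_⟩⟩
    have h : (fun x => (0 : Γ.L2) x * conj (φ x)) =ᵐ[volume] fun _ => 0 := by
      filter_upwards [Lp.coeFn_zero ℂ 2 (volume : Measure Γ.Point)] with x hx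
      rw [hx]; simp
    rw [Prod.snd_zero, integral_congr_ae h]
    simp
  add_mem' := by
    rintro ⟨f, g⟩ ⟨f', g'⟩ ⟨u, w, hu, hf, h⟩ ⟨u', w', hu', hf', h'⟩
    refine ⟨u + u', w + w', hu.add hu', (Lp.coeFn_add f f').trans (hf.add hf'),
      fun φ ψ hφ => ?_⟩
    obtain ⟨hi, he⟩ := h φ ψ hφ
    obtain ⟨hi', he'⟩ := h' φ ψ hφ
    have hψ : MemLp (fun x => conj (ψ x)) 2 volume := hφ.memLp_deriv.star
    have hφ' : MemLp (fun x => conj (φ x)) 2 volume := hφ.memLp.star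
    have k : Integrable fun x => w x * conj (ψ x) := hu.memLp_deriv.integrable_mul hψ
    have k' : Integrable fun x => w' x * conj (ψ x) := hu'.memLp_deriv.integrable_mul hψ
    have l : Integrable fun x => g x * conj (φ x) := (Lp.memLp g).integrable_mul hφ'
    have l' : Integrable fun x => g' x * conj (φ x) := (Lp.memLp g').integrable_mul hφ'
    refine ⟨(hi.add hi').congr (Eventually.of_forall fun x => ?_), ?_⟩
    · simp only [Pi.add_apply]; ring
    · have e1 : (fun x => (g + g' : Γ.L2) x * conj (φ x)) =ᵐ[volume]
          fun x => g x * conj (φ x) + g' x * conj (φ x) := by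
        filter_upwards [Lp.coeFn_add g g'] with x hx
        rw [hx, Pi.add_apply, add_mul]
      have e2 : (fun x => (w + w') x * conj (ψ x) - (W x : ℂ) * (u + u') x * conj (φ x)) =
          fun x => (w x * conj (ψ x) - (W x : ℂ) * u x * conj (φ x)) +
            (w' x * conj (ψ x) - (W x : ℂ) * u' x * conj (φ x)) := by
        funext x
        simp only [Pi.add_apply]; ring
      simp only [Prod.mk_add_mk]
      rw [e2, integral_congr_ae e1, integral_add l l']
      exact (integral_add (k.sub hi) (k'.sub hi')).trans (congrArg₂ (· + ·) he he')
  smul_mem' := by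
    rintro c ⟨f, g⟩ ⟨u, w, hu, hf, h⟩
    refine ⟨c • u, c • w, hu.smul c, (Lp.coeFn_smul c f).trans (hf.const_smul c),
      fun φ ψ hφ => ?_⟩
    obtain ⟨hi, he⟩ := h φ ψ hφ
    refine ⟨(hi.const_mul c).congr (Eventually.of_forall fun x => ?_), ?_⟩
    · simp only [Pi.smul_apply, smul_eq_mul]; ring
    · have e1 : (fun x => (c • g : Γ.L2) x * conj (φ x)) =ᵐ[volume]
          fun x => c * (g x * conj (φ x)) := by
        filter_upwards [Lp.coeFn_smul c g] with x hx
        rw [hx, Pi.smul_apply, smul_eq_mul, mul_assoc]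
      have e2 : (fun x => (c • w) x * conj (ψ x) - (W x : ℂ) * (c • u) x * conj (φ x)) =
          fun x => c * (w x * conj (ψ x) - (W x : ℂ) * u x * conj (φ x)) := by
        funext x
        simp only [Pi.smul_apply, smul_eq_mul]; ring
      simp only [Prod.smul_mk]
      rw [e2, integral_congr_ae e1, integral_const_mul, integral_const_mul]
      exact congrArg (c * ·) he

/-- The Schrödinger operator `-Δ - W` with the Dirichlet condition at the root, as an unbounded
operator in `L₂` of the tree, generated by the quadratic form `∫ (|u'|² - W |u|²) dx` on
`H^{1,0}`. -/
def schrodinger (W : Γ.Point → ℝ) : Γ.L2 →ₗ.[ℂ] Γ.L2 := (Γ.schrodingerGraph W).toLinearPMap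

/-- The quadratic form `∫ (|u'|² - W |u|²) dx` is finite on `H^{1,0}` and bounded below. -/
def FormBoundedBelow (W : Γ.Point → ℝ) : Prop :=
  ∃ m : ℝ, ∀ u w : Γ.Point → ℂ, Γ.IsSobolev u w →
    Integrable (fun x => W x * ‖u x‖ ^ 2) ∧
    m * ∫ x, ‖u x‖ ^ 2 ≤ ∫ x, (‖w x‖ ^ 2 - W x * ‖u x‖ ^ 2)

/-- `∫_{V |x|² > s} |x|⁻¹ dx`. -/
def levelIntegral (V : Γ.Point → ℝ) (s : ℝ) : ℝ≥0∞ :=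
  ∫⁻ x in {x : Γ.Point | s < V x * x.abs ^ 2}, ENNReal.ofReal x.abs⁻¹

/-- `N_-(-Δ - a V)`, the number of negative eigenvalues as a function of the coupling
constant `a`. -/
def negCount (V : Γ.Point → ℝ) (a : ℝ) : ℝ≥0∞ :=
  negEigenvalueCount (Γ.schrodinger fun x => a * V x)

end RegularTree

end

/-! Put `f = V|x|²` and `dμ = |x|⁻¹ dx`. Two inequalities for Sobolev functions on the tree divide
the potential `W = αV` between them. The Hardy inequality `∫ |u|²|x|⁻² dx ≤ C ∫ |u'|² dx`
(`HasGlobalDimension.exists_hardy`) makes the part where `W|x|² ≤ ε` harmless: for `ε = 1/(4C)` it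
costs a quarter of the Dirichlet integral. On the rest a trace bound works. As `u(o) = 0`,
Cauchy-Schwarz along the path from the root shows that evaluation at `x` has norm at most
`|x|^(1/2)` in the Dirichlet norm. By Bessel's inequality `∑ |u_i(x)|² ≤ |x|` whenever the
derivatives `u_i'` are orthonormal, and integration against the potential bounds the dimension of
any subspace on which it dominates the Dirichlet integral (`IsSqrtMul.finrank_le`). Together they
give `N₋ ≤ 2 ∫_{W|x|² > ε} W|x| dx` (`HasGlobalDimension.exists_spectral`).

In terms of `f` the right side is `2α ∫_{f > ε/α} f dμ`. For `f` in weak `L_p` with `p > 1`, the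
layer cake formula bounds it by a multiple of `α (ε/α)^(1-p) sup_t t^p μ{f > t}`, which is of order
`α^p`. Levels above a fixed `δ` contribute only `O(α) = o(α^p)`, so the upper limit sees only the
distribution function near zero (`limsup_le_of_tail_bound`). For `f` in `L_p`, the inequality `f ≤
s^(1-p) f^p` on `{f > s}` gives the bound, and dominated convergence gives `o(α^p)`.

The Hardy inequality is reduced to the half-line. A uniformly random ray passes through a given edge
of generation `n` with probability `1/(b_0⋯b_n)`, so the integral over the tree is the mean of the
integrals along rays with weight `g₀` (`lintegral_eq_lintegral_ray`). On a ray this weight is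
comparable to `(1+t)^(d-1)`. For `d < 2` one integrates `u'` from the root (`hardy_zero`); for `d >
2` from infinity (`hardy_infinity`), as `u` takes arbitrarily small values far out on almost every
ray. At `d = 2` both constants blow up.

On the operator side, `H^{1,0}` is a Hilbert space on which the form is represented by the bounded
self-adjoint operator `D*D - S*S`, with `D` the derivative and `S` multiplication by the square root
of the potential. Eigenvectors with negative eigenvalues span a space on which the form is
nonpositive, and a negative number that is not an eigenvalue lies in the resolvent set by
`isUnit_of_finrank_le`. -/

noncomputable section

/-! ### Operators generated by closed quadratic forms -/

section FormOperators

open ContinuousLinearMap in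
/-- A self-adjoint bounded operator is invertible if it is injective and the dimensions of the
subspaces on which its quadratic form is at most `γ ‖z‖²` are bounded. -/
theorem isUnit_of_finrank_le {Q : Type*} [NormedAddCommGroup Q] [InnerProductSpace ℂ Q]
    [CompleteSpace Q] {A : Q →L[ℂ] Q} (hA : IsSelfAdjoint A) (hinj : Function.Injective A)
    {γ : ℝ} (hγ : 0 < γ) {N : ℕ}
    (hN : ∀ L : Submodule ℂ Q, FiniteDimensional ℂ L →
      (∀ z ∈ L, (inner ℂ (A z) z).re ≤ γ * ‖z‖ ^ 2) → Module.finrank ℂ L ≤ N) :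
    IsUnit A := by
  have hsym : ∀ x y, inner ℂ (A x) y = inner ℂ x (A y) := hA.isSymmetric
  -- `L` is chosen of maximal dimension among the subspaces on which the form of `A - γ` is
  -- nonpositive.
  let S : Set ℕ := {n | ∃ L : Submodule ℂ Q, FiniteDimensional ℂ L ∧
      (∀ z ∈ L, (inner ℂ (A z) z).re ≤ γ * ‖z‖ ^ 2) ∧ Module.finrank ℂ L = n}
  have hS : S.Nonempty := ⟨0, ⊥, inferInstance, by simp, by simp⟩
  have hSb : BddAbove S := ⟨N, by rintro n ⟨L, h1, h2, rfl⟩; exact hN L h1 h2⟩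
  obtain ⟨L, hLf, hL, hLn⟩ := Nat.sSup_mem hS hSb
  -- For `z` orthogonal to `F = (A - γ)L`, the cross terms between `z` and `L` in the form of `A -
  -- γ` vanish.
  let F : Submodule ℂ Q := L.map ((A - (γ : ℂ) • (1 : Q →L[ℂ] Q) : Q →L[ℂ] Q) : Q →ₗ[ℂ] Q)
  have hFf : FiniteDimensional ℂ F := inferInstance
  have horth : ∀ z ∈ Fᗮ, ∀ y ∈ L, inner ℂ (A y) z = (γ : ℂ) * inner ℂ y z := by
    intro z hz y hy
    have : inner ℂ (A y - (γ : ℂ) • y) z = 0 :=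
      (Submodule.mem_orthogonal _ _).1 hz _ ⟨y, hy, by simp⟩
    rw [inner_sub_left, inner_smul_left, sub_eq_zero] at this
    simpa using this
  -- If `A - γ` were negative at such a `z`, then `z ∉ L` and `L + span z` would be admissible,
  -- against maximality.
  have key : ∀ z ∈ Fᗮ, γ * ‖z‖ ^ 2 ≤ (inner ℂ (A z) z).re := by
    intro z hz
    by_contra! hlt
    have hzL : z ∉ L := by
      intro hzL
      have := horth z hz z hzL
      rw [this, inner_self_eq_norm_sq_to_K, Complex.re_ofReal_mul] at hlt
      norm_cast at hlt
      exact absurd hlt (lt_irrefl _)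
    have hmem : Module.finrank ℂ (L ⊔ Submodule.span ℂ {z} : Submodule ℂ Q) ∈ S := by
      refine ⟨_, inferInstance, ?_, rfl⟩
      intro x hx
      obtain ⟨y, hy, x', hx', rfl⟩ := Submodule.mem_sup.1 hx
      obtain ⟨c, rfl⟩ := Submodule.mem_span_singleton.1 hx'
      have e1 : (inner ℂ (A (y + c • z)) (y + c • z)).re - γ * ‖y + c • z‖ ^ 2 =
          ((inner ℂ (A y) y).re - γ * ‖y‖ ^ 2)
            + ‖c‖ ^ 2 * ((inner ℂ (A z) z).re - γ * ‖z‖ ^ 2) := by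
        have h1 := horth z hz y hy
        have h2 : inner ℂ (A z) y = (γ : ℂ) * inner ℂ z y := by
          rw [hsym, ← inner_conj_symm, h1, map_mul, inner_conj_symm, Complex.conj_ofReal]
        have n1 : ∀ v : Q, γ * ‖v‖ ^ 2 = ((γ : ℂ) * inner ℂ v v).re := by
          intro v
          rw [inner_self_eq_norm_sq_to_K, Complex.re_ofReal_mul]; norm_cast
        have n2 : ‖c‖ ^ 2 * ((inner ℂ (A z) z).re - γ * ‖z‖ ^ 2) =
            (conj c * c * (inner ℂ (A z) z - (γ : ℂ) * inner ℂ z z)).re := by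
          rw [← Complex.normSq_eq_conj_mul_self, Complex.re_ofReal_mul,
            Complex.normSq_eq_norm_sq, Complex.sub_re, n1]
        rw [n2, n1, n1, ← Complex.sub_re, ← Complex.sub_re, ← Complex.add_re]
        congr 1
        simp only [map_add, map_smul, inner_add_left, inner_add_right, inner_smul_left,
          inner_smul_right, h1, h2]
        ring
      have h3 := hL y hy
      have h4 : ‖c‖ ^ 2 * ((inner ℂ (A z) z).re - γ * ‖z‖ ^ 2) ≤ 0 :=
        mul_nonpos_of_nonneg_of_nonpos (by positivity) (by linarith)
      linarith
    have h5 := le_csSup hSb hmem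
    rw [← hLn] at h5
    have h6 : L < L ⊔ Submodule.span ℂ {z} := by
      refine lt_of_le_of_ne le_sup_left fun h => hzL ?_
      rw [h]
      exact Submodule.mem_sup_right (Submodule.mem_span_singleton_self z)
    exact absurd (Submodule.finrank_lt_finrank_of_lt h6) (not_lt.2 h5)
  have hbd : ∀ z ∈ Fᗮ, γ * ‖z‖ ≤ ‖A z‖ := by
    intro z hz
    have h1 := key z hz
    have h2 : (inner ℂ (A z) z).re ≤ ‖A z‖ * ‖z‖ := re_inner_le_norm (𝕜 := ℂ) (A z) z
    rcases (norm_nonneg z).eq_or_lt with h | h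
    · rw [← h]; simp
    · refine le_of_mul_le_mul_right ?_ h
      nlinarith
  -- On `Fᗮ` the operator is bounded below, so the image is closed; adding the finite-dimensional `A
  -- F` keeps it closed.
  have hclosed : IsClosed ((Fᗮ.map (A : Q →ₗ[ℂ] Q) : Submodule ℂ Q) : Set Q) := by
    have hanti : AntilipschitzWith γ.toNNReal⁻¹ (A.comp Fᗮ.subtypeL) := by
      refine ContinuousLinearMap.antilipschitz_of_bound _ fun z => ?_
      have := hbd z z.2
      rw [NNReal.coe_inv, Real.coe_toNNReal _ hγ.le, inv_mul_eq_div, le_div_iff₀ hγ, mul_comm]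
      simpa using this
    have h1 := hanti.isClosed_range (A.comp Fᗮ.subtypeL).uniformContinuous
    convert h1 using 1
    ext x
    simp
  have hrange : (LinearMap.range (A : Q →ₗ[ℂ] Q)) =
      Fᗮ.map (A : Q →ₗ[ℂ] Q) ⊔ F.map (A : Q →ₗ[ℂ] Q) := by
    rw [← Submodule.map_sup, sup_comm, Submodule.sup_orthogonal_of_hasOrthogonalProjection,
      Submodule.map_top]
  have hcl : IsClosed (LinearMap.range (A : Q →ₗ[ℂ] Q) : Set Q) := by
    rw [hrange]
    exact Submodule.isClosed_sup_finiteDimensional _ _ hclosed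
  -- A vector orthogonal to the range of a self-adjoint operator lies in its kernel, which is zero.
  have htop : LinearMap.range (A : Q →ₗ[ℂ] Q) = ⊤ := by
    rw [← hcl.submodule_topologicalClosure_eq,
      Submodule.topologicalClosure_eq_top_iff, Submodule.eq_bot_iff]
    intro x hx
    apply hinj
    rw [map_zero, ← inner_self_eq_zero (𝕜 := ℂ), hsym, ← inner_conj_symm,
      (Submodule.mem_orthogonal _ _).1 hx (A (A x)) ⟨A x, rfl⟩, map_zero]
  exact ContinuousLinearMap.isUnit_iff_bijective.2 ⟨hinj, LinearMap.range_eq_top.1 htop⟩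

/-! ### Resolvent, self-adjointness and negative spectrum of an operator given by a form. -/

variable {E Q : Type*} [NormedAddCommGroup E] [InnerProductSpace ℂ E]
  [NormedAddCommGroup Q] [InnerProductSpace ℂ Q]

/-- `G` is the graph of the operator generated in `E` by the form `⟪A z, z⟫` on the form domain `Q`
embedded into `E` by `j`. -/
def IsFormGraph (j : Q →L[ℂ] E) (A : Q →L[ℂ] Q) (G : Submodule ℂ (E × E)) : Prop :=
  ∀ f g, (f, g) ∈ G ↔ ∃ z, j z = f ∧ ∀ y, inner ℂ y (A z) = inner ℂ (j y) g

namespace IsFormGraph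

variable {j : Q →L[ℂ] E} {A : Q →L[ℂ] Q} {G : Submodule ℂ (E × E)}

/-- The relation is single-valued: over zero the representing vector is zero since `j` is injective,
so the second component is orthogonal to the dense range of `j`. -/
theorem snd_eq_zero (hG : IsFormGraph j A G) (hj : Function.Injective j) (hd : DenseRange j) :
    ∀ x ∈ G, x.1 = 0 → x.2 = 0 := by
  rintro ⟨f, g⟩ hx (rfl : f = 0)
  obtain ⟨z, hz, h⟩ := (hG _ _).1 hx
  have hz0 : z = 0 := hj (by rw [hz, map_zero])
  refine hd.eq_zero_of_inner_left ℂ fun y => ?_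
  have := h y
  rw [hz0, map_zero, inner_zero_right] at this
  rw [← inner_conj_symm, ← this, map_zero]

theorem mem_domain_iff (u : E) : u ∈ G.toLinearPMap.domain ↔ ∃ g, (u, g) ∈ G := by
  rw [Submodule.toLinearPMap_domain]; simp

theorem apply_eq_of_mem (hG : IsFormGraph j A G) (hj : Function.Injective j)
    (hd : DenseRange j) {u g : E} (h : (u, g) ∈ G) (hu : u ∈ G.toLinearPMap.domain) :
    G.toLinearPMap ⟨u, hu⟩ = g := by
  have h1 : (u, G.toLinearPMap ⟨u, hu⟩) ∈ G :=
    Submodule.mem_graph_toLinearPMap (hG.snd_eq_zero hj hd) ⟨u, hu⟩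
  have h2 := hG.snd_eq_zero hj hd _ (G.sub_mem h1 h) (by simp)
  simpa [sub_eq_zero] using h2

theorem apply_mem (hG : IsFormGraph j A G) (hj : Function.Injective j)
    (hd : DenseRange j) (u : G.toLinearPMap.domain) : ((u : E), G.toLinearPMap u) ∈ G :=
  Submodule.mem_graph_toLinearPMap (hG.snd_eq_zero hj hd) u

open ContinuousLinearMap in
/-- The resolvent of the operator generated by a form. -/
theorem exists_resolvent [CompleteSpace E] [CompleteSpace Q] (hG : IsFormGraph j A G) {m : ℝ}
    (hB : IsUnit (A + (m : ℂ) • (adjoint j ∘L j))) :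
    ∃ R : E →L[ℂ] E, (∀ f, (R f, f - (m : ℂ) • R f) ∈ G) ∧
      ∀ u g, (u, g) ∈ G → R (g + (m : ℂ) • u) = u := by
  obtain ⟨B, hB⟩ := hB
  have e : ∀ z y, inner ℂ y ((B : Q →L[ℂ] Q) z) =
      inner ℂ y (A z) + (m : ℂ) * inner ℂ (j y) (j z) := by
    intro z y
    rw [hB]
    simp [adjoint_inner_right]
  have hB1 : ∀ z, (B : Q →L[ℂ] Q) ((↑B⁻¹ : Q →L[ℂ] Q) z) = z := fun z => by
    change ((B : Q →L[ℂ] Q) * (↑B⁻¹ : Q →L[ℂ] Q)) z = z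
    rw [Units.mul_inv]; rfl
  have hB2 : ∀ z, (↑B⁻¹ : Q →L[ℂ] Q) ((B : Q →L[ℂ] Q) z) = z := fun z => by
    change ((↑B⁻¹ : Q →L[ℂ] Q) * (B : Q →L[ℂ] Q)) z = z
    rw [Units.inv_mul]; rfl
  refine ⟨j ∘L (↑B⁻¹ : Q →L[ℂ] Q) ∘L adjoint j, fun f => ?_, fun u g h => ?_⟩
  · refine (hG _ _).2 ⟨(↑B⁻¹ : Q →L[ℂ] Q) (adjoint j f), rfl, fun y => ?_⟩
    have := e ((↑B⁻¹ : Q →L[ℂ] Q) (adjoint j f)) y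
    rw [hB1, adjoint_inner_right] at this
    rw [inner_sub_right, inner_smul_right, this]
    simp
  · obtain ⟨z, rfl, hz⟩ := (hG _ _).1 h
    simp only [ContinuousLinearMap.comp_apply]
    have h1 : adjoint j (g + (m : ℂ) • j z) = (B : Q →L[ℂ] Q) z := by
      refine ext_inner_left ℂ fun y => ?_
      rw [e, adjoint_inner_right, inner_add_right, inner_smul_right, hz]
    rw [h1, hB2]

theorem symmetric [CompleteSpace Q] (hG : IsFormGraph j A G) (hA : IsSelfAdjoint A) {u g u' g' : E}
    (h : (u, g) ∈ G) (h' : (u', g') ∈ G) : inner ℂ g u' = inner ℂ u g' := by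
  obtain ⟨z, rfl, hz⟩ := (hG _ _).1 h
  obtain ⟨z', rfl, hz'⟩ := (hG _ _).1 h'
  rw [← hz' z, ← inner_conj_symm, ← hz z', inner_conj_symm]
  exact hA.isSymmetric z z'

open ContinuousLinearMap in
/-- The operator generated by a form is self-adjoint. -/
theorem isSelfAdjoint [CompleteSpace E] [CompleteSpace Q] (hG : IsFormGraph j A G)
    (hj : Function.Injective j) (hd : DenseRange j) (hA : IsSelfAdjoint A) {m : ℝ}
    (hB : IsUnit (A + (m : ℂ) • (adjoint j ∘L j))) : IsSelfAdjoint G.toLinearPMap := by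
  obtain ⟨R, hR1, hR2⟩ := hG.exists_resolvent hB
  have hsymR : ∀ f f', inner ℂ (R f) f' = inner ℂ f (R f') := by
    intro f f'
    have := hG.symmetric hA (hR1 f) (hR1 f')
    rw [inner_sub_left, inner_sub_right, inner_smul_left, inner_smul_right] at this
    simp only [Complex.conj_ofReal] at this
    exact (sub_left_injective this).symm
  have hRinj : ∀ f, R f = 0 → f = 0 := by
    intro f hf
    have := hG.snd_eq_zero hj hd _ (hR1 f) hf
    simpa [hf] using this
  have hdense : Dense (G.toLinearPMap.domain : Set E) := by
    rw [Submodule.dense_iff_topologicalClosure_eq_top, Submodule.topologicalClosure_eq_top_iff,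
      Submodule.eq_bot_iff]
    intro x hx
    apply hRinj
    rw [← inner_self_eq_zero (𝕜 := ℂ), hsymR, ← inner_conj_symm,
      (Submodule.mem_orthogonal _ _).1 hx _ ((mem_domain_iff _).2 ⟨_, hR1 (R x)⟩), map_zero]
  rw [LinearPMap.isSelfAdjoint_def]
  apply LinearPMap.eq_of_eq_graph
  rw [LinearPMap.adjoint_graph_eq_graph_adjoint hdense,
    Submodule.toLinearPMap_graph_eq _ (hG.snd_eq_zero hj hd)]
  ext ⟨y, h⟩
  rw [Submodule.mem_adjoint_iff]
  constructor
  -- Testing the adjoint relation on the pairs `(R k, k - m R k)` shows `y = R (h + m y)`, and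
  -- values of `R` lie in the domain.
  · intro hyp
    have hy : y = R (h + (m : ℂ) • y) := by
      refine ext_inner_left ℂ fun k => ?_
      have := hyp _ _ (hR1 k)
      rw [inner_sub_left, inner_smul_left, Complex.conj_ofReal, hsymR, hsymR] at this
      rw [map_add, map_smul, inner_add_right, inner_smul_right]
      linear_combination this
    have := hR1 (h + (m : ℂ) • y)
    rw [← hy] at this
    simpa using this
  · intro hyp a b hab
    rw [hG.symmetric hA hab hyp, sub_self]

/-- The number of elements of an orthonormal family of eigenvectors with negative eigenvalues is at
most the dimension of a subspace on which the form is nonpositive. -/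
theorem card_le_of_orthonormal (hG : IsFormGraph j A G) {P : Q → Prop} {N : ℕ}
    (hN : ∀ L : Submodule ℂ Q, FiniteDimensional ℂ L → (∀ z ∈ L, P z) → Module.finrank ℂ L ≤ N)
    (hP : ∀ z, (inner ℂ (A z) z).re ≤ 0 → P z) {ι : Type*} [Fintype ι] {v : ι → E}
    (hv : Orthonormal ℂ v) {l : ι → ℝ} (hl : ∀ i, l i < 0)
    (hmem : ∀ i, (v i, (l i : ℂ) • v i) ∈ G) : Fintype.card ι ≤ N := by
  have hmem' := fun i => (hG _ _).1 (hmem i)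
  choose z hz hz' using hmem'
  have hli : LinearIndependent ℂ z := by
    have : LinearIndependent ℂ ((j : Q →ₗ[ℂ] E) ∘ z) := by
      rw [show ((j : Q →ₗ[ℂ] E) ∘ z) = v from funext hz]
      exact hv.linearIndependent
    exact this.of_comp _
  rw [← finrank_span_eq_card hli]
  refine hN _ (FiniteDimensional.span_of_finite ℂ (Set.finite_range z)) fun x hx => hP _ ?_
  obtain ⟨c, rfl⟩ := (Submodule.mem_span_range_iff_exists_fun ℂ).1 hx
  have h1 : inner ℂ (∑ i, c i • z i) (A (∑ i, c i • z i)) =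
      inner ℂ (∑ i, c i • v i) (∑ i, (c i * l i) • v i) := by
    simp only [map_sum, map_smul, inner_sum, inner_smul_right, hz', mul_smul]
    simp [hz]
  rw [← inner_conj_symm, h1, hv.inner_sum, map_sum, Complex.re_sum]
  refine Finset.sum_nonpos fun i _ => ?_
  have : conj (conj (c i) * (c i * (l i : ℂ))) = ((‖c i‖ ^ 2 * l i : ℝ) : ℂ) := by
    rw [← mul_assoc, ← Complex.normSq_eq_conj_mul_self, Complex.normSq_eq_norm_sq,
      ← Complex.ofReal_mul, Complex.conj_ofReal]
  rw [this, Complex.ofReal_re]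
  exact mul_nonpos_of_nonneg_of_nonpos (by positivity) (hl i).le

/-- A natural number below the rank is used because the eigenspaces are not yet known to be
finite-dimensional. -/
theorem exists_orthonormal_of_le_rank (hG : IsFormGraph j A G) (hj : Function.Injective j)
    (hd : DenseRange j) {l : ℂ} {n : ℕ}
    (hn : (n : Cardinal) ≤ Module.rank ℂ (opEigenspace G.toLinearPMap l)) :
    ∃ v : Fin n → E, Orthonormal ℂ v ∧ ∀ i, (v i, l • v i) ∈ G := by
  obtain ⟨s, hs, hli⟩ := le_rank_iff_exists_linearIndependent_finset.1 hn
  let F : opEigenspace G.toLinearPMap l →ₗ[ℂ] E :=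
    G.toLinearPMap.domain.subtype ∘ₗ (opEigenspace G.toLinearPMap l).subtype
  have hF : LinearMap.ker F = ⊥ := LinearMap.ker_eq_bot.2
    (Subtype.val_injective.comp Subtype.val_injective)
  have hli' := hli.map' F hF
  let K := Submodule.span ℂ (Set.range (F ∘ ((↑) : s → opEigenspace G.toLinearPMap l)))
  have hKf : FiniteDimensional ℂ K := FiniteDimensional.span_of_finite ℂ (Set.finite_range _)
  have hK : Module.finrank ℂ K = n := by
    exact (finrank_span_eq_card hli').trans (by simp [hs])
  have hKmem : ∀ x ∈ K, (x, l • x) ∈ G := by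
    intro x hx
    have hle : K ≤ LinearMap.range F := Submodule.span_le.2 (by rintro _ ⟨y, rfl⟩; exact ⟨y, rfl⟩)
    obtain ⟨y, rfl⟩ := hle hx
    have h1 := hG.apply_mem hj hd (y : G.toLinearPMap.domain)
    have h2 : G.toLinearPMap y - l • ((y : G.toLinearPMap.domain) : E) = 0 := y.2
    rw [sub_eq_zero.1 h2] at h1
    exact h1
  let b := (stdOrthonormalBasis ℂ K).reindex (finCongr hK)
  refine ⟨fun i => b i, ?_, fun i => hKmem _ (b i).2⟩
  exact b.orthonormal.comp_linearIsometry K.subtypeₗᵢ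

/-- Eigenvectors for different eigenvalues are orthogonal by symmetry, so orthonormal systems in the
eigenspaces join into one. The predicate `P` leaves room beyond nonpositivity of the form;
`hasFiniteNegativeSpectrum` needs that room. -/
theorem sum_le [CompleteSpace Q] (hG : IsFormGraph j A G) (hj : Function.Injective j)
    (hd : DenseRange j) (hA : IsSelfAdjoint A) {P : Q → Prop} {N : ℕ}
    (hN : ∀ L : Submodule ℂ Q, FiniteDimensional ℂ L → (∀ z ∈ L, P z) → Module.finrank ℂ L ≤ N)
    (hP : ∀ z, (inner ℂ (A z) z).re ≤ 0 → P z) (s : Finset (Set.Iio (0 : ℝ)))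
    (n : Set.Iio (0 : ℝ) → ℕ) (hn : ∀ l ∈ s,
      (n l : Cardinal) ≤ Module.rank ℂ (opEigenspace G.toLinearPMap ((l : ℝ) : ℂ))) :
    ∑ l ∈ s, n l ≤ N := by
  have hex := fun l : s => hG.exists_orthonormal_of_le_rank hj hd (hn l l.2)
  choose v hv hvG using hex
  let w : (Σ l : s, Fin (n l)) → E := fun p => v p.1 p.2
  have hw : Orthonormal ℂ w := by
    refine ⟨fun p => (hv p.1).1 p.2, ?_⟩
    rintro ⟨l, i⟩ ⟨l', i'⟩ hne
    by_cases h : l = l'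
    · subst h
      exact (hv l).2 fun h : i = i' => hne (by rw [h])
    · have h1 := hG.symmetric hA (hvG l i) (hvG l' i')
      rw [inner_smul_left, inner_smul_right, Complex.conj_ofReal] at h1
      have h2 : ((l : ℝ) : ℂ) - ((l' : ℝ) : ℂ) ≠ 0 := by
        rw [sub_ne_zero]
        exact fun h3 => h (Subtype.ext (Subtype.ext (Complex.ofReal_injective h3)))
      have h3 : (((l : ℝ) : ℂ) - ((l' : ℝ) : ℂ)) * inner ℂ (v l i) (v l' i') = 0 := by
        linear_combination h1
      exact (mul_eq_zero.1 h3).resolve_left h2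
  have := hG.card_le_of_orthonormal hN hP hw (l := fun p => ((p.1 : Set.Iio (0 : ℝ)) : ℝ))
    (fun p => (p.1 : Set.Iio (0 : ℝ)).2) (fun p => hvG p.1 p.2)
  rw [Fintype.card_sigma] at this
  simp only [Fintype.card_fin] at this
  rwa [← Finset.sum_coe_sort]

theorem negEigenvalueCount_le [CompleteSpace Q] (hG : IsFormGraph j A G) (hj : Function.Injective j)
    (hd : DenseRange j) (hA : IsSelfAdjoint A) {P : Q → Prop} {N : ℕ}
    (hN : ∀ L : Submodule ℂ Q, FiniteDimensional ℂ L → (∀ z ∈ L, P z) → Module.finrank ℂ L ≤ N)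
    (hP : ∀ z, (inner ℂ (A z) z).re ≤ 0 → P z) :
    negEigenvalueCount G.toLinearPMap ≤ N := by
  let r : Set.Iio (0 : ℝ) → Cardinal := fun l =>
    Module.rank ℂ (opEigenspace G.toLinearPMap ((l : ℝ) : ℂ))
  have hfin : ∀ l, ∃ n : ℕ, r l = n := by
    intro l
    by_contra! h
    have h1 : Cardinal.aleph0 ≤ r l := by
      by_contra! h2
      obtain ⟨n, hn⟩ := Cardinal.lt_aleph0.1 h2
      exact h n hn
    -- An infinite-dimensional eigenspace would contain `N + 1` independent eigenvectors.
    have h2 := hG.sum_le hj hd hA hN hP {l} (fun _ => N + 1) (by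
      intro l' hl'
      rw [Finset.mem_singleton.1 hl']
      exact Cardinal.natCast_lt_aleph0.le.trans h1)
    simp at h2
  choose n hn using hfin
  rw [negEigenvalueCount, ENNReal.tsum_eq_iSup_sum]
  refine iSup_le fun s => ?_
  have h1 := hG.sum_le hj hd hA hN hP s n (fun l _ => (hn l).symm.le)
  have h2 : ∀ l, ((Cardinal.toENat (r l) : ℕ∞) : ℝ≥0∞) = n l := by
    intro l; rw [hn]; simp
  calc _ = ∑ l ∈ s, ((n l : ℕ) : ℝ≥0∞) := Finset.sum_congr rfl fun l _ => h2 l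
    _ ≤ N := by exact_mod_cast h1

-- A negative spectral point must be an eigenvalue, and every eigenvalue adds at least one to a
-- finite count, so there are finitely many. Hypothesis `hP'` keeps the dimension bound valid for
-- the form shifted by `-l` with a margin `γ`.
open ContinuousLinearMap in
theorem hasFiniteNegativeSpectrum [CompleteSpace E] [CompleteSpace Q] (hG : IsFormGraph j A G)
    (hj : Function.Injective j) (hd : DenseRange j) (hA : IsSelfAdjoint A) {P : Q → Prop} {N : ℕ}
    (hN : ∀ L : Submodule ℂ Q, FiniteDimensional ℂ L → (∀ z ∈ L, P z) → Module.finrank ℂ L ≤ N)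
    (hP : ∀ z, (inner ℂ (A z) z).re ≤ 0 → P z)
    (hP' : ∀ l : ℝ, l < 0 → ∃ γ : ℝ, 0 < γ ∧
      ∀ z, (inner ℂ (A z) z).re - l * ‖j z‖ ^ 2 ≤ γ * ‖z‖ ^ 2 → P z) :
    HasFiniteNegativeSpectrum G.toLinearPMap := by
  have hcount := hG.negEigenvalueCount_le hj hd hA hN hP
  have hlt : negEigenvalueCount G.toLinearPMap < ∞ := hcount.trans_lt (by simp)
  refine ⟨?_, hlt⟩
  have hfin := ENNReal.finite_const_le_of_tsum_ne_top hlt.ne one_ne_zero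
  refine (hfin.image ((↑) : Set.Iio (0 : ℝ) → ℝ)).subset ?_
  rintro l ⟨hl, hspec⟩
  refine ⟨⟨l, hl⟩, ?_, rfl⟩
  change 1 ≤ ((Cardinal.toENat (Module.rank ℂ (opEigenspace G.toLinearPMap (l : ℂ))) : ℕ∞) : ℝ≥0∞)
  have hne : Module.rank ℂ (opEigenspace G.toLinearPMap (l : ℂ)) ≠ 0 := by
    intro h0
    have hbot : opEigenspace G.toLinearPMap (l : ℂ) = ⊥ := Submodule.rank_eq_zero.1 h0
    apply hspec
    obtain ⟨γ, hγ, hPγ⟩ := hP' l hl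
    -- The kernel of this operator is the eigenspace for `l`, here trivial; `isUnit_of_finrank_le`
    -- then provides the resolvent.
    have hB : IsUnit (A + ((-l : ℝ) : ℂ) • (adjoint j ∘L j)) := by
      have hform : ∀ z y, inner ℂ ((A + ((-l : ℝ) : ℂ) • (adjoint j ∘L j)) z) y =
          inner ℂ (A z) y - (l : ℂ) * inner ℂ (j z) (j y) := by
        intro z y
        rw [add_apply, smul_apply, inner_add_left,
          inner_smul_left, ContinuousLinearMap.comp_apply, adjoint_inner_left, Complex.conj_ofReal]
        push_cast
        ring
      refine isUnit_of_finrank_le ?_ ?_ hγ (N := N) fun L hLf hL => hN L hLf fun z hz => ?_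
      · refine isSelfAdjoint_iff_isSymmetric.2 fun z y => ?_
        change inner ℂ ((A + ((-l : ℝ) : ℂ) • (adjoint j ∘L j)) z) y =
          inner ℂ z ((A + ((-l : ℝ) : ℂ) • (adjoint j ∘L j)) y)
        rw [← inner_conj_symm z, hform, hform, map_sub, map_mul, inner_conj_symm, inner_conj_symm,
          Complex.conj_ofReal]
        congr 1
        exact hA.isSymmetric z y
      · rw [injective_iff_map_eq_zero]
        intro z hz
        have hmem : (j z, (l : ℂ) • j z) ∈ G := by
          refine (hG _ _).2 ⟨z, rfl, fun y => ?_⟩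
          have h1 := hform z y
          rw [hz, inner_zero_left] at h1
          rw [← inner_conj_symm, sub_eq_zero.1 h1.symm, map_mul, Complex.conj_ofReal,
            inner_conj_symm, inner_smul_right]
        have hdom : j z ∈ G.toLinearPMap.domain := (mem_domain_iff _).2 ⟨_, hmem⟩
        have h2 : (⟨j z, hdom⟩ : G.toLinearPMap.domain) ∈ opEigenspace G.toLinearPMap (l : ℂ) := by
          change G.toLinearPMap ⟨j z, hdom⟩ - (l : ℂ) • j z = 0
          rw [hG.apply_eq_of_mem hj hd hmem, sub_self]
        rw [hbot, Submodule.mem_bot] at h2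
        exact hj (by rw [map_zero]; exact congrArg Subtype.val h2)
      · refine hPγ z ?_
        have h1 := hL z hz
        rw [hform, inner_self_eq_norm_sq_to_K, Complex.sub_re, Complex.re_ofReal_mul] at h1
        norm_cast at h1
    obtain ⟨R, hR1, hR2⟩ := hG.exists_resolvent hB
    refine ⟨R, fun f => ?_, fun u => ?_⟩
    · have hdom : R f ∈ G.toLinearPMap.domain := (mem_domain_iff _).2 ⟨_, hR1 f⟩
      refine ⟨hdom, ?_⟩
      rw [hG.apply_eq_of_mem hj hd (hR1 f)]
      simp
    · have := hR2 _ _ (hG.apply_mem hj hd u)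
      convert this using 2
      simp [sub_eq_add_neg]
  have h1 : (1 : ℕ∞) ≤ Cardinal.toENat (Module.rank ℂ (opEigenspace G.toLinearPMap (l : ℂ))) := by
    rw [← map_one Cardinal.toENat]
    exact Cardinal.toENat.monotone' (Cardinal.one_le_iff_ne_zero.2 hne)
  exact_mod_cast h1

end IsFormGraph

end FormOperators

/-! ### Rays of a regular tree -/

namespace RegularTree

variable (Γ : RegularTree)

theorem b_pos (n : ℕ) : 0 < Γ.b n := by
  rcases eq_or_ne n 0 with rfl | h
  · rw [Γ.b_zero]; exact Nat.one_pos
  · exact Nat.zero_lt_one.trans (Γ.one_lt_b n h)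

theorem t_lt_succ (n : ℕ) : Γ.t n < Γ.t (n + 1) := Γ.t_strictMono n.lt_succ_self

theorem t_nonneg (n : ℕ) : 0 ≤ Γ.t n := by
  rw [← Γ.t_zero]; exact Γ.t_strictMono.monotone n.zero_le

theorem exists_le_t (s : ℝ) : ∃ n, s ≤ Γ.t n :=
  (Γ.t_unbounded.eventually_ge_atTop s).exists

theorem exists_mem_Ioc {s : ℝ} (hs : 0 < s) : ∃ n, s ∈ Set.Ioc (Γ.t n) (Γ.t (n + 1)) := by
  classical
  have h := Γ.exists_le_t s
  have h1 := Nat.find_spec h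
  have h0 : Nat.find h ≠ 0 := by
    intro h0
    rw [h0, Γ.t_zero] at h1
    exact absurd hs (not_lt.2 h1)
  refine ⟨Nat.find h - 1, ?_, ?_⟩
  · exact not_le.1 (Nat.find_min h (Nat.sub_lt (Nat.pos_of_ne_zero h0) Nat.one_pos))
  · rwa [Nat.sub_add_cancel (Nat.one_le_iff_ne_zero.2 h0)]

theorem iUnion_Ioc_t : ⋃ n, Set.Ioc (Γ.t n) (Γ.t (n + 1)) = Set.Ioi 0 := by
  ext s
  simp only [Set.mem_iUnion, Set.mem_Ioi]
  exact ⟨fun ⟨n, hn⟩ => (Γ.t_nonneg n).trans_lt hn.1, fun h => Γ.exists_mem_Ioc h⟩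

theorem pairwise_disjoint_Ioc_t :
    Pairwise (Function.onFun Disjoint fun n => Set.Ioc (Γ.t n) (Γ.t (n + 1))) :=
  Γ.t_strictMono.monotone.pairwise_disjoint_on_Ioc_succ

/-- The generation of the edges that contain the points at distance `s` from the root. -/
def level (s : ℝ) : ℕ := sInf {m : ℕ | s ≤ Γ.t m} - 1

theorem level_eq {n : ℕ} {s : ℝ} (hs : s ∈ Set.Ioc (Γ.t n) (Γ.t (n + 1))) : Γ.level s = n := by
  have h : sInf {m : ℕ | s ≤ Γ.t m} = n + 1 := by
    apply le_antisymm (Nat.sInf_le hs.2)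
    have hm : s ≤ Γ.t (sInf {m : ℕ | s ≤ Γ.t m}) :=
      Nat.sInf_mem (s := {m : ℕ | s ≤ Γ.t m}) ⟨n + 1, hs.2⟩
    exact Γ.t_strictMono.lt_iff_lt.mp (hs.1.trans_le hm)
  rw [level, h, Nat.add_sub_cancel]

theorem level_of_nonpos {s : ℝ} (hs : s ≤ 0) : Γ.level s = 0 := by
  have h : sInf {m : ℕ | s ≤ Γ.t m} = 0 :=
    Nat.sInf_eq_zero.2 (Or.inl (by rw [Set.mem_ofPred_eq, Γ.t_zero]; exact hs))
  rw [level, h]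

theorem level_mono : Monotone Γ.level := fun _ r hsr =>
  Nat.sub_le_sub_right (Nat.sInf_le (hsr.trans (Nat.sInf_mem (Γ.exists_le_t r)))) 1

variable {Γ}

/-- The edge of generation `n` on the ray `ω`. -/
def rayEdge (ω : ∀ k, Fin (Γ.b k)) (n : ℕ) : Γ.Edge := ⟨n, fun k => ω k⟩

/-- The point of the ray `ω` at distance `s` from the root. -/
def ray (ω : ∀ k, Fin (Γ.b k)) (s : ℝ) : Γ.Point := Γ.edgePoint (rayEdge ω (Γ.level s)) s

/-- A vertex is stored only as the upper end of an edge, so consecutive edges of a ray must be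
checked to meet there. -/
theorem edgePoint_rayEdge_succ (ω : ∀ k, Fin (Γ.b k)) (n : ℕ) :
    Γ.edgePoint (rayEdge ω (n + 1)) (Γ.t (n + 1)) = Γ.edgePoint (rayEdge ω n) (Γ.t (n + 1)) := by
  have h1 : ¬ Γ.t (n + 1) < Γ.clamp (n + 1) (Γ.t (n + 1)) := by
    unfold clamp
    rw [min_eq_left (Γ.t_lt_succ (n + 1)).le, max_self]
    exact lt_irrefl _
  have h2 : Γ.clamp n (Γ.t (n + 1)) = Γ.t (n + 1) := by
    unfold clamp
    rw [min_self, max_eq_right (Γ.t_lt_succ n).le]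
  cases n with
  | zero => simp only [edgePoint, rayEdge, h1, dite_false, h2]; rfl
  | succ n =>
    simp only [edgePoint, rayEdge, h1, dite_false, h2, Γ.t_lt_succ (n + 1), dite_true]; rfl

theorem ray_eq (ω : ∀ k, Fin (Γ.b k)) {n : ℕ} {s : ℝ} (hs : s ∈ Set.Icc (Γ.t n) (Γ.t (n + 1))) :
    ray ω s = Γ.edgePoint (rayEdge ω n) s := by
  rcases hs.1.lt_or_eq with h | h
  · rw [ray, Γ.level_eq ⟨h, hs.2⟩]
  · subst h
    cases n with
    | zero => rw [ray, Γ.level_of_nonpos (by rw [Γ.t_zero])]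
    | succ n =>
      rw [ray, Γ.level_eq ⟨Γ.t_lt_succ n, le_rfl⟩, edgePoint_rayEdge_succ]

theorem edge_edgePoint (e : Γ.Edge) {s : ℝ} (hs : s ∈ Set.Ioc (Γ.t e.gen) (Γ.t (e.gen + 1))) :
    (Γ.edgePoint e s).edge = e := by
  obtain ⟨n, v⟩ := e
  cases n with
  | zero => rfl
  | succ n =>
    have h : Γ.t (n + 1) < Γ.clamp (n + 1) s := by
      unfold clamp
      rw [min_eq_left hs.2]
      exact lt_max_of_lt_right hs.1
    simp only [edgePoint, h, dite_true]

theorem exists_rayEdge_eq (e : Γ.Edge) : ∃ ω : ∀ k, Fin (Γ.b k), rayEdge ω e.gen = e := by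
  -- The choices above the edge are immaterial; the first branch is taken.
  refine ⟨fun k => if h : k < e.gen + 1 then e.top ⟨k, h⟩ else ⟨0, Γ.b_pos k⟩, ?_⟩
  exact congrArg (Edge.mk e.gen) (funext fun k => dif_pos k.2)

/-- A ray through the edge `e`. -/
def rayThrough (e : Γ.Edge) : ∀ k, Fin (Γ.b k) := (exists_rayEdge_eq e).choose

theorem rayEdge_rayThrough (e : Γ.Edge) : rayEdge (rayThrough e) e.gen = e :=
  (exists_rayEdge_eq e).choose_spec

theorem ray_rayThrough (e : Γ.Edge) {s : ℝ} (hs : s ∈ Set.Icc (Γ.t e.gen) (Γ.t (e.gen + 1))) :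
    ray (rayThrough e) s = Γ.edgePoint e s := by
  rw [ray_eq _ hs, rayEdge_rayThrough]

theorem abs_ray (ω : ∀ k, Fin (Γ.b k)) {s : ℝ} (hs : 0 ≤ s) : (ray ω s).abs = s := by
  rcases hs.eq_or_lt with rfl | h
  · have h0 : (0 : ℝ) ∈ Set.Icc (Γ.t 0) (Γ.t (0 + 1)) :=
      ⟨Γ.t_zero.le, by rw [← Γ.t_zero]; exact (Γ.t_lt_succ 0).le⟩
    rw [ray_eq _ h0]
    exact Γ.abs_edgePoint (rayEdge ω 0) h0
  · obtain ⟨n, hn⟩ := Γ.exists_mem_Ioc h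
    rw [ray_eq _ ⟨hn.1.le, hn.2⟩]
    exact Γ.abs_edgePoint (rayEdge ω n) ⟨hn.1.le, hn.2⟩

theorem Point.ext_edge {x y : Γ.Point} (h : x.edge = y.edge) (h' : x.pos = y.pos) : x = y := by
  cases x; cases y; cases h; cases h'; rfl

theorem subsingleton_edge_zero {e e' : Γ.Edge} (h : e.gen = 0) (h' : e'.gen = 0) : e = e' := by
  obtain ⟨n, v⟩ := e
  obtain ⟨n', v'⟩ := e'
  cases h; cases h'
  congr 1
  funext k
  have hk : (k : ℕ) = 0 := Nat.lt_one_iff.1 k.2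
  have : Subsingleton (Fin (Γ.b k)) := by rw [hk, Γ.b_zero]; infer_instance
  exact Subsingleton.elim _ _

theorem ray_zero (ω : ∀ k, Fin (Γ.b k)) : ray ω 0 = Γ.root := by
  refine Point.ext_edge (subsingleton_edge_zero ?_ rfl) (abs_ray ω le_rfl)
  rw [ray, Γ.level_of_nonpos le_rfl]
  rfl

theorem abs_nonneg (x : Γ.Point) : 0 ≤ x.abs := by
  rcases x.lt_pos with h | h
  · exact (Γ.t_nonneg _).trans h.le
  · exact h.2.symm.le

theorem ray_abs (x : Γ.Point) : ray (rayThrough x.edge) x.abs = x := by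
  rcases x.lt_pos with h | h
  · have hI : x.abs ∈ Set.Ioc (Γ.t x.edge.gen) (Γ.t (x.edge.gen + 1)) := ⟨h, x.pos_le⟩
    rw [ray_rayThrough _ ⟨hI.1.le, hI.2⟩]
    exact Point.ext_edge (edge_edgePoint _ hI) (Γ.abs_edgePoint _ ⟨hI.1.le, hI.2⟩)
  · have h0 : x.abs = 0 := h.2
    rw [h0, ray_zero]
    exact Point.ext_edge (subsingleton_edge_zero rfl h.1) h0.symm

/-- A point other than the root determines its edge, and the edge records every choice made on the
way to it; hence rays that meet have coincided so far. -/
theorem ray_congr {ω ω' : ∀ k, Fin (Γ.b k)} {s r : ℝ} (h : ray ω s = ray ω' s) (hr : r ≤ s) :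
    ray ω r = ray ω' r := by
  have key : rayEdge ω (Γ.level r) = rayEdge ω' (Γ.level r) := by
    rcases le_or_gt r 0 with h0 | h0
    · rw [Γ.level_of_nonpos h0]
      exact subsingleton_edge_zero rfl rfl
    · obtain ⟨n, hn⟩ := Γ.exists_mem_Ioc (h0.trans_le hr)
      have h1 : rayEdge ω n = rayEdge ω' n := by
        rw [← edge_edgePoint (rayEdge ω n) hn, ← edge_edgePoint (rayEdge ω' n) hn]
        rw [ray_eq ω ⟨hn.1.le, hn.2⟩, ray_eq ω' ⟨hn.1.le, hn.2⟩] at h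
        rw [h]
      have h2 : ∀ k : Fin (n + 1), ω k = ω' k := by
        intro k
        injection h1 with _ h3
        exact congrFun h3 k
      have h3 : Γ.level r ≤ n := by
        rw [← Γ.level_eq hn]; exact Γ.level_mono hr
      unfold rayEdge
      congr 1
      funext k
      exact h2 ⟨k, by omega⟩
  rw [ray, ray, key]

/-! ### Integration along rays -/

instance (n : ℕ) : Fintype (Γ.Vertex n) := inferInstanceAs (Fintype ((k : Fin n) → Fin (Γ.b k)))

variable (Γ) in
/-- The edges of generation `n` correspond to the vertices of generation `n + 1`. -/
def edgeEquiv : Γ.Edge ≃ Σ n, Γ.Vertex (n + 1) where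
  toFun e := ⟨e.gen, e.top⟩
  invFun p := ⟨p.1, p.2⟩

instance : Countable Γ.Edge := Γ.edgeEquiv.injective.countable

theorem measurable_ray (ω : ∀ k, Fin (Γ.b k)) : Measurable (ray ω) := by
  have h : Measurable fun q : ℕ × ℝ => Γ.edgePoint (rayEdge ω q.1) q.2 :=
    measurable_from_prod_countable_right fun n => Γ.measurable_edgePoint (rayEdge ω n)
  exact h.comp (Γ.level_mono.measurable.prodMk measurable_id)

theorem measurable_abs : Measurable (Point.abs : Γ.Point → ℝ) :=
  measurable_snd.comp (comap_measurable (fun x : Γ.Point => (x.edge, x.pos)))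

variable (Γ) in
theorem volume_eq : (volume : Measure Γ.Point) = Measure.sum fun e : Γ.Edge =>
    (volume.restrict (Set.Icc (Γ.t e.gen) (Γ.t (e.gen + 1)))).map (Γ.edgePoint e) := rfl

instance : SFinite (volume : Measure Γ.Point) := by
  rw [volume_eq]; infer_instance

theorem map_edgePoint_le (e : Γ.Edge) :
    (volume.restrict (Set.Icc (Γ.t e.gen) (Γ.t (e.gen + 1)))).map (Γ.edgePoint e) ≤ volume :=
  Measure.le_sum (fun e : Γ.Edge =>
    (volume.restrict (Set.Icc (Γ.t e.gen) (Γ.t (e.gen + 1)))).map (Γ.edgePoint e)) e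

theorem quasiMeasurePreserving_edgePoint (e : Γ.Edge) :
    Measure.QuasiMeasurePreserving (Γ.edgePoint e)
      (volume.restrict (Set.Icc (Γ.t e.gen) (Γ.t (e.gen + 1)))) volume :=
  ⟨Γ.measurable_edgePoint e, (map_edgePoint_le e).absolutelyContinuous⟩

theorem lintegral_eq_tsum {F : Γ.Point → ℝ≥0∞} (hF : AEMeasurable F volume) :
    ∫⁻ x, F x = ∑' e : Γ.Edge, ∫⁻ s in Set.Icc (Γ.t e.gen) (Γ.t (e.gen + 1)),
      F (Γ.edgePoint e s) := by
  rw [volume_eq, lintegral_sum_measure]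
  refine tsum_congr fun e => ?_
  rw [lintegral_map' (hF.mono_measure (map_edgePoint_le e)) (Γ.measurable_edgePoint e).aemeasurable]

theorem setLIntegral_Ioi_eq_tsum (f : ℝ → ℝ≥0∞) :
    ∫⁻ s in Set.Ioi 0, f s = ∑' n, ∫⁻ s in Set.Ioc (Γ.t n) (Γ.t (n + 1)), f s := by
  rw [← Γ.iUnion_Ioc_t, lintegral_iUnion (fun n => measurableSet_Ioc) Γ.pairwise_disjoint_Ioc_t]

theorem setLIntegral_ray (ω : ∀ k, Fin (Γ.b k)) (F : Γ.Point → ℝ≥0∞) (f : ℝ → ℝ≥0∞) :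
    ∫⁻ s in Set.Ioi 0, F (ray ω s) * f s = ∑' n,
      ∫⁻ s in Set.Ioc (Γ.t n) (Γ.t (n + 1)), F (Γ.edgePoint (rayEdge ω n) s) * f s := by
  rw [setLIntegral_Ioi_eq_tsum (Γ := Γ)]
  refine tsum_congr fun n => setLIntegral_congr_fun measurableSet_Ioc fun s hs => ?_
  rw [ray_eq ω ⟨hs.1.le, hs.2⟩]

theorem rayEdge_injective (ω : ∀ k, Fin (Γ.b k)) : Function.Injective (rayEdge ω) :=
  fun _ _ h => congrArg Edge.gen h

/-- A ray contains only one edge of each generation, so it covers no part of the tree twice. -/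
theorem map_ray_le (ω : ∀ k, Fin (Γ.b k)) :
    (volume.restrict (Set.Ioi 0)).map (ray ω) ≤ (volume : Measure Γ.Point) := by
  refine Measure.le_iff.2 fun S hS => ?_
  rw [← lintegral_indicator_one hS, ← lintegral_indicator_one hS,
    lintegral_map (measurable_one.indicator hS) (measurable_ray ω),
    lintegral_eq_tsum (measurable_one.indicator hS).aemeasurable]
  have h := setLIntegral_ray ω (S.indicator 1) 1
  simp only [Pi.one_apply, mul_one] at h
  rw [h]
  refine le_trans (ENNReal.tsum_le_tsum fun n => ?_)
    (ENNReal.tsum_comp_le_tsum_of_injective (rayEdge_injective ω)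
      (fun e : Γ.Edge => ∫⁻ s in Set.Icc (Γ.t e.gen) (Γ.t (e.gen + 1)),
        S.indicator 1 (Γ.edgePoint e s)))
  exact lintegral_mono_set Set.Ioc_subset_Icc_self

theorem setLIntegral_ray_le (ω : ∀ k, Fin (Γ.b k)) {F : Γ.Point → ℝ≥0∞}
    (hF : AEMeasurable F volume) : ∫⁻ s in Set.Ioi 0, F (ray ω s) ≤ ∫⁻ x, F x := by
  rw [← lintegral_map' (hF.mono_measure (map_ray_le ω)) (measurable_ray ω).aemeasurable]
  exact lintegral_mono' (map_ray_le ω) le_rfl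

variable (Γ) in
/-- The uniform probability measure on the rays. -/
def rayMeasure : Measure (∀ k, Fin (Γ.b k)) :=
  Measure.infinitePi fun k => (Γ.b k : ℝ≥0∞)⁻¹ • (Measure.count : Measure (Fin (Γ.b k)))

instance (n : ℕ) : IsProbabilityMeasure
    ((Γ.b n : ℝ≥0∞)⁻¹ • (Measure.count : Measure (Fin (Γ.b n)))) := by
  constructor
  rw [Measure.smul_apply, Measure.count_univ, smul_eq_mul]
  simp only [ENat.card_eq_coe_fintype_card, Fintype.card_fin]
  exact ENNReal.inv_mul_cancel (by exact_mod_cast (Γ.b_pos n).ne') (by simp)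

theorem rayMeasure_setOf_eq (n : ℕ) (v : Γ.Vertex (n + 1)) :
    Γ.rayMeasure {ω | (fun k : Fin (n + 1) => ω k) = v} =
      (∏ k ∈ Finset.range (n + 1), (Γ.b k : ℝ≥0∞))⁻¹ := by
  have h : {ω : ∀ k, Fin (Γ.b k) | (fun k : Fin (n + 1) => ω k) = v} =
      Set.pi (Finset.range (n + 1)) fun k => {rayThrough ⟨n, v⟩ k} := by
    have h1 : (fun k : Fin (n + 1) => rayThrough (⟨n, v⟩ : Γ.Edge) k) = v := by
      have := rayEdge_rayThrough (⟨n, v⟩ : Γ.Edge)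
      injection this
    ext ω
    simp only [Set.mem_ofPred_eq, Set.mem_pi, Finset.coe_range, Set.mem_Iio, Set.mem_singleton_iff]
    constructor
    · intro h2 k hk
      have := congrFun (h2.trans h1.symm) ⟨k, hk⟩
      exact this
    · intro h2
      rw [← h1]
      funext k
      exact h2 k k.2
  rw [h, rayMeasure, Measure.infinitePi_pi _ (fun k _ => MeasurableSet.singleton _)]
  rw [ENNReal.prod_inv_distrib]
  · refine Finset.prod_congr rfl fun k _ => ?_
    simp
  · intro i _ k _ _
    right; simp

theorem measurable_ray_restrict (n : ℕ) (φ : Γ.Vertex (n + 1) → ℝ≥0∞) :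
    Measurable fun ω : ∀ k, Fin (Γ.b k) => φ fun k => ω k := by
  have h : Measurable fun (ω : ∀ k, Fin (Γ.b k)) (k : Fin (n + 1)) => ω k :=
    measurable_pi_lambda _ fun k => measurable_pi_apply _
  exact (measurable_of_finite (fun v : (k : Fin (n + 1)) → Fin (Γ.b k) => φ v)).comp h

/-- The first `n + 1` choices of a random ray are uniformly distributed over the vertices of
generation `n + 1`. -/
theorem lintegral_rayMeasure (n : ℕ) (φ : Γ.Vertex (n + 1) → ℝ≥0∞) :
    ∫⁻ ω, φ (fun k => ω k) ∂Γ.rayMeasure =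
      ∑ v, (∏ k ∈ Finset.range (n + 1), (Γ.b k : ℝ≥0∞))⁻¹ * φ v := by
  have h : Measurable fun (ω : ∀ k, Fin (Γ.b k)) (k : Fin (n + 1)) => ω k :=
    measurable_pi_lambda _ fun k => measurable_pi_apply _
  have key : ∀ ψ : ((k : Fin (n + 1)) → Fin (Γ.b k)) → ℝ≥0∞,
      ∫⁻ ω, ψ (fun k => ω k) ∂Γ.rayMeasure =
        ∑ v, (∏ k ∈ Finset.range (n + 1), (Γ.b k : ℝ≥0∞))⁻¹ * ψ v := by
    intro ψ
    rw [← lintegral_map (f := ψ) (measurable_of_finite _) h, lintegral_fintype]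
    refine Finset.sum_congr rfl fun v _ => ?_
    rw [Measure.map_apply h (MeasurableSet.singleton _), mul_comm, ← rayMeasure_setOf_eq n v]
    rfl
  exact key φ

theorem ofReal_branching (n : ℕ) {s : ℝ} (hs : s ∈ Set.Ioc (Γ.t n) (Γ.t (n + 1))) :
    ENNReal.ofReal (Γ.branching s) = ∏ k ∈ Finset.range (n + 1), (Γ.b k : ℝ≥0∞) := by
  rw [Γ.branching_eq n hs, ENNReal.ofReal_prod_of_nonneg (fun _ _ => by positivity)]
  simp

/-- `F` may be arbitrary: the contribution of each generation depends on finitely many choices only.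
-/
theorem measurable_lintegral_ray (F : Γ.Point → ℝ≥0∞) (f : ℝ → ℝ≥0∞) :
    Measurable fun ω : ∀ k, Fin (Γ.b k) => ∫⁻ s in Set.Ioi 0, F (ray ω s) * f s := by
  simp_rw [setLIntegral_ray]
  exact Measurable.tsum fun n => measurable_ray_restrict n fun v =>
    ∫⁻ s in Set.Ioc (Γ.t n) (Γ.t (n + 1)), F (Γ.edgePoint ⟨n, v⟩ s) * f s

/-- Integration over the tree in terms of the rays. -/
theorem lintegral_eq_lintegral_ray {F : Γ.Point → ℝ≥0∞} (hF : AEMeasurable F volume) :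
    ∫⁻ x, F x = ∫⁻ ω, (∫⁻ s in Set.Ioi 0,
      F (ray ω s) * ENNReal.ofReal (Γ.branching s)) ∂Γ.rayMeasure := by
  simp_rw [setLIntegral_ray]
  rw [lintegral_tsum (f := fun n (ω : ∀ k, Fin (Γ.b k)) =>
    ∫⁻ s in Set.Ioc (Γ.t n) (Γ.t (n + 1)), F (Γ.edgePoint (rayEdge ω n) s) *
      ENNReal.ofReal (Γ.branching s)) (fun n => (measurable_ray_restrict n fun v =>
    ∫⁻ s in Set.Ioc (Γ.t n) (Γ.t (n + 1)), F (Γ.edgePoint ⟨n, v⟩ s) *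
      ENNReal.ofReal (Γ.branching s)).aemeasurable), lintegral_eq_tsum hF,
    ← Γ.edgeEquiv.symm.tsum_eq, ENNReal.tsum_sigma']
  refine tsum_congr fun n => ?_
  rw [tsum_fintype]
  refine Eq.trans ?_ (lintegral_rayMeasure n fun v =>
    ∫⁻ s in Set.Ioc (Γ.t n) (Γ.t (n + 1)), F (Γ.edgePoint ⟨n, v⟩ s) *
      ENNReal.ofReal (Γ.branching s)).symm
  refine Finset.sum_congr rfl fun v _ => ?_
  -- On generation `n` the weight is the constant `b_0⋯b_n`, the reciprocal of the probability of
  -- each edge, so the two cancel.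
  have h0 : (∏ k ∈ Finset.range (n + 1), (Γ.b k : ℝ≥0∞)) ≠ 0 :=
    Finset.prod_ne_zero_iff.2 fun k _ => by exact_mod_cast (Γ.b_pos k).ne'
  have ht : (∏ k ∈ Finset.range (n + 1), (Γ.b k : ℝ≥0∞)) ≠ ∞ :=
    (ENNReal.prod_lt_top fun k _ => ENNReal.natCast_lt_top _).ne
  rw [setLIntegral_congr_fun (g := fun s => F (Γ.edgePoint ⟨n, v⟩ s) *
    ∏ k ∈ Finset.range (n + 1), (Γ.b k : ℝ≥0∞)) measurableSet_Ioc
    (fun s hs => by simp only [ofReal_branching n hs]), lintegral_mul_const' _ _ ht,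
    mul_comm _ (∏ k ∈ _, _),
    ← mul_assoc, ENNReal.inv_mul_cancel h0 ht, one_mul]
  exact setLIntegral_congr Ioc_ae_eq_Icc.symm

end RegularTree

/-! ### Weighted Hardy inequalities on the half-line -/

section HalfLine

/-- The Cauchy-Schwarz inequality for the lower Lebesgue integral. -/
theorem lintegral_mul_sq_le {X : Type*} [MeasurableSpace X] {μ : Measure X} {f g : X → ℝ≥0∞}
    (hf : AEMeasurable f μ) (hg : AEMeasurable g μ) :
    (∫⁻ x, f x * g x ∂μ) ^ 2 ≤ (∫⁻ x, f x ^ 2 ∂μ) * ∫⁻ x, g x ^ 2 ∂μ := by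
  have h := ENNReal.lintegral_mul_le_Lp_mul_Lq μ Real.HolderConjugate.two_two hf hg
  have h2 : ∀ x : ℝ≥0∞, (x ^ (1 / 2 : ℝ)) ^ 2 = x := by
    intro x
    rw [← ENNReal.rpow_natCast, ← ENNReal.rpow_mul]
    norm_num
  calc _ ≤ ((∫⁻ x, f x ^ (2 : ℝ) ∂μ) ^ (1 / 2 : ℝ) * (∫⁻ x, g x ^ (2 : ℝ) ∂μ) ^ (1 / 2 : ℝ)) ^ 2 :=
        pow_le_pow_left' h 2
    _ = _ := by
        rw [mul_pow, h2, h2]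
        simp only [ENNReal.rpow_ofNat]

/-- A Schur test for integral operators between weighted `L₂` spaces. -/
theorem lintegral_sq_le_of_schur {μ : Measure ℝ} [SFinite μ] {K : ℝ → ℝ → ℝ≥0∞}
    {W h m q g : ℝ → ℝ≥0∞} {A B : ℝ≥0∞} (hB : B ≠ ∞) (hK : Measurable (Function.uncurry K))
    (hK2 : ∀ r s, K r s * K r s = K r s) (hW : AEMeasurable W μ) (hh : Measurable h)
    (hm : Measurable m) (hq : Measurable q)
    (hpos : ∀ᵐ s ∂μ, h s ≠ 0 ∧ h s ≠ ∞)
    (h1 : ∀ᵐ r ∂μ, ∫⁻ s, K r s * (h s ^ 2)⁻¹ ∂μ ≤ A * m r)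
    (h2 : ∀ᵐ s ∂μ, (∫⁻ r, K r s * (m r * q r) ∂μ) * h s ^ 2 ≤ B * g s) :
    ∫⁻ r, (∫⁻ s, K r s * W s ∂μ) ^ 2 * q r ∂μ ≤ A * B * ∫⁻ s, W s ^ 2 * g s ∂μ := by
  have hKr : ∀ r, Measurable (K r) := fun r => hK.comp measurable_prodMk_left
  have step : ∀ᵐ r ∂μ, (∫⁻ s, K r s * W s ∂μ) ^ 2 * q r ≤
      A * ∫⁻ s, K r s * (m r * q r) * (W s ^ 2 * h s ^ 2) ∂μ := by
    filter_upwards [h1] with r hr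
    -- As `K² = K`, the integrand splits into the Cauchy-Schwarz factors `K h⁻¹` and `K W h`.
    have e1 : ∫⁻ s, K r s * W s ∂μ = ∫⁻ s, (K r s * (h s)⁻¹) * (K r s * (W s * h s)) ∂μ := by
      refine lintegral_congr_ae ?_
      filter_upwards [hpos] with s hs
      calc K r s * W s = (K r s * K r s) * W s * ((h s)⁻¹ * h s) := by
            rw [ENNReal.inv_mul_cancel hs.1 hs.2, hK2, mul_one]
        _ = _ := by ring
    have e2 := lintegral_mul_sq_le (μ := μ) (f := fun s => K r s * (h s)⁻¹)
      (g := fun s => K r s * (W s * h s)) ((hKr r).mul hh.inv).aemeasurable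
      ((hKr r).aemeasurable.mul (hW.mul hh.aemeasurable))
    have e3 : ∀ s, (K r s * (h s)⁻¹) ^ 2 = K r s * (h s ^ 2)⁻¹ := by
      intro s; rw [mul_pow, sq (K r s), hK2, ENNReal.inv_pow]
    have e4 : ∀ s, (K r s * (W s * h s)) ^ 2 = K r s * (W s ^ 2 * h s ^ 2) := by
      intro s; rw [mul_pow, sq (K r s), hK2, mul_pow]
    simp only [e3, e4] at e2
    rw [← e1] at e2
    calc (∫⁻ s, K r s * W s ∂μ) ^ 2 * q r
        ≤ ((A * m r) * ∫⁻ s, K r s * (W s ^ 2 * h s ^ 2) ∂μ) * q r := by 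
          gcongr
          exact e2.trans (by gcongr)
      _ = A * ((m r * q r) * ∫⁻ s, K r s * (W s ^ 2 * h s ^ 2) ∂μ) := by ring
      _ = _ := by
        rw [← lintegral_const_mul'' (f := fun s => K r s * (W s ^ 2 * h s ^ 2)) _
          ((hKr r).aemeasurable.mul ((hW.pow_const 2).mul (hh.pow_const 2).aemeasurable))]
        congr 1
        exact lintegral_congr fun s => by ring
  calc _ ≤ ∫⁻ r, A * ∫⁻ s, K r s * (m r * q r) * (W s ^ 2 * h s ^ 2) ∂μ ∂μ := lintegral_mono_ae step
    _ = A * ∫⁻ r, ∫⁻ s, K r s * (m r * q r) * (W s ^ 2 * h s ^ 2) ∂μ ∂μ := by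
        refine lintegral_const_mul'' _ (AEMeasurable.lintegral_prod_right' (f := fun z : ℝ × ℝ =>
          K z.1 z.2 * (m z.1 * q z.1) * (W z.2 ^ 2 * h z.2 ^ 2)) ?_)
        exact ((hK.mul ((hm.comp measurable_fst).mul (hq.comp measurable_fst))).aemeasurable).mul
          ((hW.comp_snd.pow_const 2).mul ((hh.comp measurable_snd).pow_const 2).aemeasurable)
    _ = A * ∫⁻ s, ∫⁻ r, K r s * (m r * q r) * (W s ^ 2 * h s ^ 2) ∂μ ∂μ := by
        rw [lintegral_lintegral_swap]
        exact ((hK.mul ((hm.comp measurable_fst).mul (hq.comp measurable_fst))).aemeasurable).mul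
          ((hW.comp_snd.pow_const 2).mul ((hh.comp measurable_snd).pow_const 2).aemeasurable)
    _ ≤ A * ∫⁻ s, B * (W s ^ 2 * g s) ∂μ := by
        gcongr A * ?_
        refine lintegral_mono_ae ?_
        filter_upwards [h2] with s hs
        have hKs : Measurable fun r => K r s := hK.comp measurable_prodMk_right
        rw [lintegral_mul_const (f := fun r => K r s * (m r * q r)) _ (hKs.mul (hm.mul hq))]
        calc _ = ((∫⁻ r, K r s * (m r * q r) ∂μ) * h s ^ 2) * W s ^ 2 := by ring
          _ ≤ (B * g s) * W s ^ 2 := by gcongr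
          _ = _ := by ring
    _ = _ := by rw [lintegral_const_mul' _ _ hB, mul_assoc]

theorem lintegral_rpow_Ioi {a c : ℝ} (ha : a < -1) (hc : 0 < c) :
    ∫⁻ x in Set.Ioi c, ENNReal.ofReal (x ^ a) = ENNReal.ofReal (c ^ (a + 1) / (-a - 1)) := by
  rw [← ofReal_integral_eq_lintegral_ofReal (integrableOn_Ioi_rpow_of_lt ha hc),
    integral_Ioi_rpow_of_lt ha hc]
  · congr 1
    rw [← neg_div_neg_eq]; congr 1 <;> ring
  · filter_upwards [ae_restrict_mem measurableSet_Ioi] with x hx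
    exact Real.rpow_nonneg (hc.trans hx).le _

theorem lintegral_rpow_Ioc {a c : ℝ} (ha : -1 < a) (hc : 0 ≤ c) :
    ∫⁻ x in Set.Ioc 0 c, ENNReal.ofReal (x ^ a) = ENNReal.ofReal (c ^ (a + 1) / (a + 1)) := by
  have hi := (intervalIntegral.intervalIntegrable_rpow' (a := 0) (b := c) ha)
  rw [intervalIntegrable_iff_integrableOn_Ioc_of_le hc] at hi
  rw [← ofReal_integral_eq_lintegral_ofReal hi, ← intervalIntegral.integral_of_le hc,
    integral_rpow (Or.inl ha), Real.zero_rpow (by linarith), sub_zero]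
  filter_upwards [ae_restrict_mem measurableSet_Ioc] with x hx
  exact Real.rpow_nonneg hx.1.le _

/-- A weighted Hardy inequality for functions vanishing at zero. -/
theorem hardy_zero {S : Set ℝ} (hS : MeasurableSet S) (hS0 : S ⊆ Set.Ioi 0) {g : ℝ → ℝ}
    (hg : Measurable g) (hg0 : ∀ r ∈ S, 0 ≤ g r) {δ k : ℝ} (hδ : δ < 1) (hk : 0 ≤ k)
    (hgr : ∀ s ∈ S, ∀ r ∈ S, s ≤ r → g r ≤ k * g s * (r / s) ^ δ) {W : ℝ → ℝ≥0∞}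
    (hW : AEMeasurable W (volume.restrict S)) :
    ∫⁻ r in S, (∫⁻ s in S ∩ Set.Iio r, W s) ^ 2 * ENNReal.ofReal (r ^ (-2 : ℝ) * g r) ≤
      ENNReal.ofReal (4 * k / (1 - δ) ^ 2) * ∫⁻ s in S, W s ^ 2 * ENNReal.ofReal (g s) := by
  set a : ℝ := (1 + δ) / 2 with ha
  have hc : 0 < 1 - a := by rw [ha]; linarith
  have hc' : 0 < a - δ := by rw [ha]; linarith
  have hKm : MeasurableSet {z : ℝ × ℝ | z.2 < z.1} := measurableSet_lt measurable_snd measurable_fst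
  have key := lintegral_sq_le_of_schur (μ := volume.restrict S)
    (K := fun r s => Set.indicator (Set.Iio r) 1 s) (W := W)
    (h := fun s => ENNReal.ofReal (s ^ (a / 2))) (m := fun r => ENNReal.ofReal (r ^ (1 - a)))
    (q := fun r => ENNReal.ofReal (r ^ (-2 : ℝ) * g r)) (g := fun s => ENNReal.ofReal (g s))
    (A := ENNReal.ofReal (1 / (1 - a))) (B := ENNReal.ofReal (k / (a - δ)))
    ENNReal.ofReal_ne_top ?_ ?_ hW (by fun_prop) (by fun_prop) (by fun_prop) ?_ ?_ ?_
  · rw [← ENNReal.ofReal_mul (by positivity)] at key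
    convert key using 1
    · refine lintegral_congr fun r => ?_
      congr 2
      rw [Set.inter_comm, ← Measure.restrict_restrict measurableSet_Iio,
        ← lintegral_indicator measurableSet_Iio]
      refine lintegral_congr fun s => ?_
      by_cases h : s < r <;> simp [h]
    · congr 2
      rw [ha]
      have : 1 - δ ≠ 0 := by linarith
      have h1 : 1 - (1 + δ) / 2 = (1 - δ) / 2 := by ring
      have h2 : (1 + δ) / 2 - δ = (1 - δ) / 2 := by ring
      rw [h1, h2]
      field_simp
      ring
  · have : Function.uncurry (fun r s : ℝ => Set.indicator (Set.Iio r) (1 : ℝ → ℝ≥0∞) s) =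
        Set.indicator {z : ℝ × ℝ | z.2 < z.1} 1 := by
      funext ⟨r, s⟩; by_cases h : s < r <;> simp [h]
    rw [this]
    exact measurable_one.indicator hKm
  · intro r s
    by_cases h : s < r <;> simp [h]
  · filter_upwards [ae_restrict_mem hS] with s hs
    have hs0 : 0 < s := hS0 hs
    exact ⟨(ENNReal.ofReal_pos.2 (Real.rpow_pos_of_pos hs0 _)).ne', ENNReal.ofReal_ne_top⟩
  · filter_upwards [ae_restrict_mem hS] with r hr
    have hr0 : 0 < r := hS0 hr
    calc ∫⁻ s in S, Set.indicator (Set.Iio r) 1 s * (ENNReal.ofReal (s ^ (a / 2)) ^ 2)⁻¹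
        ≤ ∫⁻ s in Set.Ioc 0 r, ENNReal.ofReal (s ^ (-a)) := by
          rw [← lintegral_indicator hS, ← lintegral_indicator measurableSet_Ioc]
          refine lintegral_mono fun s => ?_
          by_cases hs : s ∈ S
          · have hs0 : 0 < s := hS0 hs
            by_cases h : s < r
            · rw [Set.indicator_of_mem hs, Set.indicator_of_mem (show s ∈ Set.Iio r from h),
                Set.indicator_of_mem (show s ∈ Set.Ioc 0 r from ⟨hs0, h.le⟩),
                Pi.one_apply, one_mul, ← ENNReal.ofReal_pow (by positivity),
                ← ENNReal.ofReal_inv_of_pos (by positivity)]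
              apply ENNReal.ofReal_le_ofReal
              rw [Real.rpow_neg hs0.le, ← Real.rpow_natCast, ← Real.rpow_mul hs0.le]
              norm_num
            · rw [Set.indicator_of_mem hs, Set.indicator_of_notMem (show s ∉ Set.Iio r from h),
                zero_mul]
              exact zero_le
          · simp [hs]
      _ = _ := by
          rw [lintegral_rpow_Ioc (by linarith) hr0.le, ← ENNReal.ofReal_mul (by positivity)]
          congr 1
          rw [show -a + 1 = 1 - a by ring]; ring
  · filter_upwards [ae_restrict_mem hS] with s hs
    have hs0 : 0 < s := hS0 hs
    calc (∫⁻ r in S, Set.indicator (Set.Iio r) 1 s *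
          (ENNReal.ofReal (r ^ (1 - a)) * ENNReal.ofReal (r ^ (-2 : ℝ) * g r))) *
          ENNReal.ofReal (s ^ (a / 2)) ^ 2
        ≤ (∫⁻ r in Set.Ioi s, ENNReal.ofReal (k * g s * s ^ (-δ)) *
            ENNReal.ofReal (r ^ (-1 - a + δ))) * ENNReal.ofReal (s ^ (a / 2)) ^ 2 := by
          gcongr ?_ * _
          rw [← lintegral_indicator hS, ← lintegral_indicator measurableSet_Ioi]
          refine lintegral_mono fun r => ?_
          by_cases hr : r ∈ S
          · have hr0 : 0 < r := hS0 hr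
            by_cases h : s < r
            · rw [Set.indicator_of_mem hr, Set.indicator_of_mem (show s ∈ Set.Iio r from h),
                Set.indicator_of_mem (show r ∈ Set.Ioi s from h), Pi.one_apply, one_mul,
                ← ENNReal.ofReal_mul (by positivity), ← ENNReal.ofReal_mul (by
                  have := hg0 s hs; positivity)]
              apply ENNReal.ofReal_le_ofReal
              have h1 := hgr s hs r hr h.le
              rw [Real.div_rpow hr0.le hs0.le] at h1
              calc r ^ (1 - a) * (r ^ (-2 : ℝ) * g r) = r ^ (-1 - a) * g r := by
                    rw [← mul_assoc, ← Real.rpow_add hr0]; congr 2; ring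
                _ ≤ r ^ (-1 - a) * (k * g s * (r ^ δ / s ^ δ)) := by gcongr
                _ = _ := by rw [Real.rpow_add hr0, Real.rpow_neg hs0.le]; ring
            · simp [h]
          · simp [hr]
      _ = _ := by
          have hgs := hg0 s hs
          rw [lintegral_const_mul' _ _ ENNReal.ofReal_ne_top, lintegral_rpow_Ioi (by linarith) hs0,
            ← ENNReal.ofReal_pow (by positivity), ← ENNReal.ofReal_mul (by positivity),
            ← ENNReal.ofReal_mul (by
              have : 0 < -(-1 - a + δ) - 1 := by linarith
              positivity), ← ENNReal.ofReal_mul (by positivity)]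
          congr 1
          have h1 : (s ^ (a / 2)) ^ 2 = s ^ a := by
            rw [← Real.rpow_natCast, ← Real.rpow_mul hs0.le]; congr 1; push_cast; ring
          have h2 : s ^ (-δ) * s ^ (-1 - a + δ + 1) * s ^ a = 1 := by
            rw [← Real.rpow_add hs0, ← Real.rpow_add hs0,
              show -δ + (-1 - a + δ + 1) + a = 0 by ring, Real.rpow_zero]
          rw [h1, show -(-1 - a + δ) - 1 = a - δ by ring]
          calc _ = k * g s / (a - δ) * (s ^ (-δ) * s ^ (-1 - a + δ + 1) * s ^ a) := by ring
            _ = _ := by rw [h2]; ring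

/-- A weighted Hardy inequality for functions vanishing at infinity. -/
theorem hardy_infinity {g : ℝ → ℝ} (hg : Measurable g) {d c₁ c₂ : ℝ} (hd : 2 < d) (hc₁ : 0 < c₁)
    (hc₂ : 0 < c₂) (hg1 : ∀ s, 0 < s → c₁ * (1 + s) ^ (d - 1) ≤ g s)
    (hg2 : ∀ s, 0 < s → g s ≤ c₂ * (1 + s) ^ (d - 1)) {W : ℝ → ℝ≥0∞}
    (hW : AEMeasurable W (volume.restrict (Set.Ioi 0))) :
    ∫⁻ r in Set.Ioi 0, (∫⁻ s in Set.Ioi r, W s) ^ 2 *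
        ENNReal.ofReal ((1 + r) ^ (-2 : ℝ) * g r) ≤
      ENNReal.ofReal (4 * c₂ / (c₁ * (d - 2) ^ 2)) *
        ∫⁻ s in Set.Ioi 0, W s ^ 2 * ENNReal.ofReal (g s) := by
  -- The midpoint of `1` and `d - 1`: here `b > 1` is needed for convergence at infinity and `b < d
  -- - 1` for the integral over `r < s`.
  set b : ℝ := d / 2 with hb
  have hb1 : 0 < b - 1 := by rw [hb]; linarith
  have hbd : d - 1 - b = b - 1 := by rw [hb]; ring
  have hKm : MeasurableSet {z : ℝ × ℝ | z.1 < z.2} := measurableSet_lt measurable_fst measurable_snd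
  have shift : ∀ (T : Set ℝ) (f : ℝ → ℝ≥0∞), MeasurableSet T → Measurable f →
      ∫⁻ s in (fun s => 1 + s) ⁻¹' T, f (1 + s) = ∫⁻ s in T, f s := fun T f hT hf =>
    (measurePreserving_add_left volume (1 : ℝ)).setLIntegral_comp_preimage hT hf
  have key := lintegral_sq_le_of_schur (μ := volume.restrict (Set.Ioi 0))
    (K := fun r s => Set.indicator (Set.Ioi r) 1 s) (W := W)
    (h := fun s => ENNReal.ofReal ((1 + s) ^ (b / 2)))
    (m := fun r => ENNReal.ofReal ((1 + r) ^ (1 - b)))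
    (q := fun r => ENNReal.ofReal ((1 + r) ^ (-2 : ℝ) * g r)) (g := fun s => ENNReal.ofReal (g s))
    (A := ENNReal.ofReal (1 / (b - 1))) (B := ENNReal.ofReal (c₂ / (c₁ * (b - 1))))
    ENNReal.ofReal_ne_top ?_ ?_ hW (by fun_prop) (by fun_prop) (by fun_prop) ?_ ?_ ?_
  · rw [← ENNReal.ofReal_mul (by positivity)] at key
    convert key using 1
    · refine setLIntegral_congr_fun measurableSet_Ioi fun r hr => ?_
      congr 2
      have hsub : (volume : Measure ℝ).restrict (Set.Ioi r) =
          (volume.restrict (Set.Ioi 0)).restrict (Set.Ioi r) := by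
        rw [Measure.restrict_restrict measurableSet_Ioi,
          Set.inter_eq_self_of_subset_left (Set.Ioi_subset_Ioi (le_of_lt hr))]
      rw [hsub, ← lintegral_indicator measurableSet_Ioi]
      refine lintegral_congr fun s => ?_
      by_cases h : r < s
      · rw [Set.indicator_of_mem (show s ∈ Set.Ioi r from h), Set.indicator_of_mem
          (show s ∈ Set.Ioi r from h), Pi.one_apply, one_mul]
      · rw [Set.indicator_of_notMem (show s ∉ Set.Ioi r from h), Set.indicator_of_notMem
          (show s ∉ Set.Ioi r from h), zero_mul]
    · congr 2
      rw [show d - 2 = 2 * (b - 1) by rw [hb]; ring]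
      field_simp
      ring
  · have : Function.uncurry (fun r s : ℝ => Set.indicator (Set.Ioi r) (1 : ℝ → ℝ≥0∞) s) =
        Set.indicator {z : ℝ × ℝ | z.1 < z.2} 1 := by
      funext ⟨r, s⟩; by_cases h : r < s <;> simp [h]
    rw [this]
    exact measurable_one.indicator hKm
  · intro r s
    by_cases h : r < s <;> simp [h]
  · filter_upwards [ae_restrict_mem measurableSet_Ioi] with s hs
    have hs0 : 0 < 1 + s := by linarith [Set.mem_Ioi.1 hs]
    exact ⟨(ENNReal.ofReal_pos.2 (Real.rpow_pos_of_pos hs0 _)).ne', ENNReal.ofReal_ne_top⟩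
  · filter_upwards [ae_restrict_mem measurableSet_Ioi] with r hr
    have hr0 : (0 : ℝ) < r := hr
    calc ∫⁻ s in Set.Ioi 0, Set.indicator (Set.Ioi r) 1 s *
          (ENNReal.ofReal ((1 + s) ^ (b / 2)) ^ 2)⁻¹
        ≤ ∫⁻ s in (fun s => 1 + s) ⁻¹' (Set.Ioi (1 + r)), ENNReal.ofReal ((1 + s) ^ (-b)) := by
          rw [← lintegral_indicator measurableSet_Ioi, ← lintegral_indicator
            (measurableSet_Ioi.preimage (measurable_const_add 1))]
          refine lintegral_mono fun s => ?_
          by_cases h : r < s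
          · have hs0 : 0 < 1 + s := by linarith
            rw [Set.indicator_of_mem (show s ∈ Set.Ioi 0 from hr0.trans h),
              Set.indicator_of_mem (show s ∈ Set.Ioi r from h),
              Set.indicator_of_mem (show s ∈ (fun s => 1 + s) ⁻¹' (Set.Ioi (1 + r)) by
                simpa using h),
              Pi.one_apply, one_mul, ← ENNReal.ofReal_pow (by positivity),
              ← ENNReal.ofReal_inv_of_pos (by positivity)]
            apply ENNReal.ofReal_le_ofReal
            rw [Real.rpow_neg hs0.le, ← Real.rpow_natCast, ← Real.rpow_mul hs0.le]
            norm_num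
          · by_cases h0 : (0 : ℝ) < s <;> simp [h, h0]
      _ = _ := by
          rw [shift _ (fun s => ENNReal.ofReal (s ^ (-b))) measurableSet_Ioi (by fun_prop),
            lintegral_rpow_Ioi (by linarith) (by linarith), ← ENNReal.ofReal_mul (by positivity)]
          congr 1
          rw [show -b + 1 = 1 - b by ring, show - -b - 1 = b - 1 by ring]; ring
  · filter_upwards [ae_restrict_mem measurableSet_Ioi] with s hs
    have hs0 : (0 : ℝ) < s := hs
    -- Enlarging the range of `r` to `(-1, s]` makes the shifted integral start at zero, where the
    -- exponent `b - 2 > -1` is integrable.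
    calc (∫⁻ r in Set.Ioi 0, Set.indicator (Set.Ioi r) 1 s *
          (ENNReal.ofReal ((1 + r) ^ (1 - b)) * ENNReal.ofReal ((1 + r) ^ (-2 : ℝ) * g r))) *
          ENNReal.ofReal ((1 + s) ^ (b / 2)) ^ 2
        ≤ (∫⁻ r in (fun r => 1 + r) ⁻¹' (Set.Ioc 0 (1 + s)), ENNReal.ofReal c₂ *
            ENNReal.ofReal ((1 + r) ^ (b - 2))) * ENNReal.ofReal ((1 + s) ^ (b / 2)) ^ 2 := by
          gcongr ?_ * _
          rw [← lintegral_indicator measurableSet_Ioi, ← lintegral_indicator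
            (measurableSet_Ioc.preimage (measurable_const_add 1))]
          refine lintegral_mono fun r => ?_
          by_cases hr : 0 < r
          · have hr0 : 0 < 1 + r := by linarith
            by_cases h : r < s
            · rw [Set.indicator_of_mem (show r ∈ Set.Ioi 0 from hr),
                Set.indicator_of_mem (show s ∈ Set.Ioi r from h),
                Set.indicator_of_mem (show r ∈ (fun r => 1 + r) ⁻¹' (Set.Ioc 0 (1 + s)) from
                  ⟨hr0, by simpa using h.le⟩), Pi.one_apply, one_mul,
                ← ENNReal.ofReal_mul (by positivity), ← ENNReal.ofReal_mul hc₂.le]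
              apply ENNReal.ofReal_le_ofReal
              have h1 := hg2 r hr
              calc (1 + r) ^ (1 - b) * ((1 + r) ^ (-2 : ℝ) * g r) = (1 + r) ^ (-1 - b) * g r := by
                    rw [← mul_assoc, ← Real.rpow_add hr0]; congr 2; ring
                _ ≤ (1 + r) ^ (-1 - b) * (c₂ * (1 + r) ^ (d - 1)) := by gcongr
                _ = c₂ * ((1 + r) ^ (-1 - b) * (1 + r) ^ (d - 1)) := by ring
                _ = _ := by
                    rw [← Real.rpow_add hr0]; congr 2; linarith
            · rw [Set.indicator_of_mem (show r ∈ Set.Ioi 0 from hr),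
                Set.indicator_of_notMem (show s ∉ Set.Ioi r from h), zero_mul]
              exact zero_le
          · simp [hr]
      _ = ENNReal.ofReal (c₂ / (b - 1) * (1 + s) ^ (d - 1)) := by
          have h1s : 0 < 1 + s := by linarith
          rw [lintegral_const_mul' _ _ ENNReal.ofReal_ne_top,
            shift _ (fun s => ENNReal.ofReal (s ^ (b - 2))) measurableSet_Ioc (by fun_prop),
            lintegral_rpow_Ioc (by linarith) (by linarith),
            ← ENNReal.ofReal_pow (by positivity), ← ENNReal.ofReal_mul (by positivity),
            ← ENNReal.ofReal_mul (by
              have : 0 < b - 2 + 1 := by linarith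
              positivity)]
          congr 1
          have h1 : ((1 + s) ^ (b / 2)) ^ 2 = (1 + s) ^ b := by
            rw [← Real.rpow_natCast, ← Real.rpow_mul h1s.le]; congr 1; push_cast; ring
          have h2 : (1 + s) ^ (b - 2 + 1) * (1 + s) ^ b = (1 + s) ^ (d - 1) := by
            rw [← Real.rpow_add h1s]; congr 1; linarith
          rw [h1, ← h2, show b - 2 + 1 = b - 1 by ring]; ring
      _ ≤ _ := by
          rw [← ENNReal.ofReal_mul (by positivity)]
          apply ENNReal.ofReal_le_ofReal
          calc c₂ / (b - 1) * (1 + s) ^ (d - 1) =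
                c₂ / (c₁ * (b - 1)) * (c₁ * (1 + s) ^ (d - 1)) := by field_simp
            _ ≤ _ := by
                have := hg1 s hs0
                gcongr

end HalfLine

/-! ### Sobolev functions along rays and the Hardy inequality -/

namespace RegularTree

variable {Γ : RegularTree}

theorem MemLp.comp_ray {w : Γ.Point → ℂ} (hw : MemLp w 2 volume) (ω : ∀ k, Fin (Γ.b k)) :
    MemLp (fun s => w (ray ω s)) 2 (volume.restrict (Set.Ioi 0)) :=
  (hw.mono_measure (map_ray_le ω)).comp_of_map (measurable_ray ω).aemeasurable

theorem integrableOn_ray {w : Γ.Point → ℂ} (hw : MemLp w 2 volume) (ω : ∀ k, Fin (Γ.b k)) (s : ℝ) :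
    IntegrableOn (fun r => w (ray ω r)) (Set.Ioc 0 s) := by
  have h : MemLp (fun s => w (ray ω s)) 2 (volume.restrict (Set.Ioc 0 s)) :=
    (MemLp.comp_ray hw ω).mono_measure (Measure.restrict_mono Set.Ioc_subset_Ioi_self le_rfl)
  exact h.integrable one_le_two

theorem intervalIntegrable_ray {w : Γ.Point → ℂ} (hw : MemLp w 2 volume) (ω : ∀ k, Fin (Γ.b k))
    {r s : ℝ} (hr : 0 ≤ r) (hs : 0 ≤ s) :
    IntervalIntegrable (fun r => w (ray ω r)) volume r s := by
  have h0 : ∀ {x : ℝ}, 0 ≤ x → IntervalIntegrable (fun r => w (ray ω r)) volume 0 x := fun hx =>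
    (intervalIntegrable_iff_integrableOn_Ioc_of_le hx).2 (integrableOn_ray hw ω _)
  exact (h0 hr).symm.trans (h0 hs)

theorem enorm_integral_ray_le (w : Γ.Point → ℂ) (ω : ∀ k, Fin (Γ.b k)) {r s : ℝ} (hrs : r ≤ s) :
    ‖∫ x in r..s, w (ray ω x)‖ₑ ≤ ∫⁻ x in Set.Ioc r s, ‖w (ray ω x)‖ₑ := by
  rw [intervalIntegral.integral_of_le hrs]
  exact enorm_integral_le_lintegral_enorm _

/-- The value of an integral along a ray is controlled by the `L₂` norm of the integrand. -/
theorem enorm_integral_ray_sq_le {w : Γ.Point → ℂ} (hw : MemLp w 2 volume)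
    (ω : ∀ k, Fin (Γ.b k)) {s : ℝ} (hs : 0 ≤ s) :
    ‖∫ x in (0 : ℝ)..s, w (ray ω x)‖ₑ ^ 2 ≤ ENNReal.ofReal s * ∫⁻ x, ‖w x‖ₑ ^ 2 := by
  calc _ ≤ (∫⁻ x in Set.Ioc 0 s, 1 * ‖w (ray ω x)‖ₑ) ^ 2 := by
        simp only [one_mul]
        exact pow_le_pow_left' (enorm_integral_ray_le w ω hs) 2
    _ ≤ (∫⁻ x in Set.Ioc 0 s, 1 ^ 2) * ∫⁻ x in Set.Ioc 0 s, ‖w (ray ω x)‖ₑ ^ 2 :=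
        lintegral_mul_sq_le aemeasurable_const (integrableOn_ray hw ω s).1.enorm
    _ ≤ _ := by
        gcongr
        · simp
        · exact (lintegral_mono_set Set.Ioc_subset_Ioi_self).trans
            (setLIntegral_ray_le ω (hw.1.enorm.pow_const 2))

/-- The edgewise formulas telescope from the root, where `u` vanishes; continuity at the vertices is
built into the parametrization of a ray. -/
theorem IsSobolev.ray_eq {u w : Γ.Point → ℂ} (h : Γ.IsSobolev u w) (ω : ∀ k, Fin (Γ.b k)) {s : ℝ}
    (hs : 0 ≤ s) : u (ray ω s) = ∫ r in (0 : ℝ)..s, w (ray ω r) := by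
  have key : ∀ n, ∀ s ∈ Set.Icc (Γ.t n) (Γ.t (n + 1)),
      u (ray ω s) = ∫ r in (0 : ℝ)..s, w (ray ω r) := by
    have step : ∀ n, u (ray ω (Γ.t n)) = (∫ r in (0 : ℝ)..(Γ.t n), w (ray ω r)) →
        ∀ s ∈ Set.Icc (Γ.t n) (Γ.t (n + 1)), u (ray ω s) = ∫ r in (0 : ℝ)..s, w (ray ω r) := by
      intro n hn s hs
      have h1 := h.eq_integral (rayEdge ω n) s hs
      rw [← RegularTree.ray_eq ω hs] at h1
      change _ = u (Γ.edgePoint (rayEdge ω n) (Γ.t n)) + ∫ r in (Γ.t n)..s, _ at h1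
      rw [← RegularTree.ray_eq ω ⟨le_rfl, (Γ.t_lt_succ n).le⟩, hn] at h1
      rw [h1, ← intervalIntegral.integral_add_adjacent_intervals
        (intervalIntegrable_ray h.memLp_deriv ω le_rfl (Γ.t_nonneg n))
        (intervalIntegrable_ray h.memLp_deriv ω (Γ.t_nonneg n) ((Γ.t_nonneg n).trans hs.1))]
      congr 1
      refine intervalIntegral.integral_congr fun r hr => ?_
      rw [Set.uIcc_of_le hs.1] at hr
      simp only [RegularTree.ray_eq ω ⟨hr.1, hr.2.trans hs.2⟩]
    intro n
    induction n with
    | zero =>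
      apply step
      rw [Γ.t_zero, ray_zero, h.root_eq_zero, intervalIntegral.integral_same]
    | succ n ih => exact step _ (ih _ ⟨(Γ.t_lt_succ n).le, le_rfl⟩)
  rcases hs.eq_or_lt with rfl | h0
  · rw [ray_zero, h.root_eq_zero, intervalIntegral.integral_same]
  · obtain ⟨n, hn⟩ := Γ.exists_mem_Ioc h0
    exact key n s ⟨hn.1.le, hn.2⟩

theorem edgePoint_clamp (e : Γ.Edge) (s : ℝ) :
    Γ.edgePoint e (Γ.clamp e.gen s) = Γ.edgePoint e s := by
  have hc : ∀ n, Γ.clamp n (Γ.clamp n s) = Γ.clamp n s := by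
    intro n
    have h1 : min (Γ.clamp n s) (Γ.t (n + 1)) = Γ.clamp n s := min_eq_left (Γ.clamp_le n s)
    conv_lhs => unfold clamp
    change max (Γ.t n) (min (Γ.clamp n s) (Γ.t (n + 1))) = _
    rw [h1, max_eq_right (Γ.le_clamp n s)]
  obtain ⟨n, v⟩ := e
  cases n with
  | zero => simp only [edgePoint, hc]
  | succ n => simp only [edgePoint, hc]

/-- With `IsSobolev.ray_eq` this replaces the edgewise conditions by one integral formula on rays,
which is stable under limits. -/
theorem isSobolev_of_ray {u w : Γ.Point → ℂ} (hu : MemLp u 2 volume) (hw : MemLp w 2 volume)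
    (h : ∀ (ω : ∀ k, Fin (Γ.b k)) (s : ℝ), 0 ≤ s →
      u (ray ω s) = ∫ r in (0 : ℝ)..s, w (ray ω r)) : Γ.IsSobolev u w := by
  have hray : ∀ (e : Γ.Edge), ∀ s ∈ Set.Icc (Γ.t e.gen) (Γ.t (e.gen + 1)),
      Γ.edgePoint e s = ray (rayThrough e) s := fun e s hs => (ray_rayThrough e hs).symm
  have hint : ∀ e : Γ.Edge, ∀ s ∈ Set.Icc (Γ.t e.gen) (Γ.t (e.gen + 1)),
      Set.EqOn (fun r => w (Γ.edgePoint e r)) (fun r => w (ray (rayThrough e) r))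
        (Set.uIcc (Γ.t e.gen) s) := by
    intro e s hs r hr
    rw [Set.uIcc_of_le hs.1] at hr
    simp only [hray e r ⟨hr.1, hr.2.trans hs.2⟩]
  refine ⟨fun e => ?_, fun e => ?_, fun e s hs => ?_, hu, hw, ?_⟩
  · have h1 : ContinuousOn (fun x => ∫ r in (0 : ℝ)..x, w (ray (rayThrough e) r))
        (Set.uIcc 0 (Γ.t (e.gen + 1))) := by
      refine intervalIntegral.continuousOn_primitive_interval ?_
      rw [Set.uIcc_of_le (Γ.t_nonneg _), integrableOn_Icc_iff_integrableOn_Ioc]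
      exact integrableOn_ray hw _ _
    rw [Set.uIcc_of_le (Γ.t_nonneg _)] at h1
    have hcl : Continuous (Γ.clamp e.gen) :=
      continuous_const.max (continuous_id.min continuous_const)
    have h2 := h1.comp_continuous hcl fun s =>
      ⟨(Γ.t_nonneg _).trans (Γ.le_clamp _ s), Γ.clamp_le _ s⟩
    refine h2.congr fun s => ?_
    rw [← edgePoint_clamp e s, hray e _ ⟨Γ.le_clamp _ s, Γ.clamp_le _ s⟩,
      h _ _ ((Γ.t_nonneg _).trans (Γ.le_clamp _ s))]
    rfl
  · refine (intervalIntegrable_ray hw (rayThrough e) (Γ.t_nonneg e.gen)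
      (Γ.t_nonneg (e.gen + 1))).congr ?_
    intro r hr
    exact (hint e _ ⟨(Γ.t_lt_succ _).le, le_rfl⟩ (Set.uIoc_subset_uIcc hr)).symm
  · rw [hray e s hs, hray e _ ⟨le_rfl, (Γ.t_lt_succ _).le⟩, h _ _ ((Γ.t_nonneg _).trans hs.1),
      h _ _ (Γ.t_nonneg _), intervalIntegral.integral_congr (hint e s hs),
      intervalIntegral.integral_add_adjacent_intervals
        (intervalIntegrable_ray hw _ le_rfl (Γ.t_nonneg _))
        (intervalIntegrable_ray hw _ (Γ.t_nonneg _) ((Γ.t_nonneg _).trans hs.1))]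
  · have := h (rayThrough ⟨0, Γ.root.edge.top⟩) 0 le_rfl
    rwa [ray_zero, intervalIntegral.integral_same] at this

theorem IsSobolev.enorm_sq_le {u w : Γ.Point → ℂ} (h : Γ.IsSobolev u w) (x : Γ.Point) :
    ‖u x‖ₑ ^ 2 ≤ ENNReal.ofReal x.abs * ∫⁻ y, ‖w y‖ₑ ^ 2 := by
  conv_lhs => rw [← ray_abs x]
  rw [h.ray_eq _ (abs_nonneg x)]
  exact enorm_integral_ray_sq_le h.memLp_deriv _ (abs_nonneg x)

variable (Γ) in
theorem measurable_branching : Measurable Γ.branching := by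
  have h : Monotone fun s : ℝ => sInf {m : ℕ | s ≤ Γ.t m} := fun s r hsr =>
    Nat.sInf_le (hsr.trans (Nat.sInf_mem (Γ.exists_le_t r)))
  exact (measurable_from_top (f := fun n => ∏ k ∈ Finset.range n, (Γ.b k : ℝ))).comp h.measurable

/-- On almost every ray a square integrable function on the tree takes arbitrarily small values
arbitrarily far from the root, if the branching function is bounded below. -/
theorem exists_enorm_ray_lt {c : ℝ} (hc : 0 < c) (hg : ∀ s, 0 < s → c ≤ Γ.branching s)
    {u : Γ.Point → ℂ} {ω : ∀ k, Fin (Γ.b k)}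
    (hu : ∫⁻ s in Set.Ioi 0, ‖u (ray ω s)‖ₑ ^ 2 * ENNReal.ofReal (Γ.branching s) < ∞)
    {ε : ℝ≥0∞} (hε : ε ≠ 0) {r : ℝ} (hr : 0 ≤ r) : ∃ s, r < s ∧ ‖u (ray ω s)‖ₑ < ε := by
  by_contra! hcon
  refine hu.ne (top_unique ?_)
  -- A positive constant has infinite integral over a half-line.
  calc ∞ = ∫⁻ s in Set.Ioi r, ε ^ 2 * ENNReal.ofReal c := by
        rw [setLIntegral_const, Real.volume_Ioi, ENNReal.mul_top]
        simp [hε, hc]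
    _ ≤ ∫⁻ s in Set.Ioi r, ‖u (ray ω s)‖ₑ ^ 2 * ENNReal.ofReal (Γ.branching s) := by
        refine setLIntegral_mono' measurableSet_Ioi fun s hs => ?_
        gcongr
        · exact hcon s hs
        · exact hg s (hr.trans_lt hs)
    _ ≤ _ := lintegral_mono_set (Set.Ioi_subset_Ioi hr)

theorem IsSobolev.enorm_ray_le {u w : Γ.Point → ℂ} (h : Γ.IsSobolev u w) (ω : ∀ k, Fin (Γ.b k))
    {r : ℝ} (hr : 0 ≤ r) : ‖u (ray ω r)‖ₑ ≤ ∫⁻ s in Set.Ioo 0 r, ‖w (ray ω s)‖ₑ := by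
  rw [h.ray_eq ω hr, setLIntegral_congr Ioo_ae_eq_Ioc]
  exact enorm_integral_ray_le w ω hr

/-- There are points `s > r` on the ray with `|u(s)|` arbitrarily small, so `u(r)` is up to that
error the negative of the integral of `w` over `(r, s)`. -/
theorem IsSobolev.enorm_ray_le_Ioi {u w : Γ.Point → ℂ} (h : Γ.IsSobolev u w) {c : ℝ} (hc : 0 < c)
    (hg : ∀ s, 0 < s → c ≤ Γ.branching s) {ω : ∀ k, Fin (Γ.b k)}
    (hu : ∫⁻ s in Set.Ioi 0, ‖u (ray ω s)‖ₑ ^ 2 * ENNReal.ofReal (Γ.branching s) < ∞)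
    {r : ℝ} (hr : 0 ≤ r) : ‖u (ray ω r)‖ₑ ≤ ∫⁻ s in Set.Ioi r, ‖w (ray ω s)‖ₑ := by
  refine ENNReal.le_of_forall_pos_le_add fun ε hε _ => ?_
  obtain ⟨s, hrs, hs⟩ := exists_enorm_ray_lt hc hg hu (ENNReal.coe_ne_zero.2 hε.ne') hr
  have e : u (ray ω r) = u (ray ω s) - ∫ x in r..s, w (ray ω x) := by
    rw [h.ray_eq ω hr, h.ray_eq ω (hr.trans hrs.le), eq_sub_iff_add_eq,
      intervalIntegral.integral_add_adjacent_intervals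
        (intervalIntegrable_ray h.memLp_deriv ω le_rfl hr)
        (intervalIntegrable_ray h.memLp_deriv ω hr (hr.trans hrs.le))]
  rw [e, add_comm]
  calc _ ≤ ‖u (ray ω s)‖ₑ + ‖∫ x in r..s, w (ray ω x)‖ₑ := enorm_sub_le
    _ ≤ _ := by
      gcongr
      exact (enorm_integral_ray_le w ω hrs.le).trans (lintegral_mono_set Set.Ioc_subset_Ioi_self)

theorem aemeasurable_enorm_ray {w : Γ.Point → ℂ} (hw : MemLp w 2 volume)
    (ω : ∀ k, Fin (Γ.b k)) :
    AEMeasurable (fun s => ‖w (ray ω s)‖ₑ) (volume.restrict (Set.Ioi 0)) :=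
  (MemLp.comp_ray hw ω).1.enorm

/-- The Hardy inequality on a ray, for dimension less than two. -/
theorem IsSobolev.hardy_ray_of_lt_two {u w : Γ.Point → ℂ} (h : Γ.IsSobolev u w) {d c₁ c₂ : ℝ}
    (hd1 : 1 ≤ d) (hd : d < 2) (hc₁ : 0 < c₁) (hc₂ : 0 < c₂)
    (hg : ∀ s, 0 < s → c₁ * (1 + s) ^ (d - 1) ≤ Γ.branching s ∧
      Γ.branching s ≤ c₂ * (1 + s) ^ (d - 1)) (ω : ∀ k, Fin (Γ.b k)) :
    ∫⁻ s in Set.Ioi 0, ‖u (ray ω s)‖ₑ ^ 2 * ENNReal.ofReal (s ^ (-2 : ℝ)) *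
        ENNReal.ofReal (Γ.branching s) ≤
      ENNReal.ofReal (4 * (c₂ / c₁) / (2 - d) ^ 2) *
        ∫⁻ s in Set.Ioi 0, ‖w (ray ω s)‖ₑ ^ 2 * ENNReal.ofReal (Γ.branching s) := by
  have hg0 : ∀ s, 0 < s → 0 ≤ Γ.branching s := fun s hs => le_trans (by positivity) (hg s hs).1
  have key := hardy_zero (S := Set.Ioi 0) measurableSet_Ioi subset_rfl Γ.measurable_branching
    (fun r hr => hg0 r hr) (δ := d - 1) (k := c₂ / c₁) (by linarith) (by positivity) ?_
    (aemeasurable_enorm_ray h.memLp_deriv ω)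
  · rw [show 1 - (d - 1) = 2 - d by ring] at key
    refine le_trans (setLIntegral_mono' measurableSet_Ioi fun s hs => ?_) key
    have hs0 : (0 : ℝ) < s := hs
    rw [mul_assoc, ← ENNReal.ofReal_mul (by positivity)]
    gcongr
    exact h.enorm_ray_le ω hs0.le
  · intro s hs r hr hsr
    have hs0 : (0 : ℝ) < s := hs
    have hr0 : (0 : ℝ) < r := hr
    -- This turns growth like `(1+t)^(d-1)` into the homogeneous condition of `hardy_zero` with `δ =
    -- d - 1 < 1`.
    have h1 : (1 + r) / (1 + s) ≤ r / s := by
      rw [div_le_div_iff₀ (by positivity) hs0]; nlinarith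
    calc Γ.branching r ≤ c₂ * (1 + r) ^ (d - 1) := (hg r hr0).2
      _ = c₂ / c₁ * (c₁ * (1 + s) ^ (d - 1)) * ((1 + r) / (1 + s)) ^ (d - 1) := by
          rw [Real.div_rpow (by positivity) (by positivity)]
          field_simp
      _ ≤ _ := by
          have hb := hg0 s hs0
          have hd' : 0 ≤ d - 1 := by linarith
          gcongr
          exact (hg s hs0).1

/-- The Hardy inequality on a ray, for dimension greater than two. -/
theorem IsSobolev.hardy_ray_of_two_lt {u w : Γ.Point → ℂ} (h : Γ.IsSobolev u w) {d c₁ c₂ : ℝ}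
    (hd : 2 < d) (hc₁ : 0 < c₁) (hc₂ : 0 < c₂)
    (hg : ∀ s, 0 < s → c₁ * (1 + s) ^ (d - 1) ≤ Γ.branching s ∧
      Γ.branching s ≤ c₂ * (1 + s) ^ (d - 1)) {ω : ∀ k, Fin (Γ.b k)}
    (hu : ∫⁻ s in Set.Ioi 0, ‖u (ray ω s)‖ₑ ^ 2 * ENNReal.ofReal (Γ.branching s) < ∞) :
    ∫⁻ s in Set.Ioi 0, ‖u (ray ω s)‖ₑ ^ 2 * ENNReal.ofReal (s ^ (-2 : ℝ)) *
        ENNReal.ofReal (Γ.branching s) ≤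
      ENNReal.ofReal (4 * (c₂ * 2 ^ (d - 1) / c₁) + 4 * (4 * c₂ / (c₁ * (d - 2) ^ 2))) *
        ∫⁻ s in Set.Ioi 0, ‖w (ray ω s)‖ₑ ^ 2 * ENNReal.ofReal (Γ.branching s) := by
  have hg0 : ∀ s, 0 < s → 0 ≤ Γ.branching s := fun s hs => le_trans (by positivity) (hg s hs).1
  have hgc : ∀ s, 0 < s → c₁ ≤ Γ.branching s := fun s hs =>
    le_trans (le_mul_of_one_le_right hc₁.le
      (Real.one_le_rpow (by linarith) (by linarith))) (hg s hs).1
  have hsub : Set.Ioc (0 : ℝ) 1 ⊆ Set.Ioi 0 := Set.Ioc_subset_Ioi_self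
  -- Near the root the weight is comparable to a constant, so `δ = 0` is admissible whatever `d` is;
  -- `2^(d-1)` bounds `(1+r)^(d-1)` on `(0, 1]`.
  have near := hardy_zero (S := Set.Ioc 0 1) measurableSet_Ioc hsub Γ.measurable_branching
    (fun r hr => hg0 r hr.1) (δ := 0) (k := c₂ * 2 ^ (d - 1) / c₁) (by norm_num) (by positivity) ?_
    ((aemeasurable_enorm_ray h.memLp_deriv ω).mono_measure (Measure.restrict_mono hsub le_rfl))
  · have far := hardy_infinity Γ.measurable_branching hd hc₁ hc₂ (fun s hs => (hg s hs).1)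
      (fun s hs => (hg s hs).2) (aemeasurable_enorm_ray h.memLp_deriv ω)
    have hunion : Set.Ioi (0 : ℝ) = Set.Ioc 0 1 ∪ Set.Ioi 1 :=
      (Set.Ioc_union_Ioi_eq_Ioi zero_le_one).symm
    conv_lhs => rw [hunion]
    refine (lintegral_union_le _ _ _).trans ?_
    rw [ENNReal.ofReal_add (by positivity) (by positivity), add_mul]
    refine add_le_add ?_ ?_
    · have h1 : (1 - (0 : ℝ)) ^ 2 = 1 := by norm_num
      rw [h1, div_one] at near
      refine le_trans (setLIntegral_mono' measurableSet_Ioc fun s hs => ?_) (near.trans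
        (mul_le_mul_right (lintegral_mono_set hsub) _))
      have hs0 : (0 : ℝ) < s := hs.1
      rw [mul_assoc, ← ENNReal.ofReal_mul (by positivity)]
      gcongr
      refine (h.enorm_ray_le ω hs0.le).trans (lintegral_mono_set fun x hx => ?_)
      exact ⟨⟨hx.1, hx.2.le.trans hs.2⟩, hx.2⟩
    · rw [ENNReal.ofReal_mul (by norm_num), mul_assoc]
      refine le_trans ?_ (mul_le_mul_right far _)
      rw [← lintegral_const_mul' _ _ ENNReal.ofReal_ne_top]
      refine le_trans (setLIntegral_mono' measurableSet_Ioi fun s hs => ?_)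
        (lintegral_mono_set (Set.Ioi_subset_Ioi zero_le_one))
      have hs1 : (1 : ℝ) < s := hs
      have hs0 : (0 : ℝ) < s := by linarith
      have hb := hg0 s hs0
      rw [mul_assoc, ← ENNReal.ofReal_mul (by positivity), mul_left_comm,
        ← ENNReal.ofReal_mul (by norm_num)]
      refine mul_le_mul' (pow_le_pow_left' ?_ 2) (ENNReal.ofReal_le_ofReal ?_)
      · exact h.enorm_ray_le_Ioi hc₁ hgc hu hs0.le
      · rw [← mul_assoc]
        refine mul_le_mul_of_nonneg_right ?_ hb
        -- Beyond `1` one has `1 + s ≤ 2s`, hence `s⁻² ≤ 4(1+s)⁻²`: the factor `4` in front of the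
        -- second constant.
        rw [Real.rpow_neg hs0.le, Real.rpow_neg (by linarith), Real.rpow_two, Real.rpow_two,
          ← div_eq_mul_inv, inv_le_comm₀ (by positivity) (by positivity), inv_div,
          div_le_iff₀ (by norm_num)]
        nlinarith
  · intro s hs r hr hsr
    have hs0 := hs.1
    have hr0 := hr.1
    rw [Real.rpow_zero, mul_one]
    calc Γ.branching r ≤ c₂ * (1 + r) ^ (d - 1) := (hg r hr0).2
      _ ≤ c₂ * 2 ^ (d - 1) := by
          gcongr
          · linarith
          · linarith [hr.2]
      _ = c₂ * 2 ^ (d - 1) / c₁ * c₁ := by field_simp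
      _ ≤ _ := by
          gcongr
          exact hgc s hs0

theorem IsSobolev.lintegral_lt_top {u w : Γ.Point → ℂ} (h : Γ.IsSobolev u w) :
    ∫⁻ x, ‖u x‖ₑ ^ 2 < ∞ := by
  have := h.memLp.2
  rw [eLpNorm_lt_top_iff_lintegral_rpow_enorm_lt_top two_ne_zero ENNReal.ofNat_ne_top] at this
  simpa using this

/-- A Hardy inequality on almost every ray implies the Hardy inequality on the tree. -/
theorem IsSobolev.hardy_of_hardy_ray {u w : Γ.Point → ℂ} (h : Γ.IsSobolev u w) {C : ℝ}
    (hC : ∀ ω : ∀ k, Fin (Γ.b k),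
      ∫⁻ s in Set.Ioi 0, ‖u (ray ω s)‖ₑ ^ 2 * ENNReal.ofReal (Γ.branching s) < ∞ →
      ∫⁻ s in Set.Ioi 0, ‖u (ray ω s)‖ₑ ^ 2 * ENNReal.ofReal (s ^ (-2 : ℝ)) *
        ENNReal.ofReal (Γ.branching s) ≤
      ENNReal.ofReal C *
        ∫⁻ s in Set.Ioi 0, ‖w (ray ω s)‖ₑ ^ 2 * ENNReal.ofReal (Γ.branching s)) :
    ∫⁻ x, ‖u x‖ₑ ^ 2 * ENNReal.ofReal (x.abs ^ (-2 : ℝ)) ≤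
      ENNReal.ofReal C * ∫⁻ x, ‖w x‖ₑ ^ 2 := by
  have hu2 : AEMeasurable (fun x => ‖u x‖ₑ ^ 2) (volume : Measure Γ.Point) :=
    h.memLp.1.enorm.pow_const 2
  have hw2 : AEMeasurable (fun x => ‖w x‖ₑ ^ 2) (volume : Measure Γ.Point) :=
    h.memLp_deriv.1.enorm.pow_const 2
  have habs : Measurable fun x : Γ.Point => ENNReal.ofReal (x.abs ^ (-2 : ℝ)) :=
    (measurable_abs.pow_const _).ennreal_ofReal
  have hF : AEMeasurable (fun x : Γ.Point => ‖u x‖ₑ ^ 2 * ENNReal.ofReal (x.abs ^ (-2 : ℝ)))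
      volume := hu2.mul habs.aemeasurable
  have hfin : ∫⁻ ω, (∫⁻ s in Set.Ioi 0,
      ‖u (ray ω s)‖ₑ ^ 2 * ENNReal.ofReal (Γ.branching s)) ∂Γ.rayMeasure ≠ ∞ := by
    rw [← lintegral_eq_lintegral_ray hu2]
    exact h.lintegral_lt_top.ne
  -- Square integrability on the tree passes to almost every ray, which is all that the inequality
  -- on rays requires.
  have hae := ae_lt_top (measurable_lintegral_ray (fun x => ‖u x‖ₑ ^ 2)
    fun s => ENNReal.ofReal (Γ.branching s)) hfin
  rw [lintegral_eq_lintegral_ray hF, lintegral_eq_lintegral_ray hw2,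
    ← lintegral_const_mul' _ _ ENNReal.ofReal_ne_top]
  refine lintegral_mono_ae ?_
  filter_upwards [hae] with ω hω
  refine le_trans (le_of_eq ?_) (hC ω hω)
  refine setLIntegral_congr_fun measurableSet_Ioi fun s hs => ?_
  simp only [abs_ray ω (le_of_lt hs)]

/-- The Hardy inequality on a regular tree of global dimension different from two. -/
theorem HasGlobalDimension.exists_hardy {d : ℝ} (hd : Γ.HasGlobalDimension d) (hd2 : d ≠ 2) :
    ∃ C : ℝ, 0 < C ∧ ∀ u w : Γ.Point → ℂ, Γ.IsSobolev u w →
      ∫⁻ x, ‖u x‖ₑ ^ 2 * ENNReal.ofReal (x.abs ^ (-2 : ℝ)) ≤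
        ENNReal.ofReal C * ∫⁻ x, ‖w x‖ₑ ^ 2 := by
  obtain ⟨hd1, c₁, c₂, hc₁, hc₁₂, hg⟩ := hd
  have hc₂ := hc₁.trans hc₁₂
  rcases hd2.lt_or_gt with h | h
  · refine ⟨4 * (c₂ / c₁) / (2 - d) ^ 2, ?_, fun u w hu => hu.hardy_of_hardy_ray fun ω _ =>
      hu.hardy_ray_of_lt_two hd1 h hc₁ hc₂ hg ω⟩
    have : 0 < 2 - d := by linarith
    positivity
  · refine ⟨4 * (c₂ * 2 ^ (d - 1) / c₁) + 4 * (4 * c₂ / (c₁ * (d - 2) ^ 2)), ?_,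
      fun u w hu => hu.hardy_of_hardy_ray fun ω hω => hu.hardy_ray_of_two_lt h hc₁ hc₂ hg hω⟩
    have : 0 < d - 2 := by linarith
    positivity

end RegularTree

/-! ### The Sobolev space as a Hilbert space -/

theorem lintegral_enorm_sq_eq {X : Type*} [MeasurableSpace X] {μ : Measure X} (f : X → ℂ) :
    ∫⁻ x, ‖f x‖ₑ ^ 2 ∂μ = eLpNorm f 2 μ ^ 2 := by
  have h := eLpNorm_nnreal_pow_eq_lintegral (μ := μ) (f := f) (p := 2) two_ne_zero
  simp only [NNReal.coe_ofNat, ENNReal.rpow_ofNat, ENNReal.coe_ofNat] at h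
  exact h.symm

theorem lintegral_enorm_sq_Lp {X : Type*} [MeasurableSpace X] {μ : Measure X} (f : Lp ℂ 2 μ) :
    ∫⁻ x, ‖f x‖ₑ ^ 2 ∂μ = ENNReal.ofReal (‖f‖ ^ 2) := by
  rw [lintegral_enorm_sq_eq, ← Lp.enorm_def, ← ofReal_norm,
    ENNReal.ofReal_pow (norm_nonneg _)]

namespace RegularTree

variable {Γ : RegularTree}

theorem ae_eq_zero_of_edge {f : Γ.Point → ℂ} (hf : AEStronglyMeasurable f volume)
    (h : ∀ e : Γ.Edge, ∀ᵐ s ∂(volume.restrict (Set.Icc (Γ.t e.gen) (Γ.t (e.gen + 1)))),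
      f (Γ.edgePoint e s) = 0) : f =ᵐ[volume] 0 := by
  have h1 : ∫⁻ x, ‖f x‖ₑ = 0 := by
    rw [lintegral_eq_tsum hf.enorm, ENNReal.tsum_eq_zero]
    intro e
    rw [lintegral_congr_ae (g := fun _ => 0) ?_, lintegral_zero]
    filter_upwards [h e] with s hs
    rw [hs, enorm_zero]
  rw [lintegral_eq_zero_iff' hf.enorm] at h1
  filter_upwards [h1] with x hx
  simpa using hx

theorem clamp_eq_self {n : ℕ} {s : ℝ} (hs : s ∈ Set.Icc (Γ.t n) (Γ.t (n + 1))) :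
    Γ.clamp n s = s := by
  unfold clamp
  rw [min_eq_left hs.2, max_eq_right hs.1]

/-- A Sobolev function that vanishes almost everywhere has zero derivative. -/
theorem IsSobolev.deriv_ae_eq_zero {u w : Γ.Point → ℂ} (h : Γ.IsSobolev u w)
    (hu : u =ᵐ[volume] 0) : w =ᵐ[volume] 0 := by
  refine ae_eq_zero_of_edge h.memLp_deriv.1 fun e => ?_
  have h1 : (fun s => u (Γ.edgePoint e s))
      =ᵐ[volume.restrict (Set.Icc (Γ.t e.gen) (Γ.t (e.gen + 1)))] fun _ => 0 :=
    (quasiMeasurePreserving_edgePoint e).ae hu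
  -- Continuity makes `u` vanish on the whole edge; the integral of `w` is then constant and
  -- Lebesgue differentiation gives `w = 0`.
  have h2 := Measure.eqOn_Icc_of_ae_eq volume (Γ.t_lt_succ e.gen).ne h1
    (h.continuous e).continuousOn continuousOn_const
  have h3 := (h.intervalIntegrable e).ae_hasDerivAt_integral
  rw [Set.uIcc_of_le (Γ.t_lt_succ e.gen).le] at h3
  rw [← restrict_Ioo_eq_restrict_Icc, ae_restrict_iff' measurableSet_Ioo]
  filter_upwards [h3] with s hs hsI
  have hl : Γ.t e.gen ∈ Set.Icc (Γ.t e.gen) (Γ.t (e.gen + 1)) := ⟨le_rfl, (Γ.t_lt_succ _).le⟩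
  have h4 := hs ⟨hsI.1.le, hsI.2.le⟩ _ hl
  have h5 : (fun x => ∫ r in (Γ.t e.gen)..x, w (Γ.edgePoint e r)) =ᶠ[𝓝 s] fun _ => 0 := by
    filter_upwards [isOpen_Ioo.mem_nhds hsI] with x hx
    have h6 := h.eq_integral e x ⟨hx.1.le, hx.2.le⟩
    have h7 : u (Γ.edgePoint e x) = 0 := h2 ⟨hx.1.le, hx.2.le⟩
    have h8 : u (Γ.edgePoint e (Γ.t e.gen)) = 0 := h2 hl
    rw [h7, h8, zero_add] at h6
    exact h6.symm
  exact h4.unique ((hasDerivAt_const s (0 : ℂ)).congr_of_eventuallyEq h5)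

/-! ### Test functions supported in a single edge. -/

open Classical in
/-- The function that equals `ψ` on the edge `e` and vanishes elsewhere. -/
def edgeBump (e : Γ.Edge) (ψ : ℝ → ℂ) (x : Γ.Point) : ℂ := if x.edge = e then ψ x.pos else 0

open Classical in
theorem edgeBump_edgePoint {e : Γ.Edge} {ψ : ℝ → ℂ}
    (hψ : ∀ s, s ∉ Set.Ioo (Γ.t e.gen) (Γ.t (e.gen + 1)) → ψ s = 0) (e' : Γ.Edge) (s : ℝ) :
    edgeBump e ψ (Γ.edgePoint e' s) = if e' = e then ψ (Γ.clamp e'.gen s) else 0 := by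
  rw [← edgePoint_clamp]
  set c := Γ.clamp e'.gen s with hc
  have hcI : c ∈ Set.Icc (Γ.t e'.gen) (Γ.t (e'.gen + 1)) := ⟨Γ.le_clamp _ s, Γ.clamp_le _ s⟩
  have hpos : (Γ.edgePoint e' c).pos = c := Γ.abs_edgePoint e' hcI
  rw [edgeBump, hpos]
  rcases hcI.1.lt_or_eq with h | h
  · rw [edge_edgePoint e' ⟨h, hcI.2⟩]
  -- At its lower end the edge `e'` may be represented by the preceding edge, but no vertex lies in
  -- the open interval where `ψ` can be nonzero.
  · have h0 : ψ c = 0 := by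
      apply hψ
      rw [← h]
      rintro ⟨h1, h2⟩
      have := Γ.t_strictMono.lt_iff_lt.1 h1
      have := Γ.t_strictMono.lt_iff_lt.1 h2
      omega
    rw [h0, ite_self, ite_self]

theorem measurable_edgeBump (e : Γ.Edge) {ψ : ℝ → ℂ} (hψ : Measurable ψ) :
    Measurable (edgeBump e ψ) := by
  classical
  have h : Measurable fun p : Γ.Edge × ℝ => if p.1 = e then ψ p.2 else 0 :=
    Measurable.ite (measurable_fst (MeasurableSet.singleton e)) (hψ.comp measurable_snd)
      measurable_const
  exact h.comp (comap_measurable (fun x : Γ.Point => (x.edge, x.pos)))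

theorem continuous_clamp (n : ℕ) : Continuous (Γ.clamp n) :=
  continuous_const.max (continuous_id.min continuous_const)

theorem memLp_edgeBump {e : Γ.Edge} {ψ : ℝ → ℂ} (hc : Continuous ψ)
    (hψ : ∀ s, s ∉ Set.Ioo (Γ.t e.gen) (Γ.t (e.gen + 1)) → ψ s = 0) :
    MemLp (edgeBump e ψ) 2 volume := by
  have hm := measurable_edgeBump e hc.measurable
  refine ⟨hm.aestronglyMeasurable, ?_⟩
  rw [eLpNorm_lt_top_iff_lintegral_rpow_enorm_lt_top two_ne_zero ENNReal.ofNat_ne_top]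
  simp only [ENNReal.toReal_ofNat, ENNReal.rpow_ofNat]
  rw [lintegral_eq_tsum (hm.enorm.pow_const 2).aemeasurable, tsum_eq_single e]
  · have h1 : Continuous fun s => ‖ψ (Γ.clamp e.gen s)‖ ^ 2 :=
      ((hc.comp (continuous_clamp _)).norm).pow 2
    have h2 := (h1.integrableOn_Icc (μ := volume) (a := Γ.t e.gen) (b := Γ.t (e.gen + 1))).2
    refine lt_of_eq_of_lt ?_ h2
    refine lintegral_congr fun s => ?_
    rw [edgeBump_edgePoint hψ, if_pos rfl, enorm_pow, enorm_norm]
  · intro e' he'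
    simp [edgeBump_edgePoint hψ, he']

theorem isSobolev_edgeBump {e : Γ.Edge} {ψ ψ' : ℝ → ℂ} (hd : ∀ s, HasDerivAt ψ (ψ' s) s)
    (hc : Continuous ψ')
    (hψ : ∀ s, s ∉ Set.Ioo (Γ.t e.gen) (Γ.t (e.gen + 1)) → ψ s = 0)
    (hψ' : ∀ s, s ∉ Set.Ioo (Γ.t e.gen) (Γ.t (e.gen + 1)) → ψ' s = 0) :
    Γ.IsSobolev (edgeBump e ψ) (edgeBump e ψ') := by
  have hcψ : Continuous ψ := continuous_iff_continuousAt.2 fun s => (hd s).continuousAt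
  refine ⟨fun e' => ?_, fun e' => ?_, fun e' s hs => ?_, memLp_edgeBump hcψ hψ,
    memLp_edgeBump hc hψ', ?_⟩
  · simp only [edgeBump_edgePoint hψ]
    split_ifs
    · exact hcψ.comp (continuous_clamp _)
    · exact continuous_const
  · simp only [edgeBump_edgePoint hψ']
    split_ifs
    · exact (hc.comp (continuous_clamp _)).intervalIntegrable _ _
    · simp
  · simp only [edgeBump_edgePoint hψ, edgeBump_edgePoint hψ']
    split_ifs with h
    · rw [clamp_eq_self hs, clamp_eq_self ⟨le_rfl, (Γ.t_lt_succ _).le⟩]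
      have h1 : ∫ r in (Γ.t e'.gen)..s, ψ' (Γ.clamp e'.gen r) = ∫ r in (Γ.t e'.gen)..s, ψ' r := by
        refine intervalIntegral.integral_congr fun r hr => ?_
        rw [Set.uIcc_of_le hs.1] at hr
        simp only [clamp_eq_self ⟨hr.1, hr.2.trans hs.2⟩]
      rw [h1, intervalIntegral.integral_eq_sub_of_hasDerivAt (fun x _ => hd x)
        (hc.intervalIntegrable _ _)]
      ring
    · simp
  · unfold edgeBump
    split_ifs with h
    · apply hψ
      rintro ⟨h1, _⟩
      exact absurd h1 (not_lt.2 (Γ.t_nonneg _))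
    · rfl

theorem integral_mul_edgeBump {e : Γ.Edge} {ψ : ℝ → ℂ} (hc : Continuous ψ)
    (hψ : ∀ s, s ∉ Set.Ioo (Γ.t e.gen) (Γ.t (e.gen + 1)) → ψ s = 0) {f : Γ.Point → ℂ}
    (hf : MemLp f 2 volume) :
    ∫ x, edgeBump e ψ x * f x = ∫ s, ψ s * f (Γ.edgePoint e s) := by
  have hi : Integrable (fun x => edgeBump e ψ x * f x) volume :=
    (memLp_edgeBump hc hψ).integrable_mul hf
  rw [volume_eq] at hi ⊢
  rw [integral_sum_measure hi, tsum_eq_single e]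
  · rw [integral_map (Γ.measurable_edgePoint e).aemeasurable
      (hi.1.mono_measure (Measure.le_sum _ e))]
    rw [← setIntegral_eq_integral_of_forall_compl_eq_zero
      (s := Set.Icc (Γ.t e.gen) (Γ.t (e.gen + 1))) (f := fun s => ψ s * f (Γ.edgePoint e s))]
    · refine setIntegral_congr_fun measurableSet_Icc fun s hs => ?_
      simp only [edgeBump_edgePoint hψ, if_true, clamp_eq_self hs]
    · intro s hs
      rw [hψ s fun h => hs ⟨h.1.le, h.2.le⟩, zero_mul]
  · intro e' he'
    rw [integral_map (Γ.measurable_edgePoint e').aemeasurable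
      (hi.1.mono_measure (Measure.le_sum _ e'))]
    simp [edgeBump_edgePoint hψ, he']

/-- A square integrable function orthogonal to all Sobolev functions vanishes. -/
theorem ae_eq_zero_of_forall_isSobolev {f : Γ.Point → ℂ} (hf : MemLp f 2 volume)
    (h : ∀ φ ψ : Γ.Point → ℂ, Γ.IsSobolev φ ψ → ∫ x, φ x * f x = 0) : f =ᵐ[volume] 0 := by
  refine ae_eq_zero_of_edge hf.1 fun e => ?_
  rw [← restrict_Ioo_eq_restrict_Icc, ae_restrict_iff' measurableSet_Ioo]
  have hfe : IntegrableOn (fun s => f (Γ.edgePoint e s))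
      (Set.Icc (Γ.t e.gen) (Γ.t (e.gen + 1))) := by
    have h1 : MemLp (fun s => f (Γ.edgePoint e s)) 2
        (volume.restrict (Set.Icc (Γ.t e.gen) (Γ.t (e.gen + 1)))) :=
      (hf.mono_measure (map_edgePoint_le e)).comp_of_map (Γ.measurable_edgePoint e).aemeasurable
    exact h1.integrable one_le_two
  refine isOpen_Ioo.ae_eq_zero_of_integral_contDiff_smul_eq_zero
    (hfe.mono_set Set.Ioo_subset_Icc_self).locallyIntegrableOn fun g hg _ hsupp => ?_
  have h0 : ∀ s, s ∉ Set.Ioo (Γ.t e.gen) (Γ.t (e.gen + 1)) → ((g s : ℝ) : ℂ) = 0 := fun s hs => by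
    rw [image_eq_zero_of_notMem_tsupport fun h => hs (hsupp h), Complex.ofReal_zero]
  have h0' : ∀ s, s ∉ Set.Ioo (Γ.t e.gen) (Γ.t (e.gen + 1)) → ((deriv g s : ℝ) : ℂ) = 0 :=
    fun s hs => by
      have : deriv g s = 0 := by
        by_contra hne
        exact hs (hsupp (support_deriv_subset (Function.mem_support.2 hne)))
      rw [this, Complex.ofReal_zero]
  have hg1 : ContDiff ℝ 1 g := hg.of_le (by exact_mod_cast le_top)
  have hS := isSobolev_edgeBump (e := e) (ψ := fun s => ((g s : ℝ) : ℂ))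
    (ψ' := fun s => ((deriv g s : ℝ) : ℂ))
    (fun s => ((hg1.differentiable one_ne_zero) s).hasDerivAt.ofReal_comp)
    (Complex.continuous_ofReal.comp (hg1.continuous_deriv le_rfl)) h0 h0'
  have := h _ _ hS
  rw [integral_mul_edgeBump (ψ := fun s => ((g s : ℝ) : ℂ))
    (Complex.continuous_ofReal.comp hg.continuous) h0 hf] at this
  simpa using this

/-! ### Primitives along rays and completeness of the Sobolev space. -/

variable (Γ) in
/-- The Sobolev space `H^{1,0}` of the tree, as a subspace of the pairs of square integrable
functions: the function and its derivative. -/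
def sobolevSpace : Submodule ℂ (WithLp 2 (Γ.L2 × Γ.L2)) where
  carrier := {z | ∃ u w : Γ.Point → ℂ, Γ.IsSobolev u w ∧ z.fst =ᵐ[volume] u ∧ z.snd =ᵐ[volume] w}
  zero_mem' := ⟨0, 0, IsSobolev.zero, Lp.coeFn_zero _ _ _, Lp.coeFn_zero _ _ _⟩
  add_mem' := by
    rintro z z' ⟨u, w, h, hu, hw⟩ ⟨u', w', h', hu', hw'⟩
    exact ⟨u + u', w + w', h.add h', (Lp.coeFn_add _ _).trans (hu.add hu'),
      (Lp.coeFn_add _ _).trans (hw.add hw')⟩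
  smul_mem' := by
    rintro c z ⟨u, w, h, hu, hw⟩
    exact ⟨c • u, c • w, h.smul c, (Lp.coeFn_smul _ _).trans (hu.const_smul c),
      (Lp.coeFn_smul _ _).trans (hw.const_smul c)⟩

/-- The integral of `w` along the way from the root to `x`. -/
def primitive (w : Γ.Point → ℂ) (x : Γ.Point) : ℂ :=
  ∫ r in (0 : ℝ)..x.abs, w (ray (rayThrough x.edge) r)

/-- By `ray_congr` the primitive does not depend on the ray chosen through the edge of the point. -/
theorem primitive_ray (w : Γ.Point → ℂ) (ω : ∀ k, Fin (Γ.b k)) {s : ℝ} (hs : 0 ≤ s) :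
    primitive w (ray ω s) = ∫ r in (0 : ℝ)..s, w (ray ω r) := by
  have h1 : ray (rayThrough (ray ω s).edge) s = ray ω s := by
    conv_rhs => rw [← ray_abs (ray ω s), abs_ray ω hs]
  rw [primitive, abs_ray ω hs]
  refine intervalIntegral.integral_congr fun r hr => ?_
  rw [Set.uIcc_of_le hs] at hr
  simp only [ray_congr h1 hr.2]

theorem IsSobolev.eq_primitive {u w : Γ.Point → ℂ} (h : Γ.IsSobolev u w) (x : Γ.Point) :
    u x = primitive w x := by
  conv_lhs => rw [← ray_abs x]
  exact h.ray_eq _ (abs_nonneg x)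

theorem primitive_sub {w w' : Γ.Point → ℂ} (hw : MemLp w 2 volume) (hw' : MemLp w' 2 volume)
    (x : Γ.Point) : primitive w x - primitive w' x = primitive (w - w') x :=
  (intervalIntegral.integral_sub (intervalIntegrable_ray hw _ le_rfl (abs_nonneg x))
    (intervalIntegrable_ray hw' _ le_rfl (abs_nonneg x))).symm

theorem enorm_primitive_sq_le {w : Γ.Point → ℂ} (hw : MemLp w 2 volume) (x : Γ.Point) :
    ‖primitive w x‖ₑ ^ 2 ≤ ENNReal.ofReal x.abs * ∫⁻ y, ‖w y‖ₑ ^ 2 :=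
  enorm_integral_ray_sq_le hw _ (abs_nonneg x)

theorem primitive_congr {w w' : Γ.Point → ℂ} (hw : MemLp w 2 volume) (hw' : MemLp w' 2 volume)
    (h : w =ᵐ[volume] w') (x : Γ.Point) : primitive w x = primitive w' x := by
  have h1 := enorm_primitive_sq_le (hw.sub hw') x
  have h2 : ∫⁻ y, ‖(w - w') y‖ₑ ^ 2 = 0 := by
    rw [lintegral_congr_ae (g := fun _ => 0) ?_, lintegral_zero]
    filter_upwards [h] with y hy
    simp [hy]
  rw [h2, mul_zero, nonpos_iff_eq_zero] at h1
  rw [← sub_eq_zero, primitive_sub hw hw']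
  simpa using h1

/-- The primitive at `x` is bounded on `L₂` with norm at most `|x|^(1/2)`, so `L₂` convergence of
derivatives forces convergence at every point. -/
theorem tendsto_primitive {w : ℕ → Γ.L2} {w' : Γ.L2} (h : Tendsto w atTop (𝓝 w')) (x : Γ.Point) :
    Tendsto (fun n => primitive (w n) x) atTop (𝓝 (primitive w' x)) := by
  rw [tendsto_iff_norm_sub_tendsto_zero] at h ⊢
  have h1 : ∀ n, ‖primitive (w n) x - primitive w' x‖ ≤ √x.abs * ‖w n - w'‖ := by
    intro n
    have h2 := enorm_primitive_sq_le ((Lp.memLp (w n)).sub (Lp.memLp w')) x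
    have h3 : ∫⁻ y, ‖((w n : Γ.Point → ℂ) - w') y‖ₑ ^ 2 = ENNReal.ofReal (‖w n - w'‖ ^ 2) := by
      rw [← lintegral_enorm_sq_Lp]
      refine lintegral_congr_ae ?_
      filter_upwards [Lp.coeFn_sub (w n) w'] with y hy
      rw [hy]
    rw [h3, ← primitive_sub (Lp.memLp _) (Lp.memLp _), ← ofReal_norm,
      ← ENNReal.ofReal_pow (norm_nonneg _), ← ENNReal.ofReal_mul (abs_nonneg x),
      ENNReal.ofReal_le_ofReal_iff (mul_nonneg (abs_nonneg x) (by positivity))] at h2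
    rw [← Real.sqrt_sq (norm_nonneg (w n - w')), ← Real.sqrt_mul (abs_nonneg x)]
    exact Real.le_sqrt_of_sq_le h2
  refine squeeze_zero (fun _ => norm_nonneg _) h1 ?_
  simpa using h.const_mul (√x.abs)

variable (Γ) in
theorem isClosed_sobolevSpace : IsClosed (Γ.sobolevSpace : Set (WithLp 2 (Γ.L2 × Γ.L2))) := by
  refine IsSeqClosed.isClosed fun z z' hz hlim => ?_
  choose u w h hu hw using hz
  have hfst : Tendsto (fun n => (z n).fst) atTop (𝓝 z'.fst) :=
    ((WithLp.fstL 2 ℂ Γ.L2 Γ.L2).continuous.tendsto z').comp hlim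
  have hsnd : Tendsto (fun n => (z n).snd) atTop (𝓝 z'.snd) :=
    ((WithLp.sndL 2 ℂ Γ.L2 Γ.L2).continuous.tendsto z').comp hlim
  -- An almost everywhere convergent subsequence identifies the `L₂` limit of the functions with the
  -- primitive of the limit of their derivatives.
  obtain ⟨ns, hns, hae⟩ := (tendstoInMeasure_of_tendsto_Lp hfst).exists_seq_tendsto_ae
  have hpt : ∀ x, Tendsto (fun n => u n x) atTop (𝓝 (primitive z'.snd x)) := by
    intro x
    refine (tendsto_primitive hsnd x).congr fun n => ?_
    rw [(h n).eq_primitive]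
    exact primitive_congr (Lp.memLp _) (h n).memLp_deriv (hw n) x
  have heq : z'.fst =ᵐ[volume] primitive z'.snd := by
    filter_upwards [hae, ae_all_iff.2 hu] with x hx hux
    refine tendsto_nhds_unique hx (((hpt x).comp hns.tendsto_atTop).congr fun n => ?_)
    exact (hux _).symm
  refine ⟨primitive z'.snd, z'.snd, ?_, heq, EventuallyEq.rfl⟩
  exact isSobolev_of_ray ((Lp.memLp _).ae_eq heq) (Lp.memLp _) fun ω s hs => primitive_ray _ ω hs

instance : CompleteSpace Γ.sobolevSpace := (isClosed_sobolevSpace Γ).completeSpace_coe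

variable (Γ) in
/-- The embedding of the Sobolev space in `L₂`. -/
def sobolevEmb : Γ.sobolevSpace →L[ℂ] Γ.L2 :=
  (WithLp.fstL 2 ℂ Γ.L2 Γ.L2).comp Γ.sobolevSpace.subtypeL

variable (Γ) in
/-- The derivative of a Sobolev function. -/
def sobolevDeriv : Γ.sobolevSpace →L[ℂ] Γ.L2 :=
  (WithLp.sndL 2 ℂ Γ.L2 Γ.L2).comp Γ.sobolevSpace.subtypeL

theorem exists_isSobolev (z : Γ.sobolevSpace) : ∃ u w : Γ.Point → ℂ, Γ.IsSobolev u w ∧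
    Γ.sobolevEmb z =ᵐ[volume] u ∧ Γ.sobolevDeriv z =ᵐ[volume] w := z.2

theorem exists_sobolevSpace {u w : Γ.Point → ℂ} (h : Γ.IsSobolev u w) :
    ∃ z : Γ.sobolevSpace, Γ.sobolevEmb z =ᵐ[volume] u ∧ Γ.sobolevDeriv z =ᵐ[volume] w :=
  ⟨⟨WithLp.toLp 2 (h.memLp.toLp u, h.memLp_deriv.toLp w), u, w, h, h.memLp.coeFn_toLp,
    h.memLp_deriv.coeFn_toLp⟩, h.memLp.coeFn_toLp, h.memLp_deriv.coeFn_toLp⟩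

theorem sobolevSpace_norm_sq (z : Γ.sobolevSpace) :
    ‖z‖ ^ 2 = ‖Γ.sobolevEmb z‖ ^ 2 + ‖Γ.sobolevDeriv z‖ ^ 2 :=
  WithLp.prod_norm_sq_eq_of_L2 (z : WithLp 2 (Γ.L2 × Γ.L2))

theorem sobolevEmb_injective : Function.Injective Γ.sobolevEmb := by
  rw [injective_iff_map_eq_zero]
  intro z hz
  obtain ⟨u, w, h, hu, hw⟩ := exists_isSobolev z
  have h1 : u =ᵐ[volume] 0 := by
    rw [hz] at hu
    exact hu.symm.trans (Lp.coeFn_zero _ _ _)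
  have h2 : Γ.sobolevDeriv z = 0 :=
    Lp.eq_zero_iff_ae_eq_zero.2 (hw.trans (h.deriv_ae_eq_zero h1))
  have h3 := sobolevSpace_norm_sq z
  rw [hz, h2] at h3
  simpa using h3

/-- The condition at the root excludes constants. This allows dimensions to be counted on the image
in `L₂`, with the Dirichlet norm. -/
theorem sobolevDeriv_injective : Function.Injective Γ.sobolevDeriv := by
  rw [injective_iff_map_eq_zero]
  intro z hz
  obtain ⟨u, w, h, hu, hw⟩ := exists_isSobolev z
  have h1 : u = 0 := by
    funext x
    rw [h.eq_primitive, primitive_congr h.memLp_deriv (Lp.memLp (Γ.sobolevDeriv z)) hw.symm, hz,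
      primitive_congr (Lp.memLp _) MemLp.zero (Lp.coeFn_zero _ _ _)]
    simp [primitive]
  have h2 : Γ.sobolevEmb z = 0 := Lp.eq_zero_iff_ae_eq_zero.2 (by rw [h1] at hu; exact hu)
  have h3 := sobolevSpace_norm_sq z
  rw [hz, h2] at h3
  simpa using h3

theorem denseRange_sobolevEmb : DenseRange Γ.sobolevEmb := by
  have h : Dense ((LinearMap.range (Γ.sobolevEmb : Γ.sobolevSpace →ₗ[ℂ] Γ.L2) :
      Submodule ℂ Γ.L2) : Set Γ.L2) := by
    rw [Submodule.dense_iff_topologicalClosure_eq_top, Submodule.topologicalClosure_eq_top_iff,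
      Submodule.eq_bot_iff]
    intro f hf
    have hf' : MemLp (fun x => conj (f x)) 2 volume := (Lp.memLp f).star
    have h0 : (fun x => conj (f x)) =ᵐ[volume] 0 := by
      refine ae_eq_zero_of_forall_isSobolev hf' fun φ ψ hφ => ?_
      obtain ⟨z, hz, -⟩ := exists_sobolevSpace hφ
      have h1 := (Submodule.mem_orthogonal' _ _).1 hf _ ⟨z, rfl⟩
      rw [L2.inner_def] at h1
      rw [← h1]
      refine integral_congr_ae ?_
      filter_upwards [hz] with x hx
      rw [RCLike.inner_apply, ← hx]
      rfl
    refine Lp.eq_zero_iff_ae_eq_zero.2 ?_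
    filter_upwards [h0] with x hx
    simpa using hx
  exact h

end RegularTree

/-! ### Potentials on the Sobolev space -/

namespace RegularTree

variable {Γ : RegularTree}

variable (Γ) in
/-- The integral along the way from the root to `x`, as a functional on `L₂`. -/
def primitiveL (x : Γ.Point) : Γ.L2 →L[ℂ] ℂ :=
  LinearMap.mkContinuous
    { toFun := fun w => primitive w x
      map_add' := fun w w' => by
        rw [primitive_congr (Lp.memLp _) ((Lp.memLp w).add (Lp.memLp w')) (Lp.coeFn_add w w')]
        exact intervalIntegral.integral_add
          (intervalIntegrable_ray (Lp.memLp w) _ le_rfl (abs_nonneg x))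
          (intervalIntegrable_ray (Lp.memLp w') _ le_rfl (abs_nonneg x))
      map_smul' := fun c w => by
        rw [primitive_congr (Lp.memLp _) ((Lp.memLp w).const_smul c) (Lp.coeFn_smul c w)]
        exact intervalIntegral.integral_smul c _ } (√x.abs) fun w => by
    have h2 := enorm_primitive_sq_le (Lp.memLp w) x
    rw [lintegral_enorm_sq_Lp, ← ofReal_norm, ← ENNReal.ofReal_pow (norm_nonneg _),
      ← ENNReal.ofReal_mul (abs_nonneg x),
      ENNReal.ofReal_le_ofReal_iff (mul_nonneg (abs_nonneg x) (by positivity))] at h2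
    rw [← Real.sqrt_sq (norm_nonneg w), ← Real.sqrt_mul (abs_nonneg x)]
    exact Real.le_sqrt_of_sq_le h2

theorem primitiveL_apply (x : Γ.Point) (w : Γ.L2) : primitiveL Γ x w = primitive w x := rfl

theorem norm_primitiveL_le (x : Γ.Point) : ‖primitiveL Γ x‖ ≤ √x.abs :=
  LinearMap.mkContinuous_norm_le _ (Real.sqrt_nonneg _) _

/-- Evaluation of the primitive at `x` is the inner product with a vector of norm at most
`|x|^(1/2)`; the claim is Bessel's inequality for that vector. -/
theorem sum_norm_primitive_sq_le {ι : Type*} [Fintype ι] {v : ι → Γ.L2} (hv : Orthonormal ℂ v)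
    (x : Γ.Point) : ∑ i, ‖primitive (v i) x‖ ^ 2 ≤ x.abs := by
  set k := (InnerProductSpace.toDual ℂ Γ.L2).symm (primitiveL Γ x) with hk
  have h1 : ∀ i, ‖primitive (v i) x‖ = ‖inner ℂ (v i) k‖ := by
    intro i
    rw [norm_inner_symm, hk, InnerProductSpace.toDual_symm_apply, primitiveL_apply]
  simp only [h1]
  refine (hv.sum_inner_products_le k).trans ?_
  rw [hk, LinearIsometryEquiv.norm_map]
  calc ‖primitiveL Γ x‖ ^ 2 ≤ √x.abs ^ 2 :=
        pow_le_pow_left₀ (norm_nonneg _) (norm_primitiveL_le x) 2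
    _ = x.abs := Real.sq_sqrt (abs_nonneg x)

theorem sobolevEmb_ae_eq (z : Γ.sobolevSpace) :
    Γ.sobolevEmb z =ᵐ[volume] primitive (Γ.sobolevDeriv z) := by
  obtain ⟨u, w, h, hu, hw⟩ := exists_isSobolev z
  filter_upwards [hu] with x hx
  rw [hx, h.eq_primitive, primitive_congr h.memLp_deriv (Lp.memLp _) hw.symm]

/-- `S` is the multiplication by the square root of the potential `W` on the Sobolev space. -/
def IsSqrtMul (W : Γ.Point → ℝ) (S : Γ.sobolevSpace →L[ℂ] Γ.L2) : Prop :=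
  ∀ z, S z =ᵐ[volume] fun x => ((√(W x) : ℝ) : ℂ) * Γ.sobolevEmb z x

theorem enorm_sqrt_mul_sq (W : ℝ) (c : ℂ) :
    ‖((√W : ℝ) : ℂ) * c‖ₑ ^ 2 = ENNReal.ofReal W * ‖c‖ₑ ^ 2 := by
  rw [enorm_mul, mul_pow, ← ofReal_norm, Complex.norm_real, Real.norm_of_nonneg
    (Real.sqrt_nonneg _), ← ENNReal.ofReal_pow (Real.sqrt_nonneg _)]
  rcases le_total 0 W with h | h
  · rw [Real.sq_sqrt h]
  · rw [Real.sqrt_eq_zero_of_nonpos h, ENNReal.ofReal_of_nonpos h]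
    simp

/-- Domination by the Dirichlet integral makes the potential term equal to `‖S z‖²` with `S` bounded
on the Sobolev space. -/
theorem exists_isSqrtMul {W : Γ.Point → ℝ} (hW : AEMeasurable W volume) {c : ℝ} (hc : 0 ≤ c)
    (hb : ∀ u w : Γ.Point → ℂ, Γ.IsSobolev u w →
      ∫⁻ x, ENNReal.ofReal (W x) * ‖u x‖ₑ ^ 2 ≤ ENNReal.ofReal c * ∫⁻ x, ‖w x‖ₑ ^ 2) :
    ∃ S, IsSqrtMul W S := by
  have hbd : ∀ z : Γ.sobolevSpace,
      ∫⁻ x, ‖((√(W x) : ℝ) : ℂ) * Γ.sobolevEmb z x‖ₑ ^ 2 ≤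
        ENNReal.ofReal (c * ‖Γ.sobolevDeriv z‖ ^ 2) := by
    intro z
    obtain ⟨u, w, h, hu, hw⟩ := exists_isSobolev z
    rw [ENNReal.ofReal_mul hc, ← lintegral_enorm_sq_Lp]
    have h1 : ∫⁻ x, ‖Γ.sobolevDeriv z x‖ₑ ^ 2 = ∫⁻ x, ‖w x‖ₑ ^ 2 := by
      refine lintegral_congr_ae ?_
      filter_upwards [hw] with x hx
      rw [hx]
    rw [h1]
    refine le_trans (le_of_eq (lintegral_congr_ae ?_)) (hb u w h)
    filter_upwards [hu] with x hx
    rw [hx, enorm_sqrt_mul_sq]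
  have hmem : ∀ z : Γ.sobolevSpace,
      MemLp (fun x => ((√(W x) : ℝ) : ℂ) * Γ.sobolevEmb z x) 2 volume := by
    intro z
    have hm : AEMeasurable (fun x => ((√(W x) : ℝ) : ℂ)) volume :=
      Complex.measurable_ofReal.comp_aemeasurable hW.sqrt
    refine ⟨hm.aestronglyMeasurable.mul (Lp.aestronglyMeasurable _), ?_⟩
    rw [eLpNorm_lt_top_iff_lintegral_rpow_enorm_lt_top two_ne_zero ENNReal.ofNat_ne_top]
    simp only [ENNReal.toReal_ofNat, ENNReal.rpow_ofNat]
    exact (hbd z).trans_lt ENNReal.ofReal_lt_top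
  refine ⟨LinearMap.mkContinuous
    { toFun := fun z => (hmem z).toLp _
      map_add' := fun z z' => ?_
      map_smul' := fun a z => ?_ } (√c) fun z => ?_, fun z => (hmem z).coeFn_toLp⟩
  · rw [← MemLp.toLp_add]
    refine MemLp.toLp_congr _ _ ?_
    rw [map_add]
    filter_upwards [Lp.coeFn_add (Γ.sobolevEmb z) (Γ.sobolevEmb z')] with x hx
    rw [hx, Pi.add_apply, Pi.add_apply, mul_add]
  · rw [RingHom.id_apply, ← MemLp.toLp_const_smul]
    refine MemLp.toLp_congr _ _ ?_
    rw [map_smul]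
    filter_upwards [Lp.coeFn_smul a (Γ.sobolevEmb z)] with x hx
    rw [hx, Pi.smul_apply, Pi.smul_apply, smul_eq_mul, smul_eq_mul, mul_left_comm]
  · change ‖(hmem z).toLp _‖ ≤ _
    have h1 : ‖(hmem z).toLp _‖ ^ 2 ≤ c * ‖Γ.sobolevDeriv z‖ ^ 2 := by
      rw [← ENNReal.ofReal_le_ofReal_iff (by positivity), ← lintegral_enorm_sq_Lp]
      refine le_trans (le_of_eq (lintegral_congr_ae ?_)) (hbd z)
      filter_upwards [(hmem z).coeFn_toLp] with x hx
      rw [hx]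
    rw [← Real.sqrt_sq (norm_nonneg z), ← Real.sqrt_mul hc]
    refine Real.le_sqrt_of_sq_le (h1.trans ?_)
    rw [sobolevSpace_norm_sq]
    nlinarith [sq_nonneg ‖Γ.sobolevEmb z‖]

namespace IsSqrtMul

variable {W : Γ.Point → ℝ} {S : Γ.sobolevSpace →L[ℂ] Γ.L2}

theorem ofReal_norm_sq (h : IsSqrtMul W S) (z : Γ.sobolevSpace) :
    ENNReal.ofReal (‖S z‖ ^ 2) = ∫⁻ x, ENNReal.ofReal (W x) * ‖Γ.sobolevEmb z x‖ₑ ^ 2 := by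
  rw [← lintegral_enorm_sq_Lp]
  refine lintegral_congr_ae ?_
  filter_upwards [h z] with x hx
  rw [hx, enorm_sqrt_mul_sq]

theorem mul_ae_eq (h : IsSqrtMul W S) (hW0 : ∀ x, 0 ≤ W x) (y z : Γ.sobolevSpace)
    {u φ : Γ.Point → ℂ} (hu : Γ.sobolevEmb z =ᵐ[volume] u) (hφ : Γ.sobolevEmb y =ᵐ[volume] φ) :
    (fun x => (W x : ℂ) * u x * conj (φ x)) =ᵐ[volume] fun x => S z x * conj (S y x) := by
  filter_upwards [h z, h y, hu, hφ] with x h1 h2 h3 h4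
  rw [h1, h2, h3, h4, map_mul, Complex.conj_ofReal]
  have : (W x : ℂ) = ((√(W x) : ℝ) : ℂ) * ((√(W x) : ℝ) : ℂ) := by
    rw [← Complex.ofReal_mul, Real.mul_self_sqrt (hW0 x)]
  rw [this]; ring

theorem integrable_mul_conj (f g : Γ.L2) : Integrable (fun x => f x * conj (g x)) volume :=
  (Lp.memLp f).integrable_mul (Lp.memLp g).star

theorem integral_mul_conj (f g : Γ.L2) : ∫ x, f x * conj (g x) = inner ℂ g f := by
  rw [L2.inner_def]
  rfl

theorem integrable_and_integral (h : IsSqrtMul W S) (hW0 : ∀ x, 0 ≤ W x) (y z : Γ.sobolevSpace)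
    {u w φ ψ : Γ.Point → ℂ} (hu : Γ.sobolevEmb z =ᵐ[volume] u)
    (hw : Γ.sobolevDeriv z =ᵐ[volume] w) (hφ : Γ.sobolevEmb y =ᵐ[volume] φ)
    (hψ : Γ.sobolevDeriv y =ᵐ[volume] ψ) :
    Integrable (fun x => (W x : ℂ) * u x * conj (φ x)) volume ∧
      ∫ x, (w x * conj (ψ x) - (W x : ℂ) * u x * conj (φ x)) =
        inner ℂ (Γ.sobolevDeriv y) (Γ.sobolevDeriv z) - inner ℂ (S y) (S z) := by
  have h1 := h.mul_ae_eq hW0 y z hu hφ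
  have h2 : (fun x => w x * conj (ψ x)) =ᵐ[volume]
      fun x => Γ.sobolevDeriv z x * conj (Γ.sobolevDeriv y x) := by
    filter_upwards [hw, hψ] with x hx hx'
    rw [hx, hx']
  have i1 := (integrable_mul_conj (S z) (S y)).congr h1.symm
  have i2 := (integrable_mul_conj (Γ.sobolevDeriv z) (Γ.sobolevDeriv y)).congr h2.symm
  refine ⟨i1, ?_⟩
  rw [integral_sub i2 i1, integral_congr_ae h1, integral_congr_ae h2, integral_mul_conj,
    integral_mul_conj]

end IsSqrtMul

open ContinuousLinearMap in
/-- The bounded operator on the Sobolev space representing the quadratic form. -/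
def formOperator (S : Γ.sobolevSpace →L[ℂ] Γ.L2) : Γ.sobolevSpace →L[ℂ] Γ.sobolevSpace :=
  adjoint Γ.sobolevDeriv ∘L Γ.sobolevDeriv - adjoint S ∘L S

open ContinuousLinearMap in
theorem inner_formOperator (S : Γ.sobolevSpace →L[ℂ] Γ.L2) (y z : Γ.sobolevSpace) :
    inner ℂ y (formOperator S z) =
      inner ℂ (Γ.sobolevDeriv y) (Γ.sobolevDeriv z) - inner ℂ (S y) (S z) := by
  rw [formOperator, sub_apply, inner_sub_right, comp_apply, comp_apply, adjoint_inner_right,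
    adjoint_inner_right]

theorem inner_formOperator_left (S : Γ.sobolevSpace →L[ℂ] Γ.L2) (y z : Γ.sobolevSpace) :
    inner ℂ (formOperator S z) y =
      inner ℂ (Γ.sobolevDeriv z) (Γ.sobolevDeriv y) - inner ℂ (S z) (S y) := by
  rw [← inner_conj_symm (formOperator S z) y, inner_formOperator, map_sub, inner_conj_symm,
    inner_conj_symm]

theorem isSelfAdjoint_formOperator (S : Γ.sobolevSpace →L[ℂ] Γ.L2) :
    IsSelfAdjoint (formOperator S) := by
  refine ContinuousLinearMap.isSelfAdjoint_iff_isSymmetric.2 fun z y => ?_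
  exact (inner_formOperator_left S y z).trans (inner_formOperator S z y).symm

theorem re_inner_formOperator (S : Γ.sobolevSpace →L[ℂ] Γ.L2) (z : Γ.sobolevSpace) :
    (inner ℂ (formOperator S z) z).re = ‖Γ.sobolevDeriv z‖ ^ 2 - ‖S z‖ ^ 2 := by
  rw [inner_formOperator_left, inner_self_eq_norm_sq_to_K, inner_self_eq_norm_sq_to_K]
  norm_cast

theorem IsSqrtMul.isFormGraph {W : Γ.Point → ℝ} {S : Γ.sobolevSpace →L[ℂ] Γ.L2}
    (h : IsSqrtMul W S) (hW0 : ∀ x, 0 ≤ W x) :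
    IsFormGraph Γ.sobolevEmb (formOperator S) (Γ.schrodingerGraph W) := by
  have hg : ∀ (g : Γ.L2) (y : Γ.sobolevSpace) (φ : Γ.Point → ℂ),
      Γ.sobolevEmb y =ᵐ[volume] φ → ∫ x, g x * conj (φ x) = inner ℂ (Γ.sobolevEmb y) g := by
    intro g y φ hφ
    rw [← integral_mul_conj]
    refine integral_congr_ae ?_
    filter_upwards [hφ] with x hx
    rw [hx]
  intro f g
  constructor
  · rintro ⟨u, w, hS, hf, hall⟩
    obtain ⟨z, hzu, hzw⟩ := exists_sobolevSpace hS
    refine ⟨z, Lp.ext (hzu.trans hf.symm), fun y => ?_⟩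
    obtain ⟨φ, ψ, hS', hφ, hψ⟩ := exists_isSobolev y
    rw [inner_formOperator, ← (h.integrable_and_integral hW0 y z hzu hzw hφ hψ).2,
      (hall φ ψ hS').2, hg g y φ hφ]
  · rintro ⟨z, rfl, hz⟩
    obtain ⟨u, w, hS, hu, hw⟩ := exists_isSobolev z
    refine ⟨u, w, hS, hu, fun φ ψ hS' => ?_⟩
    obtain ⟨y, hφ, hψ⟩ := exists_sobolevSpace hS'
    have h1 := h.integrable_and_integral hW0 y z hu hw hφ hψ
    refine ⟨h1.1, ?_⟩
    rw [h1.2, ← inner_formOperator, hz, hg g y φ hφ]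

theorem IsSqrtMul.formBoundedBelow {W : Γ.Point → ℝ} {S : Γ.sobolevSpace →L[ℂ] Γ.L2}
    (h : IsSqrtMul W S) (hW0 : ∀ x, 0 ≤ W x) {M : ℝ}
    (hM : ∀ z, ‖S z‖ ^ 2 ≤ 1 / 2 * ‖Γ.sobolevDeriv z‖ ^ 2 + M * ‖Γ.sobolevEmb z‖ ^ 2) :
    Γ.FormBoundedBelow W := by
  refine ⟨-M, fun u w hS => ?_⟩
  obtain ⟨z, hu, hw⟩ := exists_sobolevSpace hS
  obtain ⟨h1, h2⟩ := h.integrable_and_integral hW0 z z hu hw hu hw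
  have e1 : (fun x => (W x : ℂ) * u x * conj (u x)) =
      fun x => ((W x * ‖u x‖ ^ 2 : ℝ) : ℂ) := by
    funext x
    rw [mul_assoc, Complex.mul_conj, Complex.normSq_eq_norm_sq, ← Complex.ofReal_mul]
  have e2 : (fun x => w x * conj (w x) - (W x : ℂ) * u x * conj (u x)) =
      fun x => ((‖w x‖ ^ 2 - W x * ‖u x‖ ^ 2 : ℝ) : ℂ) := by
    funext x
    rw [mul_assoc, Complex.mul_conj, Complex.mul_conj, Complex.normSq_eq_norm_sq,
      Complex.normSq_eq_norm_sq, ← Complex.ofReal_mul, ← Complex.ofReal_sub]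
  rw [e1] at h1
  have i1 : Integrable (fun x => W x * ‖u x‖ ^ 2) volume := by
    exact h1.re
  refine ⟨i1, ?_⟩
  have e3 : ∫ x, ‖u x‖ ^ 2 = ‖Γ.sobolevEmb z‖ ^ 2 := by
    have h3 := integral_mul_conj (Γ.sobolevEmb z) (Γ.sobolevEmb z)
    have h4 : ∫ x, Γ.sobolevEmb z x * conj (Γ.sobolevEmb z x) = ∫ x, ((‖u x‖ ^ 2 : ℝ) : ℂ) := by
      refine integral_congr_ae ?_
      filter_upwards [hu] with x hx
      rw [hx, Complex.mul_conj, Complex.normSq_eq_norm_sq]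
    rw [h4, integral_complex_ofReal, inner_self_eq_norm_sq_to_K] at h3
    exact Complex.ofReal_injective (h3.trans (Complex.ofReal_pow _ _).symm)
  have e4 : ∫ x, (‖w x‖ ^ 2 - W x * ‖u x‖ ^ 2) = ‖Γ.sobolevDeriv z‖ ^ 2 - ‖S z‖ ^ 2 := by
    rw [e2, integral_complex_ofReal, inner_self_eq_norm_sq_to_K, inner_self_eq_norm_sq_to_K] at h2
    refine Complex.ofReal_injective (h2.trans ?_)
    rw [Complex.ofReal_sub, Complex.ofReal_pow, Complex.ofReal_pow]
    rfl
  rw [e3, e4]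
  nlinarith [hM z, sq_nonneg ‖Γ.sobolevDeriv z‖]

/-- The trace bound: a potential `W` with `∫ W |x| dx` finite dominates the Dirichlet integral only
on subspaces of bounded dimension. -/
theorem IsSqrtMul.finrank_le {W : Γ.Point → ℝ} {S : Γ.sobolevSpace →L[ℂ] Γ.L2}
    (h : IsSqrtMul W S) (hW : AEMeasurable W volume) {κ B : ℝ} (hκ : 0 ≤ κ) (hB : 0 ≤ B)
    (hWB : ∫⁻ x, ENNReal.ofReal (W x) * ENNReal.ofReal x.abs ≤ ENNReal.ofReal B)
    (L : Submodule ℂ Γ.sobolevSpace) [FiniteDimensional ℂ L]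
    (hL : ∀ z ∈ L, ‖Γ.sobolevDeriv z‖ ^ 2 ≤ κ * ‖S z‖ ^ 2) :
    (Module.finrank ℂ L : ℝ) ≤ κ * B := by
  -- The basis is orthonormal in the Dirichlet norm; each of its vectors contributes at least `1` to
  -- `κ ∑ ‖S (z i)‖²`.
  let K : Submodule ℂ Γ.L2 := L.map (Γ.sobolevDeriv : Γ.sobolevSpace →ₗ[ℂ] Γ.L2)
  have hK : Module.finrank ℂ K = Module.finrank ℂ L :=
    (Submodule.equivMapOfInjective _ sobolevDeriv_injective L).symm.finrank_eq
  let b := stdOrthonormalBasis ℂ K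
  have hb : Orthonormal ℂ fun i => (b i : Γ.L2) := b.orthonormal.comp_linearIsometry K.subtypeₗᵢ
  have hex : ∀ i, ∃ z ∈ L, Γ.sobolevDeriv z = b i := fun i => (b i).2
  choose z hzL hz using hex
  have h1 : (Module.finrank ℂ L : ℝ) ≤ ∑ i, κ * ‖S (z i)‖ ^ 2 := by
    calc (Module.finrank ℂ L : ℝ) = ∑ _i : Fin (Module.finrank ℂ K), (1 : ℝ) := by simp [hK]
      _ ≤ _ := by
        refine Finset.sum_le_sum fun i _ => ?_
        have := hL _ (hzL i)
        rwa [hz, hb.1 i, one_pow] at this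
  have h2 : ∑ i, ‖S (z i)‖ ^ 2 ≤ B := by
    rw [← ENNReal.ofReal_le_ofReal_iff hB, ENNReal.ofReal_sum_of_nonneg (fun _ _ => by positivity)]
    simp only [h.ofReal_norm_sq]
    rw [← lintegral_finsetSum'
      (f := fun i x => ENNReal.ofReal (W x) * ‖Γ.sobolevEmb (z i) x‖ₑ ^ 2) _ fun i _ =>
      hW.ennreal_ofReal.mul ((Lp.aestronglyMeasurable (Γ.sobolevEmb (z i))).enorm.pow_const 2)]
    -- The sum is taken under the integral, where pointwise it is at most `|x|`.
    refine le_trans (lintegral_mono_ae ?_) hWB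
    filter_upwards [ae_all_iff.2 fun i => sobolevEmb_ae_eq (z i)] with x hx
    rw [← Finset.mul_sum]
    gcongr
    refine le_trans (le_of_eq ?_) (ENNReal.ofReal_le_ofReal (sum_norm_primitive_sq_le hb x))
    rw [ENNReal.ofReal_sum_of_nonneg (fun _ _ => by positivity)]
    refine Finset.sum_congr rfl fun i _ => ?_
    rw [hx i, hz, ← ofReal_norm, ENNReal.ofReal_pow (norm_nonneg _)]
  rw [← Finset.mul_sum] at h1
  exact h1.trans (by gcongr)

/-- Spectral properties of a Schrödinger operator whose potential splits into a part that is small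
with respect to the Dirichlet integral and a part of trace class. -/
theorem IsSqrtMul.spectral {W W₁ : Γ.Point → ℝ} {S S₁ : Γ.sobolevSpace →L[ℂ] Γ.L2}
    (h : IsSqrtMul W S) (h₁ : IsSqrtMul W₁ S₁) (hW0 : ∀ x, 0 ≤ W x)
    (hW₁ : AEMeasurable W₁ volume)
    (hSS : ∀ z, ‖S z‖ ^ 2 ≤ 1 / 4 * ‖Γ.sobolevDeriv z‖ ^ 2 + ‖S₁ z‖ ^ 2) {B M : ℝ} (hB : 0 ≤ B)
    (hWB : ∫⁻ x, ENNReal.ofReal (W₁ x) * ENNReal.ofReal x.abs ≤ ENNReal.ofReal B)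
    (hM : ∀ z, ‖S z‖ ^ 2 ≤ 1 / 2 * ‖Γ.sobolevDeriv z‖ ^ 2 + M * ‖Γ.sobolevEmb z‖ ^ 2) :
    IsSelfAdjoint (Γ.schrodinger W) ∧ HasFiniteNegativeSpectrum (Γ.schrodinger W) ∧
      negEigenvalueCount (Γ.schrodinger W) ≤ ENNReal.ofReal (2 * B) := by
  have hG := h.isFormGraph hW0
  have hA := isSelfAdjoint_formOperator S
  -- A nonpositive form already gives the constant `4/3`; with `2` the condition survives the loss
  -- of another quarter of the Dirichlet integral.
  let P : Γ.sobolevSpace → Prop := fun z => ‖Γ.sobolevDeriv z‖ ^ 2 ≤ 2 * ‖S₁ z‖ ^ 2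
  have hN : ∀ L : Submodule ℂ Γ.sobolevSpace, FiniteDimensional ℂ L → (∀ z ∈ L, P z) →
      Module.finrank ℂ L ≤ ⌊2 * B⌋₊ := fun L hLf hL =>
    Nat.le_floor (h₁.finrank_le hW₁ zero_le_two hB hWB L hL)
  have hP : ∀ z, (inner ℂ (formOperator S z) z).re ≤ 0 → P z := by
    intro z hz
    rw [re_inner_formOperator] at hz
    change _ ≤ _
    nlinarith [hSS z, sq_nonneg ‖Γ.sobolevDeriv z‖]
  refine ⟨?_, ?_, ?_⟩
  -- With this shift the form is at least half the squared Sobolev norm, so the operator is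
  -- coercive.
  · refine hG.isSelfAdjoint sobolevEmb_injective denseRange_sobolevEmb hA (m := M + 1 / 2) ?_
    refine ContinuousLinearMap.isUnit_of_forall_le_norm_inner_map _ (c := 1 / 2) (by norm_num)
      fun z => ?_
    refine le_trans ?_ (RCLike.re_le_norm _)
    have e : RCLike.re (inner ℂ ((formOperator S + ((M + 1 / 2 : ℝ) : ℂ) •
        (ContinuousLinearMap.adjoint Γ.sobolevEmb ∘L Γ.sobolevEmb)) z) z) =
        ‖Γ.sobolevDeriv z‖ ^ 2 - ‖S z‖ ^ 2 + (M + 1 / 2) * ‖Γ.sobolevEmb z‖ ^ 2 := by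
      rw [add_apply, inner_add_left, smul_apply, inner_smul_left,
        ContinuousLinearMap.comp_apply, ContinuousLinearMap.adjoint_inner_left,
        Complex.conj_ofReal, map_add, inner_self_eq_norm_sq_to_K]
      change (inner ℂ (formOperator S z) z).re + (_ : ℂ).re = _
      rw [re_inner_formOperator, Complex.re_ofReal_mul]
      norm_cast
    rw [e, sobolevSpace_norm_sq]
    have h2 : ((1 / 2 : NNReal) : ℝ) = 1 / 2 := by norm_num
    rw [h2]
    nlinarith [hM z]
  · refine hG.hasFiniteNegativeSpectrum sobolevEmb_injective denseRange_sobolevEmb hA hN hP ?_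
    intro l hl
    -- The part `-l` is absorbed by the spectral shift and the part `1/4` by the slack in `P`.
    refine ⟨min (1 / 4) (-l), lt_min (by norm_num) (by linarith), fun z hz => ?_⟩
    rw [re_inner_formOperator, sobolevSpace_norm_sq] at hz
    have h3 : min (1 / 4) (-l) * (‖Γ.sobolevEmb z‖ ^ 2 + ‖Γ.sobolevDeriv z‖ ^ 2) ≤
        -l * ‖Γ.sobolevEmb z‖ ^ 2 + 1 / 4 * ‖Γ.sobolevDeriv z‖ ^ 2 := by
      rw [mul_add]
      gcongr
      · exact min_le_right _ _
      · exact min_le_left _ _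
    change _ ≤ _
    nlinarith [hSS z]
  · refine (hG.negEigenvalueCount_le sobolevEmb_injective denseRange_sobolevEmb hA hN hP).trans ?_
    rw [← ENNReal.ofReal_natCast]
    exact ENNReal.ofReal_le_ofReal (Nat.floor_le (by positivity))

end RegularTree

/-! ### Splitting of the potential -/

namespace RegularTree

variable {Γ : RegularTree}

variable (Γ) in
/-- The integral of `W |x|` over the set where `W |x|² > s`. -/
def tailIntegral (W : Γ.Point → ℝ) (s : ℝ) : ℝ≥0∞ :=
  ∫⁻ x in {x : Γ.Point | s < W x * x.abs ^ 2}, ENNReal.ofReal (W x) * ENNReal.ofReal x.abs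

theorem nullMeasurableSet_lt_mul_abs_sq {W : Γ.Point → ℝ} (hW : AEMeasurable W volume) (s : ℝ) :
    NullMeasurableSet {x : Γ.Point | s < W x * x.abs ^ 2} volume :=
  nullMeasurableSet_lt aemeasurable_const (hW.mul (measurable_abs.pow_const 2).aemeasurable)

theorem IsSobolev.lintegral_mul_le {u w : Γ.Point → ℂ} (h : Γ.IsSobolev u w) {W : Γ.Point → ℝ}
    {B : ℝ≥0∞}
    (hWB : ∫⁻ x, ENNReal.ofReal (W x) * ENNReal.ofReal x.abs ≤ B) :
    ∫⁻ x, ENNReal.ofReal (W x) * ‖u x‖ₑ ^ 2 ≤ B * ∫⁻ x, ‖w x‖ₑ ^ 2 := by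
  have hw : ∫⁻ x, ‖w x‖ₑ ^ 2 ≠ ∞ := by
    have := (eLpNorm_lt_top_iff_lintegral_rpow_enorm_lt_top two_ne_zero ENNReal.ofNat_ne_top).1
      h.memLp_deriv.2
    simpa only [ENNReal.toReal_ofNat, ENNReal.rpow_ofNat] using this.ne
  calc ∫⁻ x, ENNReal.ofReal (W x) * ‖u x‖ₑ ^ 2
      ≤ ∫⁻ x, (ENNReal.ofReal (W x) * ENNReal.ofReal x.abs) * ∫⁻ y, ‖w y‖ₑ ^ 2 := by
        refine lintegral_mono fun x => ?_
        rw [mul_assoc]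
        gcongr
        exact h.enorm_sq_le x
    _ = (∫⁻ x, ENNReal.ofReal (W x) * ENNReal.ofReal x.abs) * ∫⁻ y, ‖w y‖ₑ ^ 2 :=
        lintegral_mul_const' _ _ hw
    _ ≤ _ := by gcongr

/-- Dominated convergence: the excess of `W` over a large constant is small in the trace norm. What
is cut off is bounded, so the form is bounded below with relative bound as small as desired. -/
theorem exists_truncation {W : Γ.Point → ℝ} (hW : AEMeasurable W volume)
    (hfin : ∫⁻ x, ENNReal.ofReal (W x) * ENNReal.ofReal x.abs ≠ ∞) {δ : ℝ≥0∞} (hδ : 0 < δ) :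
    ∃ n : ℕ, ∫⁻ x, ENNReal.ofReal (W x - n) * ENNReal.ofReal x.abs ≤ δ := by
  have hm : Measurable fun x : Γ.Point => ENNReal.ofReal x.abs := measurable_abs.ennreal_ofReal
  have h : Tendsto (fun n : ℕ => ∫⁻ x, ENNReal.ofReal (W x - n) * ENNReal.ofReal x.abs) atTop
      (𝓝 (∫⁻ _ : Γ.Point, 0)) := by
    refine tendsto_lintegral_of_dominated_convergence' _
      (fun n => (hW.sub_const _).ennreal_ofReal.mul hm.aemeasurable)
      (fun n => Eventually.of_forall fun x => ?_) hfin (Eventually.of_forall fun x => ?_)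
    · exact mul_le_mul_left (ENNReal.ofReal_le_ofReal (sub_le_self _ n.cast_nonneg)) _
    · refine tendsto_const_nhds.congr' ?_
      obtain ⟨N, hN⟩ := exists_nat_ge (W x)
      filter_upwards [eventually_ge_atTop N] with n hn
      have : (N : ℝ) ≤ n := Nat.cast_le.2 hn
      rw [ENNReal.ofReal_of_nonpos (by linarith), zero_mul]
  rw [lintegral_zero] at h
  exact ((h.eventually_lt_const hδ).exists).imp fun n hn => hn.le

theorem exists_isSobolev_lintegral_eq (z : Γ.sobolevSpace) : ∃ u w : Γ.Point → ℂ,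
    Γ.IsSobolev u w ∧ ∫⁻ x, ‖u x‖ₑ ^ 2 = ENNReal.ofReal (‖Γ.sobolevEmb z‖ ^ 2) ∧
      ∫⁻ x, ‖w x‖ₑ ^ 2 = ENNReal.ofReal (‖Γ.sobolevDeriv z‖ ^ 2) ∧
      ∀ (W : Γ.Point → ℝ) (S : Γ.sobolevSpace →L[ℂ] Γ.L2), IsSqrtMul W S →
        ∫⁻ x, ENNReal.ofReal (W x) * ‖u x‖ₑ ^ 2 = ENNReal.ofReal (‖S z‖ ^ 2) := by
  obtain ⟨u, w, h, hu, hw⟩ := exists_isSobolev z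
  refine ⟨u, w, h, ?_, ?_, fun W S hS => ?_⟩
  · rw [← lintegral_enorm_sq_Lp]
    refine lintegral_congr_ae ?_
    filter_upwards [hu] with x hx
    rw [hx]
  · rw [← lintegral_enorm_sq_Lp]
    refine lintegral_congr_ae ?_
    filter_upwards [hw] with x hx
    rw [hx]
  · rw [hS.ofReal_norm_sq]
    refine lintegral_congr_ae ?_
    filter_upwards [hu] with x hx
    rw [hx]

/-- The threshold is chosen so that `ε` times the Hardy constant is `1/4`. -/
theorem HasGlobalDimension.exists_split {d : ℝ} (hd : Γ.HasGlobalDimension d) (hd2 : d ≠ 2) :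
    ∃ ε : ℝ, 0 < ε ∧ ∀ W : Γ.Point → ℝ, AEMeasurable W volume →
      ∀ u w : Γ.Point → ℂ, Γ.IsSobolev u w →
        ∫⁻ x, ENNReal.ofReal (W x) * ‖u x‖ₑ ^ 2 ≤ ENNReal.ofReal (1 / 4) * (∫⁻ x, ‖w x‖ₑ ^ 2) +
          ∫⁻ x, ENNReal.ofReal ({x : Γ.Point | ε < W x * x.abs ^ 2}.indicator W x) *
            ‖u x‖ₑ ^ 2 := by
  obtain ⟨C, hC, hH⟩ := hd.exists_hardy hd2
  refine ⟨1 / (4 * C), by positivity, fun W hW u w h => ?_⟩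
  set ε := 1 / (4 * C) with hε
  have hε0 : 0 < ε := by positivity
  set W₁ := {x : Γ.Point | ε < W x * x.abs ^ 2}.indicator W with hW₁
  have hm : AEMeasurable (fun x => ENNReal.ofReal (W₁ x) * ‖u x‖ₑ ^ 2) volume :=
    (hW.indicator₀ (nullMeasurableSet_lt_mul_abs_sq hW ε)).ennreal_ofReal.mul
      (h.memLp.aestronglyMeasurable.enorm.pow_const 2)
  calc ∫⁻ x, ENNReal.ofReal (W x) * ‖u x‖ₑ ^ 2
      ≤ ∫⁻ x, (ENNReal.ofReal ε * (‖u x‖ₑ ^ 2 * ENNReal.ofReal (x.abs ^ (-2 : ℝ))) +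
          ENNReal.ofReal (W₁ x) * ‖u x‖ₑ ^ 2) := by
        refine lintegral_mono fun x => ?_
        by_cases hx : ε < W x * x.abs ^ 2
        · rw [hW₁, Set.indicator_of_mem (by exact hx)]
          exact le_add_self
        · refine le_trans ?_ le_self_add
          rcases (abs_nonneg x).eq_or_lt with h0 | h0
          -- At the root the power `0 ^ (-2)` is zero by convention, so the estimate rests on `u`
          -- vanishing there.
          · have := h.enorm_sq_le x
            rw [← h0, ENNReal.ofReal_zero, zero_mul] at this
            rw [nonpos_iff_eq_zero.1 this]
            simp
          · rw [mul_comm (‖u x‖ₑ ^ 2), ← mul_assoc, ← ENNReal.ofReal_mul hε0.le]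
            gcongr
            rw [Real.rpow_neg h0.le, Real.rpow_two, ← div_eq_mul_inv, le_div_iff₀ (by positivity)]
            exact not_lt.1 hx
    _ = ENNReal.ofReal ε * (∫⁻ x, ‖u x‖ₑ ^ 2 * ENNReal.ofReal (x.abs ^ (-2 : ℝ))) +
          ∫⁻ x, ENNReal.ofReal (W₁ x) * ‖u x‖ₑ ^ 2 := by
        rw [lintegral_add_right' _ hm, lintegral_const_mul' _ _ ENNReal.ofReal_ne_top]
    _ ≤ ENNReal.ofReal ε * (ENNReal.ofReal C * (∫⁻ x, ‖w x‖ₑ ^ 2)) +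
          ∫⁻ x, ENNReal.ofReal (W₁ x) * ‖u x‖ₑ ^ 2 := by
        gcongr
        exact hH u w h
    _ = _ := by
        have h4 : ε * C = 1 / 4 := by rw [hε]; field_simp
        rw [← mul_assoc, ← ENNReal.ofReal_mul hε0.le, h4]

/-- The part above the threshold enters twice: its trace controls the eigenvalue count, and its
truncation controls the lower bound of the form, by `1/4 + 1/4 = 1/2` of the Dirichlet integral. -/
theorem HasGlobalDimension.exists_spectral {d : ℝ} (hd : Γ.HasGlobalDimension d) (hd2 : d ≠ 2) :
    ∃ ε : ℝ, 0 < ε ∧ ∀ W : Γ.Point → ℝ, AEMeasurable W volume → (∀ x, 0 ≤ W x) →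
      Γ.tailIntegral W ε ≠ ∞ →
        Γ.FormBoundedBelow W ∧ IsSelfAdjoint (Γ.schrodinger W) ∧
        HasFiniteNegativeSpectrum (Γ.schrodinger W) ∧
        negEigenvalueCount (Γ.schrodinger W) ≤ 2 * Γ.tailIntegral W ε := by
  obtain ⟨ε, hε, hsplit⟩ := hd.exists_split hd2
  refine ⟨ε, hε, fun W hW hW0 hfin => ?_⟩
  have hA := nullMeasurableSet_lt_mul_abs_sq hW ε
  replace hsplit := hsplit W hW
  set W₁ := {x : Γ.Point | ε < W x * x.abs ^ 2}.indicator W with hW₁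
  have hW₁m : AEMeasurable W₁ volume := hW.indicator₀ hA
  have htail : ∫⁻ x, ENNReal.ofReal (W₁ x) * ENNReal.ofReal x.abs = Γ.tailIntegral W ε := by
    rw [tailIntegral, ← lintegral_indicator₀ hA]
    refine lintegral_congr fun x => ?_
    by_cases hx : x ∈ {x : Γ.Point | ε < W x * x.abs ^ 2}
    · rw [hW₁, Set.indicator_of_mem hx, Set.indicator_of_mem hx]
    · rw [hW₁, Set.indicator_of_notMem hx, Set.indicator_of_notMem hx, ENNReal.ofReal_zero,
        zero_mul]
  set B := (Γ.tailIntegral W ε).toReal with hB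
  have hBt : ENNReal.ofReal B = Γ.tailIntegral W ε := ENNReal.ofReal_toReal hfin
  have hB0 : 0 ≤ B := ENNReal.toReal_nonneg
  have hWB : ∫⁻ x, ENNReal.ofReal (W₁ x) * ENNReal.ofReal x.abs ≤ ENNReal.ofReal B := by
    rw [htail, hBt]
  have hb₁ : ∀ u w : Γ.Point → ℂ, Γ.IsSobolev u w →
      ∫⁻ x, ENNReal.ofReal (W₁ x) * ‖u x‖ₑ ^ 2 ≤ ENNReal.ofReal B * ∫⁻ x, ‖w x‖ₑ ^ 2 :=
    fun u w h => h.lintegral_mul_le hWB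
  obtain ⟨S₁, hS₁⟩ := exists_isSqrtMul hW₁m hB0 hb₁
  obtain ⟨S, hS⟩ := exists_isSqrtMul (c := 1 / 4 + B) hW (by positivity) fun u w h => by
    rw [ENNReal.ofReal_add (by positivity) hB0, add_mul]
    exact (hsplit u w h).trans (add_le_add le_rfl (hb₁ u w h))
  obtain ⟨n, hn⟩ := exists_truncation hW₁m (by rw [htail]; exact hfin)
    (δ := ENNReal.ofReal (1 / 4)) (by rw [ENNReal.ofReal_pos]; norm_num)
  have hSS : ∀ z, ‖S z‖ ^ 2 ≤ 1 / 4 * ‖Γ.sobolevDeriv z‖ ^ 2 + ‖S₁ z‖ ^ 2 := by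
    intro z
    obtain ⟨u, w, h, -, hw, hSu⟩ := exists_isSobolev_lintegral_eq z
    rw [← ENNReal.ofReal_le_ofReal_iff (by positivity),
      ENNReal.ofReal_add (by positivity) (by positivity), ENNReal.ofReal_mul (by positivity),
      ← hSu W S hS, ← hSu W₁ S₁ hS₁, ← hw]
    exact hsplit u w h
  have hM₁ : ∀ z, ‖S₁ z‖ ^ 2 ≤ 1 / 4 * ‖Γ.sobolevDeriv z‖ ^ 2 + n * ‖Γ.sobolevEmb z‖ ^ 2 := by
    intro z
    obtain ⟨u, w, h, hu, hw, hSu⟩ := exists_isSobolev_lintegral_eq z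
    rw [← ENNReal.ofReal_le_ofReal_iff (by positivity),
      ENNReal.ofReal_add (by positivity) (by positivity), ENNReal.ofReal_mul (by positivity),
      ENNReal.ofReal_mul (by positivity), ← hSu W₁ S₁ hS₁, ← hw, ← hu]
    calc ∫⁻ x, ENNReal.ofReal (W₁ x) * ‖u x‖ₑ ^ 2
        ≤ ∫⁻ x, (ENNReal.ofReal (W₁ x - n) * ‖u x‖ₑ ^ 2 + ENNReal.ofReal n * ‖u x‖ₑ ^ 2) := by
          refine lintegral_mono fun x => ?_
          rw [← add_mul]
          refine mul_le_mul_left ?_ _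
          refine le_trans (le_of_eq ?_) ENNReal.ofReal_add_le
          rw [sub_add_cancel]
      _ = (∫⁻ x, ENNReal.ofReal (W₁ x - n) * ‖u x‖ₑ ^ 2) +
            ENNReal.ofReal n * ∫⁻ x, ‖u x‖ₑ ^ 2 := by
          have hm : AEMeasurable (fun x => ENNReal.ofReal (W₁ x - n) * ‖u x‖ₑ ^ 2) volume :=
            (hW₁m.sub_const _).ennreal_ofReal.mul
              (h.memLp.aestronglyMeasurable.enorm.pow_const 2)
          rw [lintegral_add_left' hm, lintegral_const_mul' _ _ ENNReal.ofReal_ne_top]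
      _ ≤ _ := add_le_add (h.lintegral_mul_le hn) le_rfl
  have hM : ∀ z, ‖S z‖ ^ 2 ≤ 1 / 2 * ‖Γ.sobolevDeriv z‖ ^ 2 + n * ‖Γ.sobolevEmb z‖ ^ 2 :=
    fun z => by linarith [hSS z, hM₁ z]
  obtain ⟨h1, h2, h3⟩ := hS.spectral hS₁ hW0 hW₁m hSS hB0 hWB hM
  refine ⟨hS.formBoundedBelow hW0 hM, h1, h2, h3.trans (le_of_eq ?_)⟩
  rw [ENNReal.ofReal_mul zero_le_two, hBt, ENNReal.ofReal_ofNat]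

theorem tailIntegral_const_mul (V : Γ.Point → ℝ) {a : ℝ} (ha : 0 < a) (s : ℝ) :
    Γ.tailIntegral (fun x => a * V x) s = ENNReal.ofReal a * Γ.tailIntegral V (s / a) := by
  have h : {x : Γ.Point | s < a * V x * x.abs ^ 2} = {x | s / a < V x * x.abs ^ 2} := by
    ext x
    rw [Set.mem_ofPred_eq, Set.mem_ofPred_eq, div_lt_iff₀' ha, mul_assoc]
  rw [tailIntegral, h, tailIntegral, ← lintegral_const_mul' _ _ ENNReal.ofReal_ne_top]
  refine lintegral_congr fun x => ?_
  rw [ENNReal.ofReal_mul ha.le, mul_assoc]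

end RegularTree

/-! ### Weak Lebesgue spaces -/

section WeakLp

variable {X : Type*} [MeasurableSpace X] {μ : Measure X} {f : X → ℝ}

/-- In the layer cake formula for `f` restricted to `{f > s}`, levels below `s` see at most the
whole of that set. -/
theorem setLIntegral_lt_le_layercake (hf : AEMeasurable f μ) (hf0 : ∀ x, 0 ≤ f x) {s : ℝ}
    (hs : 0 < s) :
    ∫⁻ x in {x | s < f x}, ENNReal.ofReal (f x) ∂μ ≤
      ENNReal.ofReal s * μ {x | s < f x} + ∫⁻ r in Set.Ioi s, μ {x | r < f x} := by
  rw [lintegral_eq_lintegral_meas_lt _ (ae_of_all _ hf0) hf.restrict,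
    ← Set.Ioc_union_Ioi_eq_Ioi hs.le]
  refine (lintegral_union_le _ _ _).trans (add_le_add ?_ ?_)
  · calc ∫⁻ r in Set.Ioc 0 s, μ.restrict {x | s < f x} {x | r < f x}
        ≤ ∫⁻ _ in Set.Ioc 0 s, μ {x | s < f x} := by
          refine lintegral_mono fun r => (measure_mono (Set.subset_univ _)).trans ?_
          rw [Measure.restrict_apply_univ]
      _ = _ := by rw [setLIntegral_const, Real.volume_Ioc, sub_zero, mul_comm]
  · exact lintegral_mono fun r => Measure.restrict_apply_le _ _

theorem setLIntegral_Ioi_rpow_neg {p s : ℝ} (hp : 1 < p) (hs : 0 < s) :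
    ∫⁻ r in Set.Ioi s, ENNReal.ofReal (r ^ (-p)) = ENNReal.ofReal (s ^ (1 - p) / (p - 1)) := by
  rw [← ofReal_integral_eq_lintegral_ofReal (integrableOn_Ioi_rpow_of_lt (by linarith) hs)
    ((ae_restrict_mem measurableSet_Ioi).mono fun r hr =>
      Real.rpow_nonneg (hs.le.trans (le_of_lt hr)) _),
    integral_Ioi_rpow_of_lt (by linarith) hs]
  congr 1
  rw [← neg_div_neg_eq]
  congr 1 <;> ring_nf

theorem le_ofReal_rpow_neg_mul {p r : ℝ} (hr : 0 < r) {m Λ : ℝ≥0∞}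
    (h : ENNReal.ofReal (r ^ p) * m ≤ Λ) : m ≤ ENNReal.ofReal (r ^ (-p)) * Λ := by
  refine le_trans (le_of_eq ?_) (mul_le_mul_right h _)
  rw [← mul_assoc, ← ENNReal.ofReal_mul (Real.rpow_nonneg hr.le _), ← Real.rpow_add hr,
    neg_add_cancel, Real.rpow_zero, ENNReal.ofReal_one, one_mul]

theorem setLIntegral_Ioi_le {p s : ℝ} (hp : 1 < p) (hs : 0 < s) {φ : ℝ → ℝ≥0∞} {Λ : ℝ≥0∞}
    (hΛ : Λ ≠ ∞) (h : ∀ r, s < r → ENNReal.ofReal (r ^ p) * φ r ≤ Λ) :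
    ∫⁻ r in Set.Ioi s, φ r ≤ ENNReal.ofReal (s ^ (1 - p) / (p - 1)) * Λ := by
  rw [← setLIntegral_Ioi_rpow_neg hp hs, ← lintegral_mul_const' _ _ hΛ]
  exact setLIntegral_mono' measurableSet_Ioi fun r hr =>
    le_ofReal_rpow_neg_mul (hs.trans hr) (h r hr)

/-- If the distribution function is at most `Λ r⁻ᵖ` for `s ≤ r ≤ δ`, then the integral over
`{f > s}` is at most `p / (p - 1) * s ^ (1 - p) * Λ` up to the contribution of the large values. -/
theorem setLIntegral_lt_le_of_le (hf : AEMeasurable f μ) (hf0 : ∀ x, 0 ≤ f x) {p s δ : ℝ}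
    (hp : 1 < p) (hs : 0 < s) (hsδ : s ≤ δ) {Λ : ℝ≥0∞} (hΛ : Λ ≠ ∞)
    (h : ∀ r, s ≤ r → r ≤ δ → ENNReal.ofReal (r ^ p) * μ {x | r < f x} ≤ Λ) :
    ∫⁻ x in {x | s < f x}, ENNReal.ofReal (f x) ∂μ ≤
      ENNReal.ofReal (p / (p - 1) * s ^ (1 - p)) * Λ +
        ∫⁻ r in Set.Ioi δ, μ {x | r < f x} := by
  have hsp : 0 ≤ s ^ (1 - p) := Real.rpow_nonneg hs.le _
  refine (setLIntegral_lt_le_layercake hf hf0 hs).trans ?_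
  rw [← Set.Ioc_union_Ioi_eq_Ioi hsδ]
  have h1 : ENNReal.ofReal s * μ {x | s < f x} ≤ ENNReal.ofReal (s ^ (1 - p)) * Λ := by
    refine (mul_le_mul_right (le_ofReal_rpow_neg_mul hs (h s le_rfl hsδ)) _).trans (le_of_eq ?_)
    rw [← mul_assoc, ← ENNReal.ofReal_mul hs.le, sub_eq_add_neg, Real.rpow_add hs, Real.rpow_one]
  have h2 : ∫⁻ r in Set.Ioc s δ, μ {x | r < f x} ≤
      ENNReal.ofReal (s ^ (1 - p) / (p - 1)) * Λ := by
    rw [← setLIntegral_Ioi_rpow_neg hp hs, ← lintegral_mul_const' _ _ hΛ]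
    refine (setLIntegral_mono' measurableSet_Ioc fun r hr =>
      le_ofReal_rpow_neg_mul (hs.trans hr.1) (h r hr.1.le hr.2)).trans ?_
    exact lintegral_mono_set Set.Ioc_subset_Ioi_self
  calc _ ≤ ENNReal.ofReal (s ^ (1 - p)) * Λ + (ENNReal.ofReal (s ^ (1 - p) / (p - 1)) * Λ +
        ∫⁻ r in Set.Ioi δ, μ {x | r < f x}) :=
        add_le_add h1 ((lintegral_union_le _ _ _).trans (add_le_add h2 le_rfl))
    _ = _ := by
        rw [← add_assoc, ← add_mul, ← ENNReal.ofReal_add hsp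
          (div_nonneg hsp (by linarith))]
        congr 3
        have : p - 1 ≠ 0 := by linarith
        field_simp
        ring

theorem setLIntegral_lt_le (hf : AEMeasurable f μ) (hf0 : ∀ x, 0 ≤ f x) {p s : ℝ}
    (hp : 1 < p) (hs : 0 < s) {Λ : ℝ≥0∞} (hΛ : Λ ≠ ∞)
    (h : ∀ r, 0 < r → ENNReal.ofReal (r ^ p) * μ {x | r < f x} ≤ Λ) :
    ∫⁻ x in {x | s < f x}, ENNReal.ofReal (f x) ∂μ ≤
      ENNReal.ofReal (p / (p - 1) * s ^ (1 - p)) * Λ := by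
  have hsp : 0 ≤ s ^ (1 - p) := Real.rpow_nonneg hs.le _
  refine (setLIntegral_lt_le_layercake hf hf0 hs).trans ?_
  have h1 : ENNReal.ofReal s * μ {x | s < f x} ≤ ENNReal.ofReal (s ^ (1 - p)) * Λ := by
    refine (mul_le_mul_right (le_ofReal_rpow_neg_mul hs (h s hs)) _).trans (le_of_eq ?_)
    rw [← mul_assoc, ← ENNReal.ofReal_mul hs.le, sub_eq_add_neg, Real.rpow_add hs, Real.rpow_one]
  refine (add_le_add h1 (setLIntegral_Ioi_le hp hs hΛ fun r hr => h r (hs.trans hr))).trans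
    (le_of_eq ?_)
  rw [← add_mul, ← ENNReal.ofReal_add hsp (div_nonneg hsp (by linarith))]
  congr 2
  have : p - 1 ≠ 0 := by linarith
  field_simp
  ring

/-- The supremum is bounded by the `p`-th power of the weak quasi-norm. -/
theorem MemWeakLp.iSup_lt_top {p : ℝ} (hp : 1 < p) (h : MemWeakLp f p μ) (hf0 : ∀ x, 0 ≤ f x) :
    ⨆ s : {s : ℝ // 0 < s}, ENNReal.ofReal ((s : ℝ) ^ p) * μ {x | (s : ℝ) < f x} < ∞ := by
  have hp0 : 0 < p := by linarith
  refine (iSup_le fun s => ?_).trans_lt (ENNReal.rpow_lt_top_of_nonneg hp0.le h.2.ne)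
  refine le_trans (le_of_eq ?_) (ENNReal.rpow_le_rpow (le_iSup _ s) hp0.le)
  simp only [abs_of_nonneg (hf0 _)]
  rw [ENNReal.mul_rpow_of_nonneg _ _ hp0.le, ← ENNReal.rpow_mul, one_div,
    inv_mul_cancel₀ hp0.ne', ENNReal.rpow_one, ENNReal.ofReal_rpow_of_pos s.2]

theorem ofReal_le_rpow_mul_of_lt {p s y : ℝ} (hp : 1 < p) (hs : 0 < s) (h : s < y) :
    ENNReal.ofReal y ≤ ENNReal.ofReal (s ^ (1 - p)) * ENNReal.ofReal (y ^ p) := by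
  have hy : 0 < y := hs.trans h
  rw [← ENNReal.ofReal_mul (Real.rpow_nonneg hs.le _)]
  refine ENNReal.ofReal_le_ofReal ?_
  calc y = y ^ (1 - p) * y ^ p := by rw [← Real.rpow_add hy, sub_add_cancel, Real.rpow_one]
    _ ≤ _ := mul_le_mul_of_nonneg_right
        (Real.rpow_le_rpow_of_nonpos hs h.le (by linarith)) (Real.rpow_nonneg hy.le _)

theorem setLIntegral_lt_le_lintegral_rpow (hf : AEMeasurable f μ) {p s : ℝ} (hp : 1 < p)
    (hs : 0 < s) :
    ∫⁻ x in {x | s < f x}, ENNReal.ofReal (f x) ∂μ ≤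
      ENNReal.ofReal (s ^ (1 - p)) * ∫⁻ x, ENNReal.ofReal (f x ^ p) ∂μ := by
  rw [← lintegral_const_mul' _ _ ENNReal.ofReal_ne_top]
  refine le_trans ?_ (setLIntegral_le_lintegral {x | s < f x} _)
  refine lintegral_mono_ae ?_
  filter_upwards [ae_restrict_mem₀ (nullMeasurableSet_lt aemeasurable_const hf)] with x hx
  exact ofReal_le_rpow_mul_of_lt hp hs hx

/-- On `{f > ε/a}` the function `a^(1-p) f` is at most `ε^(1-p) f^p`, a majorant independent of `a`,
and it tends to zero pointwise because `p > 1`. -/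
theorem tendsto_rpow_mul_setLIntegral (hf : AEMeasurable f μ) {p ε : ℝ} (hp : 1 < p)
    (hε : 0 < ε) (hfin : ∫⁻ x, ENNReal.ofReal (f x ^ p) ∂μ ≠ ∞) :
    Tendsto (fun a : ℝ => ENNReal.ofReal (a ^ (1 - p)) *
      ∫⁻ x in {x | ε / a < f x}, ENNReal.ofReal (f x) ∂μ) atTop (𝓝 0) := by
  have hm : ∀ a : ℝ, NullMeasurableSet {x | ε / a < f x} μ := fun a =>
    nullMeasurableSet_lt aemeasurable_const hf
  have h0 : Tendsto (fun a : ℝ => ENNReal.ofReal (a ^ (1 - p))) atTop (𝓝 0) := by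
    have := ENNReal.tendsto_ofReal (tendsto_rpow_neg_atTop (show 0 < p - 1 by linarith))
    simpa only [neg_sub, ENNReal.ofReal_zero] using this
  have h : Tendsto (fun a : ℝ => ∫⁻ x, {x | ε / a < f x}.indicator
      (fun x => ENNReal.ofReal (a ^ (1 - p)) * ENNReal.ofReal (f x)) x ∂μ) atTop
      (𝓝 (∫⁻ _, 0 ∂μ)) := by
    refine tendsto_lintegral_filter_of_dominated_convergence'
      (fun x => ENNReal.ofReal (ε ^ (1 - p)) * ENNReal.ofReal (f x ^ p))
      (Eventually.of_forall fun a => (hf.ennreal_ofReal.const_mul _).indicator₀ (hm a)) ?_ ?_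
      (ae_of_all _ fun x => ?_)
    · filter_upwards [eventually_gt_atTop 0] with a ha
      refine ae_of_all _ (Set.indicator_le fun x hx => ?_)
      refine (mul_le_mul_right (ofReal_le_rpow_mul_of_lt hp (div_pos hε ha) hx) _).trans
        (le_of_eq ?_)
      rw [← mul_assoc, ← ENNReal.ofReal_mul (Real.rpow_nonneg ha.le _),
        ← Real.mul_rpow ha.le (div_pos hε ha).le, mul_div_cancel₀ _ ha.ne']
    · rw [lintegral_const_mul' _ _ ENNReal.ofReal_ne_top]
      exact ENNReal.mul_ne_top ENNReal.ofReal_ne_top hfin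
    · have h1 : Tendsto (fun a : ℝ => ENNReal.ofReal (a ^ (1 - p)) * ENNReal.ofReal (f x)) atTop
          (𝓝 0) := by
        have := ENNReal.Tendsto.mul_const (b := ENNReal.ofReal (f x)) h0
          (Or.inr ENNReal.ofReal_ne_top)
        rwa [zero_mul] at this
      exact tendsto_of_tendsto_of_tendsto_of_le_of_le tendsto_const_nhds h1
        (fun _ => zero_le) fun a => Set.indicator_le_self _ _ _
  rw [lintegral_zero] at h
  refine h.congr fun a => ?_
  rw [lintegral_indicator₀ (hm a), lintegral_const_mul' _ _ ENNReal.ofReal_ne_top]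

end WeakLp

/-! ### Level sets of the potential and the strong coupling limit. -/

namespace RegularTree

variable {Γ : RegularTree} {V : Γ.Point → ℝ}

theorem levelIntegral_eq (V : Γ.Point → ℝ) (s : ℝ) :
    Γ.levelIntegral V s = Γ.invAbsMeasure {x | s < V x * x.abs ^ 2} :=
  (withDensity_apply' _ _).symm

theorem aemeasurable_invAbs (ν : Measure Γ.Point) :
    AEMeasurable (fun x : Γ.Point => ENNReal.ofReal x.abs⁻¹) ν :=
  measurable_abs.inv.ennreal_ofReal.aemeasurable

theorem aemeasurable_mul_abs_sq (hV : AEMeasurable V volume) :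
    AEMeasurable (fun x => V x * x.abs ^ 2) volume :=
  hV.mul (measurable_abs.pow_const 2).aemeasurable

theorem absolutelyContinuous_invAbsMeasure : Γ.invAbsMeasure ≪ volume :=
  withDensity_absolutelyContinuous _ _

theorem tailIntegral_eq (hV : AEMeasurable V volume) (s : ℝ) :
    Γ.tailIntegral V s =
      ∫⁻ x in {x | s < V x * x.abs ^ 2}, ENNReal.ofReal (V x * x.abs ^ 2) ∂Γ.invAbsMeasure := by
  rw [invAbsMeasure, restrict_withDensity', lintegral_withDensity_eq_lintegral_mul₀
    (aemeasurable_invAbs _) (aemeasurable_mul_abs_sq hV).restrict.ennreal_ofReal, tailIntegral]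
  refine lintegral_congr fun x => ?_
  rw [Pi.mul_apply, ← ENNReal.ofReal_mul' (abs_nonneg x),
    ← ENNReal.ofReal_mul (inv_nonneg.2 (abs_nonneg x))]
  congr 1
  -- At the root `|x|⁻¹` is zero by convention, and `V |x|` vanishes too.
  rcases (abs_nonneg x).eq_or_lt with h | h
  · simp [← h]
  · field_simp

theorem lintegral_rpow_eq (hV : AEMeasurable V volume) (hV0 : ∀ x, 0 ≤ V x) {p : ℝ}
    (hp : 1 < p) :
    ∫⁻ x, ENNReal.ofReal ((V x * x.abs ^ 2) ^ p) ∂Γ.invAbsMeasure =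
      ∫⁻ x, ENNReal.ofReal (V x ^ p * x.abs ^ (2 * p - 1)) := by
  rw [invAbsMeasure, lintegral_withDensity_eq_lintegral_mul₀ (aemeasurable_invAbs _)
    ((aemeasurable_mul_abs_sq hV).pow_const p).ennreal_ofReal]
  refine lintegral_congr fun x => ?_
  rw [Pi.mul_apply, ← ENNReal.ofReal_mul (inv_nonneg.2 (abs_nonneg x))]
  congr 1
  rcases (abs_nonneg x).eq_or_lt with h | h
  · rw [← h, Real.zero_rpow (by linarith), inv_zero, zero_mul, mul_zero]
  · rw [Real.mul_rpow (hV0 x) (by positivity), ← Real.rpow_natCast, ← Real.rpow_mul h.le,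
      Real.rpow_sub h, Real.rpow_one]
    push_cast
    field_simp

/-- Of the two ends `s → 0` and `s → ∞` only the first matters, since the threshold `ε/a` tends to
zero. -/
theorem nhdsGT_zero_le_comap_add_inv : 𝓝[>] (0 : ℝ) ≤ comap (fun s : ℝ => s + s⁻¹) atTop := by
  refine tendsto_iff_comap.1 ?_
  refine tendsto_atTop_mono' _ ?_ tendsto_inv_nhdsGT_zero
  filter_upwards [self_mem_nhdsWithin] with s hs
  exact le_add_of_nonneg_left (le_of_lt hs)

theorem rpow_mul_two_mul_ofReal {p a : ℝ} (ha : 0 < a) (x : ℝ≥0∞) :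
    ENNReal.ofReal (a ^ (-p)) * (2 * (ENNReal.ofReal a * x)) =
      2 * (ENNReal.ofReal (a ^ (1 - p)) * x) := by
  rw [mul_left_comm, ← mul_assoc (ENNReal.ofReal (a ^ (-p))),
    ← ENNReal.ofReal_mul (Real.rpow_nonneg ha.le _), sub_eq_neg_add, Real.rpow_add ha,
    Real.rpow_one]

theorem two_mul_ofReal_mul {p a ε : ℝ} (ha : 0 < a) (hε : 0 < ε) (c : ℝ) (x : ℝ≥0∞) :
    2 * (ENNReal.ofReal a * (ENNReal.ofReal (c * (ε / a) ^ (1 - p)) * x)) =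
      ENNReal.ofReal (2 * c * ε ^ (1 - p) * a ^ p) * x := by
  rw [← mul_assoc (ENNReal.ofReal a), ← ENNReal.ofReal_mul ha.le, ← mul_assoc,
    ← ENNReal.ofReal_ofNat, ← ENNReal.ofReal_mul zero_le_two]
  congr 2
  rw [Real.div_rpow hε.le ha.le, Real.rpow_sub ha, Real.rpow_one]
  have : a ^ p ≠ 0 := (Real.rpow_pos_of_pos ha p).ne'
  field_simp

/-- The term `K` collects the levels above `δ`. It does not depend on `s`, and after multiplication
by `a^(1-p)` it disappears in the limit. -/
theorem limsup_le_of_tail_bound {N I φ : ℝ → ℝ≥0∞} {p ε c : ℝ} (hp : 1 < p) (hε : 0 < ε)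
    (hc : 0 < c)
    (hN : ∀ a, 0 < a → N a ≤ 2 * (ENNReal.ofReal a * I (ε / a)))
    (hI : ∀ Λ : ℝ≥0∞, Λ ≠ ∞ → ∀ δ, 0 < δ → (∀ r, 0 < r → r ≤ δ → ENNReal.ofReal (r ^ p) * φ r ≤ Λ) →
      ∃ K : ℝ≥0∞, K ≠ ∞ ∧ ∀ s, 0 < s → s ≤ δ → I s ≤ ENNReal.ofReal (c * s ^ (1 - p)) * Λ + K) :
    limsup (fun a : ℝ => ENNReal.ofReal (a ^ (-p)) * N a) atTop ≤
      ENNReal.ofReal (2 * c * ε ^ (1 - p)) *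
        limsup (fun s : ℝ => ENNReal.ofReal (s ^ p) * φ s)
          (comap (fun s : ℝ => s + s⁻¹) atTop) := by
  have hC : 0 < 2 * c * ε ^ (1 - p) := mul_pos (by positivity) (Real.rpow_pos_of_pos hε _)
  have hC0 : ENNReal.ofReal (2 * c * ε ^ (1 - p)) ≠ 0 := (ENNReal.ofReal_pos.2 hC).ne'
  rw [mul_comm, ← ENNReal.div_le_iff hC0 ENNReal.ofReal_ne_top]
  -- Any `Λ` above the upper limit bounds `r^p φ(r)` on some interval `(0, δ]`.
  refine le_of_forall_gt_imp_ge_of_dense fun Λ hΛ => ?_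
  rw [ENNReal.div_le_iff hC0 ENNReal.ofReal_ne_top, mul_comm]
  rcases eq_or_ne Λ ∞ with rfl | hΛt
  · rw [ENNReal.mul_top hC0]
    exact le_top
  have h1 := nhdsGT_zero_le_comap_add_inv (eventually_lt_of_limsup_lt hΛ)
  obtain ⟨δ, hδ, hδ'⟩ := mem_nhdsGT_iff_exists_Ioc_subset.1 h1
  rw [Set.mem_Ioi] at hδ
  obtain ⟨K, hK, hIK⟩ := hI Λ hΛt δ hδ fun r hr hrδ => (hδ' ⟨hr, hrδ⟩ : _ < _).le
  have h2 : ∀ᶠ a : ℝ in atTop, ENNReal.ofReal (a ^ (-p)) * N a ≤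
      ENNReal.ofReal (2 * c * ε ^ (1 - p)) * Λ + 2 * (ENNReal.ofReal (a ^ (1 - p)) * K) := by
    filter_upwards [eventually_ge_atTop (ε / δ)] with a ha
    have ha0 : 0 < a := (div_pos hε hδ).trans_le ha
    have hs : ε / a ≤ δ := by
      rw [div_le_iff₀ ha0, ← div_le_iff₀' hδ]
      exact ha
    refine (mul_le_mul_right ((hN a ha0).trans (mul_le_mul_right
      (mul_le_mul_right (hIK _ (div_pos hε ha0) hs) _) _)) _).trans (le_of_eq ?_)
    rw [mul_add, mul_add, mul_add, two_mul_ofReal_mul ha0 hε, rpow_mul_two_mul_ofReal ha0,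
      ← mul_assoc, ← ENNReal.ofReal_mul (Real.rpow_nonneg ha0.le _), mul_left_comm,
      ← Real.rpow_add ha0, neg_add_cancel, Real.rpow_zero, mul_one]
  have h3 : Tendsto (fun a : ℝ => ENNReal.ofReal (2 * c * ε ^ (1 - p)) * Λ +
      2 * (ENNReal.ofReal (a ^ (1 - p)) * K)) atTop
      (𝓝 (ENNReal.ofReal (2 * c * ε ^ (1 - p)) * Λ + 2 * (0 * K))) := by
    have h4 := ENNReal.tendsto_ofReal (tendsto_rpow_neg_atTop (show 0 < p - 1 by linarith))
    rw [neg_sub, ENNReal.ofReal_zero] at h4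
    exact tendsto_const_nhds.add (ENNReal.Tendsto.const_mul
      (ENNReal.Tendsto.mul_const h4 (Or.inr hK)) (Or.inr ENNReal.ofNat_ne_top))
  rw [zero_mul, mul_zero, add_zero] at h3
  exact (limsup_le_limsup h2).trans h3.limsup_eq.le

end RegularTree

end

theorem mainTheorem4 (Γ : RegularTree) (d : ℝ) (hd : Γ.HasGlobalDimension d) (hd2 : d ≠ 2)
    (p : ℝ) (hp : 1 < p) :
    ∃ C : ℝ, 0 < C ∧ ∀ V : Γ.Point → ℝ, AEMeasurable V volume → (∀ x, 0 ≤ V x) →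
      (MemWeakLp (fun x => V x * x.abs ^ 2) p Γ.invAbsMeasure →
        (∀ a : ℝ, 0 < a →
          Γ.FormBoundedBelow (fun x => a * V x) ∧
          IsSelfAdjoint (Γ.schrodinger fun x => a * V x) ∧
          HasFiniteNegativeSpectrum (Γ.schrodinger fun x => a * V x)) ∧
        (∀ a : ℝ, 0 < a → Γ.negCount V a ≤ ENNReal.ofReal (C * a ^ p) *
          ⨆ s : {s : ℝ // 0 < s}, ENNReal.ofReal ((s : ℝ) ^ p) * Γ.levelIntegral V s) ∧
        limsup (fun a : ℝ => ENNReal.ofReal (a ^ (-p)) * Γ.negCount V a) atTop ≤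
          ENNReal.ofReal C *
            limsup (fun s : ℝ => ENNReal.ofReal (s ^ p) * Γ.levelIntegral V s)
              (comap (fun s : ℝ => s + s⁻¹) atTop) ∧
        (Tendsto (fun s : ℝ => ENNReal.ofReal (s ^ p) * Γ.levelIntegral V s)
            (comap (fun s : ℝ => s + s⁻¹) atTop) (𝓝 0) →
          Tendsto (fun a : ℝ => ENNReal.ofReal (a ^ (-p)) * Γ.negCount V a) atTop (𝓝 0))) ∧
      (MemLp (fun x => V x * x.abs ^ 2) (ENNReal.ofReal p) Γ.invAbsMeasure →
        (∀ a : ℝ, 0 < a → Γ.negCount V a ≤ ENNReal.ofReal (C * a ^ p) *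
          ∫⁻ x, ENNReal.ofReal (V x ^ p * x.abs ^ (2 * p - 1))) ∧
        Tendsto (fun a : ℝ => ENNReal.ofReal (a ^ (-p)) * Γ.negCount V a) atTop (𝓝 0)) := by
  obtain ⟨ε, hε, hspec⟩ := hd.exists_spectral hd2
  have hp1 : 0 < p - 1 := by linarith
  have hc : 1 ≤ p / (p - 1) := by rw [le_div_iff₀ hp1]; linarith
  have hεp : 0 < ε ^ (1 - p) := Real.rpow_pos_of_pos hε _
  have hC : 0 < 2 * (p / (p - 1)) * ε ^ (1 - p) := by positivity
  -- The factor `2` comes from the eigenvalue bound, `p/(p-1)` from the layer cake formula and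
  -- `ε^(1-p)` from the threshold `ε/a`.
  refine ⟨2 * (p / (p - 1)) * ε ^ (1 - p), hC, fun V hV hV0 => ?_⟩
  have hf : AEMeasurable (fun x => V x * x.abs ^ 2) Γ.invAbsMeasure :=
    (RegularTree.aemeasurable_mul_abs_sq hV).mono_ac RegularTree.absolutelyContinuous_invAbsMeasure
  have hf0 : ∀ x : Γ.Point, 0 ≤ V x * x.abs ^ 2 := fun x => mul_nonneg (hV0 x) (sq_nonneg _)
  have hmain : ∀ a : ℝ, 0 < a → Γ.tailIntegral V (ε / a) ≠ ∞ →
      Γ.FormBoundedBelow (fun x => a * V x) ∧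
      IsSelfAdjoint (Γ.schrodinger fun x => a * V x) ∧
      HasFiniteNegativeSpectrum (Γ.schrodinger fun x => a * V x) ∧
      Γ.negCount V a ≤ 2 * (ENNReal.ofReal a * Γ.tailIntegral V (ε / a)) := by
    intro a ha hfin
    have h := hspec (fun x => a * V x) (hV.const_mul a) fun x => mul_nonneg ha.le (hV0 x)
    rw [RegularTree.tailIntegral_const_mul V ha] at h
    exact h (ENNReal.mul_ne_top ENNReal.ofReal_ne_top hfin)
  constructor
  · intro hweak
    have hsup := hweak.iSup_lt_top hp hf0
    simp only [RegularTree.levelIntegral_eq]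
    set Λ := ⨆ s : {s : ℝ // 0 < s}, ENNReal.ofReal ((s : ℝ) ^ p) *
      Γ.invAbsMeasure {x | (s : ℝ) < V x * x.abs ^ 2} with hΛ
    have hle : ∀ r : ℝ, 0 < r →
        ENNReal.ofReal (r ^ p) * Γ.invAbsMeasure {x | r < V x * x.abs ^ 2} ≤ Λ := fun r hr =>
      le_iSup (fun s : {s : ℝ // 0 < s} => ENNReal.ofReal ((s : ℝ) ^ p) *
        Γ.invAbsMeasure {x | (s : ℝ) < V x * x.abs ^ 2}) ⟨r, hr⟩
    have htail : ∀ s : ℝ, 0 < s →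
        Γ.tailIntegral V s ≤ ENNReal.ofReal (p / (p - 1) * s ^ (1 - p)) * Λ := by
      intro s hs
      rw [RegularTree.tailIntegral_eq hV]
      exact setLIntegral_lt_le hf hf0 hp hs hsup.ne hle
    have hfin : ∀ s : ℝ, 0 < s → Γ.tailIntegral V s ≠ ∞ := fun s hs =>
      ((htail s hs).trans_lt (ENNReal.mul_lt_top ENNReal.ofReal_lt_top hsup)).ne
    have hlim := RegularTree.limsup_le_of_tail_bound (N := Γ.negCount V) (I := Γ.tailIntegral V)
      (φ := fun r => Γ.invAbsMeasure {x | r < V x * x.abs ^ 2}) (c := p / (p - 1)) hp hε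
      (by positivity) (fun a ha => (hmain a ha (hfin _ (div_pos hε ha))).2.2.2)
      fun Λ' hΛ' δ hδ h => ⟨∫⁻ r in Set.Ioi δ, Γ.invAbsMeasure {x | r < V x * x.abs ^ 2},
        ((setLIntegral_Ioi_le hp hδ hsup.ne fun r hr => hle r (hδ.trans hr)).trans_lt
          (ENNReal.mul_lt_top ENNReal.ofReal_lt_top hsup)).ne, fun s hs hsδ => by
          rw [RegularTree.tailIntegral_eq hV]
          exact setLIntegral_lt_le_of_le hf hf0 hp hs hsδ hΛ' fun r hr hrδ =>
            h r (hs.trans_le hr) hrδ⟩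
    refine ⟨fun a ha => ?_, fun a ha => ?_, hlim, fun h => ?_⟩
    · obtain ⟨h1, h2, h3, -⟩ := hmain a ha (hfin _ (div_pos hε ha))
      exact ⟨h1, h2, h3⟩
    · refine (hmain a ha (hfin _ (div_pos hε ha))).2.2.2.trans ?_
      rw [← RegularTree.two_mul_ofReal_mul ha hε]
      gcongr
      exact htail _ (div_pos hε ha)
    -- A limit determines the upper limit only along a nontrivial filter.
    · have : (comap (fun s : ℝ => s + s⁻¹) atTop).NeBot :=
        neBot_of_le RegularTree.nhdsGT_zero_le_comap_add_inv
      rw [h.limsup_eq, mul_zero] at hlim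
      exact tendsto_of_le_liminf_of_limsup_le bot_le hlim
  · intro hLp
    have hfin : ∫⁻ x, ENNReal.ofReal ((V x * x.abs ^ 2) ^ p) ∂Γ.invAbsMeasure ≠ ∞ := by
      have h := (eLpNorm_lt_top_iff_lintegral_rpow_enorm_lt_top
        (ENNReal.ofReal_pos.2 (by linarith)).ne' ENNReal.ofReal_ne_top).1 hLp.2
      rw [ENNReal.toReal_ofReal (by linarith)] at h
      refine ne_of_lt (lt_of_le_of_lt (le_of_eq (lintegral_congr fun x => ?_)) h)
      rw [Real.enorm_of_nonneg (hf0 x), ENNReal.ofReal_rpow_of_nonneg (hf0 x) (by linarith)]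
    have htail : ∀ s : ℝ, 0 < s → Γ.tailIntegral V s ≤
        ENNReal.ofReal (s ^ (1 - p)) *
          ∫⁻ x, ENNReal.ofReal ((V x * x.abs ^ 2) ^ p) ∂Γ.invAbsMeasure := by
      intro s hs
      rw [RegularTree.tailIntegral_eq hV]
      exact setLIntegral_lt_le_lintegral_rpow hf hp hs
    have hfin' : ∀ s : ℝ, 0 < s → Γ.tailIntegral V s ≠ ∞ := fun s hs =>
      ((htail s hs).trans_lt (ENNReal.mul_lt_top ENNReal.ofReal_lt_top hfin.lt_top)).ne
    have hbound : ∀ a : ℝ, 0 < a →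
        Γ.negCount V a ≤ 2 * (ENNReal.ofReal a * Γ.tailIntegral V (ε / a)) := fun a ha =>
      (hmain a ha (hfin' _ (div_pos hε ha))).2.2.2
    constructor
    · intro a ha
      refine (hbound a ha).trans ?_
      rw [← RegularTree.two_mul_ofReal_mul ha hε,
        ← RegularTree.lintegral_rpow_eq hV hV0 hp]
      gcongr
      -- The `L_p` estimate lacks the factor `p/(p-1)`; as that is at least `1`, the same constant
      -- serves.
      refine (htail _ (div_pos hε ha)).trans ?_
      gcongr
      exact le_mul_of_one_le_left (Real.rpow_nonneg (div_pos hε ha).le _) hc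
    · have h := tendsto_rpow_mul_setLIntegral hf hp hε hfin
      have h2 := ENNReal.Tendsto.const_mul (a := 2) h (Or.inr ENNReal.ofNat_ne_top)
      rw [mul_zero] at h2
      refine tendsto_of_tendsto_of_tendsto_of_le_of_le' tendsto_const_nhds h2
        (Eventually.of_forall fun _ => zero_le) ?_
      filter_upwards [eventually_gt_atTop 0] with a ha
      rw [← RegularTree.tailIntegral_eq hV, ← RegularTree.rpow_mul_two_mul_ofReal ha]
      gcongr
      exact hbound a ha
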